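/- **Setting.** Let $s\ge 1$. An *indefinite $\mathcal S$-manifold* $(\tilde M^{2n+s},\phi,\xi_\alpha,\eta^\alpha,g)$, $\alpha\in\{1,\dots,s\}$, is a smooth manifold with a nowhere vanishing $(1,1)$-tensor field $\phi$, vector fields $\xi_\alpha$ framing $\ker\phi$ and $1$-forms $\eta^\alpha$ such that $\phi^2=-I+\sum_\alpha\eta^\alpha\otimes\xi_\alpha$ and $\eta^\alpha(\xi_\beta)=\delta^\alpha_\beta$, and with a semi-Riemannian metric $g$ and signs $\varepsilon_\alpha=\pm1$ such that $g(\phi X,\phi Y)=g(X,Y)-\sum_\alpha\varepsilon_\alpha\eta^\alpha(X)\eta^\alpha(Y)$, which is normal, i.e. $[\phi,\phi]+2\sum_\alpha d\eta^\alpha\otimes\xi_\alpha=0$, and satisfies $d\eta^\alpha(X,Y)=g(X,\phi Y)$ for every $\alpha$ (with the convention $2\,d\eta(X,Y)=X\eta(Y)-Y\eta(X)-\eta([X,Y])$). A *contact CR-submanifold* of $\tilde M$ is an immersed submanifold $M^m$ on which $g$ induces a nondegenerate metric, which is tangent to all the $\xi_\alpha$, together with a smooth distribution $D$ on $M$ such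 that $TM=D\oplus D^\perp$ is an orthogonal direct sum, $\phi D\subseteq D$, $\phi D^\perp\subseteq TM^\perp$, and at each point each $\xi_\alpha$ lies in $D$ or in $D^\perp$. Let $h$ be the second fundamental form of $M$ in $\tilde M$, and let $H=\{X\in D:\ \eta^\alpha(X)=0\text{ for all }\alpha\}$ be the part of $D$ orthogonal to the $\xi_\alpha$ (so $H=D$ if all the $\xi_\alpha$ lie in $D^\perp$). **Proposition 2.4.** Let $M^m$ be a contact CR-submanifold of an indefinite $\mathcal S$-manifold $\tilde M^{2n+s}$. Then every leaf (connected integral manifold) of $D^\perp$ is totally geodesic in $M$ if and only if $$g\big(h(X,Z),\phi W\big)=0\qquad\text{for all } X\in H \text{ and } Z,W\in D^\perp \text{ (at every point of } M).$$ -/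

import Mathlib

open Bundle Set FiberBundle
open scoped Manifold ContDiff Topology

universe u

noncomputable section

/-! ### Linear algebra of a (possibly indefinite) bilinear form -/

section LinearAlgebra

variable {V : Type*} [AddCommGroup V] [Module ℝ V] [TopologicalSpace V]
  [IsTopologicalAddGroup V] [ContinuousSMul ℝ V]

/-- The orthogonal complement of a subspace `W` with respect to a bilinear form `b`. -/
def orthComplement (b : V →L[ℝ] V →L[ℝ] ℝ) (W : Submodule ℝ V) : Submodule ℝ V where
  carrier := {v | ∀ w ∈ W, b w v = 0}
  add_mem' := by
    intro x y hx hy w hw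
    simp [hx w hw, hy w hw]
  zero_mem' := by
    intro w _
    simp
  smul_mem' := by
    intro c x hx w hw
    simp [hx w hw]

open Classical in
/-- The component of `v` in the orthogonal complement of `W`, with respect to the direct sum
decomposition `V = W ⊕ W^⊥` (this decomposition is available exactly when `b` restricted to `W` is
nondegenerate, in finite dimension; the value is `0` if there is no such decomposition). -/
def normalComponent (b : V →L[ℝ] V →L[ℝ] ℝ) (W : Submodule ℝ V) (v : V) : V :=
  if h : IsCompl (orthComplement b W) W then Submodule.projection (orthComplement b W) W h v else 0

end LinearAlgebra

/-! ### Semi-Riemannian metrics, Levi-Civita connections, second fundamental forms -/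

section Geometry

variable {E : Type*} [NormedAddCommGroup E] [NormedSpace ℝ E]
  {H : Type*} [TopologicalSpace H] (I : ModelWithCorners ℝ E H)
  (M : Type*) [TopologicalSpace M] [ChartedSpace H M]

/-- A field of bilinear forms on the tangent spaces of `M`. -/
abbrev BilinField : Type _ :=
  ∀ x : M, TangentSpace I x →L[ℝ] TangentSpace I x →L[ℝ] ℝ

/-- A smooth semi-Riemannian (pseudo-Riemannian) metric on `M`. -/
structure SemiRiemannianMetric [IsManifold I ∞ M] where
  /-- the scalar product on each tangent space -/
  val : BilinField I M
  symm : ∀ x v w, val x v w = val x w v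
  nondegenerate : ∀ x v, (∀ w, val x v w = 0) → v = 0
  contMDiff : ContMDiff I (I.prod 𝓘(ℝ, E →L[ℝ] E →L[ℝ] ℝ)) ∞
    (fun x ↦ TotalSpace.mk' (E →L[ℝ] E →L[ℝ] ℝ) x (val x))

variable {I M}

/-- `cov` is the Levi-Civita connection of `g`: it is torsion free and compatible with `g`.
The argument order is `cov Y x v = (∇_v Y)(x)`. -/
structure IsLeviCivita [IsManifold I ∞ M]
    (g : BilinField I M) (cov : CovariantDerivative I E (TangentSpace I : M → Type _)) : Prop where
  torsion_free : ∀ (X Y : ∀ x : M, TangentSpace I x) (x : M),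
    MDiffAt (T% X) x → MDiffAt (T% Y) x →
      cov Y x (X x) - cov X x (Y x) = VectorField.mlieBracket I X Y x
  metric : ∀ (Y Z : ∀ x : M, TangentSpace I x) (x : M) (v : TangentSpace I x),
    MDiffAt (T% Y) x → MDiffAt (T% Z) x →
      mvfderiv I (fun y ↦ g y (Y y) (Z y)) x v = g x (cov Y x v) (Z x) + g x (Y x) (cov Z x v)

variable {E' : Type*} [NormedAddCommGroup E'] [NormedSpace ℝ E']
  {H' : Type*} [TopologicalSpace H'] {I' : ModelWithCorners ℝ E' H'}
  {N : Type*} [TopologicalSpace N] [ChartedSpace H' N]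

/-- The bilinear form induced on `N` by a map `f : N → M` and a bilinear form `g` on `M`. -/
def inducedMetric (I' : ModelWithCorners ℝ E' H') (g : BilinField I M) (f : N → M) :
    BilinField I' N :=
  fun p ↦ ContinuousLinearMap.precomp ℝ (mfderiv I' I f p) ∘L g (f p) ∘L mfderiv I' I f p

theorem inducedMetric_apply (g : BilinField I M) (f : N → M) (p : N) (u v : TangentSpace I' p) :
    inducedMetric I' g f p u v = g (f p) (mfderiv I' I f p u) (mfderiv I' I f p v) := rfl

/-- The covariant derivative `(∇_u σ)(p)` of a vector field `σ` *along* a map `f : N → M`, in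
direction `u ∈ T_p N` (that is, the pulled back connection on `f^* TM`). In the local frame `s_i` of
`TM` given by the preferred trivialization at `f p`, one has `σ = ∑ a_i (s_i ∘ f)` and
`∇_u σ = ∑ da_i(u) s_i(f p) + ∑ a_i(p) (∇_{df u} s_i)(f p)`. The first sum is the first term below;
as `extend E (σ p)` is the vector field `∑ a_i(p) s_i` near `f p`, the second sum is the second
term. -/
def covAlong [IsManifold I ∞ M] (I' : ModelWithCorners ℝ E' H')
    (cov : CovariantDerivative I E (TangentSpace I : M → Type _)) (f : N → M)
    (σ : ∀ p : N, TangentSpace I (f p)) (p : N) (u : TangentSpace I' p) : TangentSpace I (f p) :=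
  (trivializationAt E (TangentSpace I : M → Type _) (f p)).symm (f p)
      (mvfderiv I' (fun q ↦ ((trivializationAt E (TangentSpace I : M → Type _) (f p))
        (TotalSpace.mk' E (f q) (σ q))).2) p u)
    + cov (extend E (σ p)) (f p) (mfderiv I' I f p u)

/-- The second fundamental form `h(u, v)` at `p` of an immersion `f : N → M` into a semi-Riemannian
manifold with metric `g` and Levi-Civita connection `cov`: the normal component of `∇_u (df V)`,
for a vector field `V` on `N` extending `v`. -/
def secondFundamentalForm [IsManifold I ∞ M]
    (I' : ModelWithCorners ℝ E' H') [IsManifold I' ∞ N] (g : BilinField I M)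
    (cov : CovariantDerivative I E (TangentSpace I : M → Type _)) (f : N → M)
    (p : N) (u v : TangentSpace I' p) : TangentSpace I (f p) :=
  normalComponent (g (f p)) (LinearMap.range (mfderiv I' I f p).toLinearMap)
    (covAlong I' cov f (fun q ↦ mfderiv I' I f q (extend E' v q)) p u)

/-- A smooth immersion. -/
structure IsSmoothImmersion (I' : ModelWithCorners ℝ E' H') (I : ModelWithCorners ℝ E H)
    (f : N → M) : Prop where
  contMDiff : ContMDiff I' I ∞ f
  injective_mfderiv : ∀ p, Function.Injective (mfderiv I' I f p)

/-- A smooth distribution: a field of subspaces of the tangent spaces that is locally spanned by a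
smooth frame. -/
def IsSmoothDistribution [IsManifold I ∞ M] (D : ∀ x : M, Submodule ℝ (TangentSpace I x)) : Prop :=
  ∀ x : M, ∃ U : Set M, IsOpen U ∧ x ∈ U ∧
    ∃ (r : ℕ) (X : Fin r → ∀ y : M, TangentSpace I y),
      (∀ i, CMDiff[U] ∞ (T% (X i))) ∧
      ∀ y ∈ U, LinearIndependent ℝ (fun i ↦ X i y) ∧ Submodule.span ℝ (range fun i ↦ X i y) = D y

/-- The orthogonal complementary distribution. -/
def orthDistribution (g : BilinField I M) (D : ∀ x : M, Submodule ℝ (TangentSpace I x)) (x : M) :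
    Submodule ℝ (TangentSpace I x) :=
  orthComplement (g x) (D x)

/-- `j : N → M` is a leaf, i.e. a connected integral manifold, of the distribution `D` on `M`:
`N` is connected and `j` is an injective immersion with `dj (T_y N) = D (j y)` for all `y`. -/
structure IsLeaf (I' : ModelWithCorners ℝ E' H')
    (D : ∀ x : M, Submodule ℝ (TangentSpace I x)) (j : N → M) : Prop where
  connected : ConnectedSpace N
  immersion : IsSmoothImmersion I' I j
  injective : Function.Injective j
  tangent : ∀ y, LinearMap.range (mfderiv I' I j y).toLinearMap = D (j y)

end Geometry

/-- Every leaf of the distribution `D` is totally geodesic in `M` (equipped with the metric `g` and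
its Levi-Civita connection `cov`), i.e. its second fundamental form in `M` vanishes. -/
def LeavesTotallyGeodesic {m : ℕ} {M : Type u} [TopologicalSpace M]
    [ChartedSpace (EuclideanSpace ℝ (Fin m)) M] [IsManifold (𝓡 m) ∞ M]
    (g : BilinField (𝓡 m) M)
    (cov : CovariantDerivative (𝓡 m) (EuclideanSpace ℝ (Fin m))
      (TangentSpace (𝓡 m) : M → Type _))
    (D : ∀ x : M, Submodule ℝ (TangentSpace (𝓡 m) x)) : Prop :=
  ∀ (q : ℕ) (N : Type u) [TopologicalSpace N] [ChartedSpace (EuclideanSpace ℝ (Fin q)) N]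
    [IsManifold (𝓡 q) ∞ N] (j : N → M), IsLeaf (𝓡 q) D j →
      ∀ (y : N) (w z : TangentSpace (𝓡 q) y),
        secondFundamentalForm (𝓡 q) g cov j y w z = 0

/-! ### Indefinite S-manifolds -/

section SManifold

variable {E : Type*} [NormedAddCommGroup E] [NormedSpace ℝ E]
  {H : Type*} [TopologicalSpace H] (I : ModelWithCorners ℝ E H)
  (M : Type*) [TopologicalSpace M] [ChartedSpace H M]

/-- The exterior derivative `dη(X, Y)` of a 1-form, evaluated at vector fields, with the convention
`2 dη(X, Y) = X(η(Y)) - Y(η(X)) - η([X, Y])` usual in contact geometry. -/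
def extDerivOneForm {I : ModelWithCorners ℝ E H} {M : Type*} [TopologicalSpace M]
    [ChartedSpace H M] (η : ∀ x : M, TangentSpace I x →L[ℝ] ℝ)
    (X Y : ∀ x : M, TangentSpace I x) (x : M) : ℝ :=
  (1 / 2) * (mvfderiv I (fun y ↦ η y (Y y)) x (X x) - mvfderiv I (fun y ↦ η y (X y)) x (Y x)
    - η x (VectorField.mlieBracket I X Y x))

/-- The Nijenhuis torsion `[φ, φ](X, Y) = φ²[X, Y] + [φX, φY] - φ[φX, Y] - φ[X, φY]`. -/
def nijenhuis {I : ModelWithCorners ℝ E H} {M : Type*} [TopologicalSpace M] [ChartedSpace H M]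
    (φ : ∀ x : M, TangentSpace I x →L[ℝ] TangentSpace I x)
    (X Y : ∀ x : M, TangentSpace I x) (x : M) : TangentSpace I x :=
  φ x (φ x (VectorField.mlieBracket I X Y x))
    + VectorField.mlieBracket I (fun y ↦ φ y (X y)) (fun y ↦ φ y (Y y)) x
    - φ x (VectorField.mlieBracket I (fun y ↦ φ y (X y)) Y x)
    - φ x (VectorField.mlieBracket I X (fun y ↦ φ y (Y y)) x)

/-- A globally framed `f`-structure on `M`: a nowhere vanishing smooth `(1,1)`-tensor field `φ`,
smooth vector fields `ξ_1, …, ξ_s` in the kernel of `φ` and smooth 1-forms `η^1, …, η^s` such that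
`φ² = -I + ∑ η^α ⊗ ξ_α` and `η^α(ξ_β) = δ^α_β`. (It follows that the `ξ_α` frame `ker φ`, so that
`φ` has constant rank.) -/
structure FramedFStructure (s : ℕ) [IsManifold I ∞ M] where
  φ : ∀ x : M, TangentSpace I x →L[ℝ] TangentSpace I x
  ξ : Fin s → ∀ x : M, TangentSpace I x
  η : Fin s → ∀ x : M, TangentSpace I x →L[ℝ] ℝ
  contMDiff_φ : ContMDiff I (I.prod 𝓘(ℝ, E →L[ℝ] E)) ∞
    (fun x ↦ TotalSpace.mk' (E →L[ℝ] E) (E := fun x : M ↦ TangentSpace I x →L[ℝ] TangentSpace I x)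
      x (φ x))
  contMDiff_ξ : ∀ α, CMDiff ∞ (T% (ξ α))
  contMDiff_η : ∀ α, ContMDiff I (I.prod 𝓘(ℝ, E →L[ℝ] ℝ)) ∞
    (fun x ↦ TotalSpace.mk' (E →L[ℝ] ℝ) (E := fun x : M ↦ TangentSpace I x →L[ℝ] ℝ) x (η α x))
  φ_ne_zero : ∀ x, φ x ≠ 0
  φ_sq : ∀ x v, φ x (φ x v) = -v + ∑ α, η α x v • ξ α x
  φ_ξ : ∀ α x, φ x (ξ α x) = 0
  η_ξ : ∀ α β x, η α x (ξ β x) = if α = β then 1 else 0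

/-- An indefinite S-structure on `M`: a globally framed `f`-structure together with a
semi-Riemannian metric `g` and signs `ε_α = ±1` such that
`g(φX, φY) = g(X, Y) - ∑ ε_α η^α(X) η^α(Y)` (so that `g(X, ξ_α) = ε_α η^α(X)`, and `ε_α` is the
causal character of `ξ_α`), which is normal, `[φ, φ] + 2 ∑ dη^α ⊗ ξ_α = 0`, and satisfies
`dη^α = Φ` for every `α`, where `Φ(X, Y) = g(X, φY)`. -/
structure IndefiniteSStructure (s : ℕ) [IsManifold I ∞ M] extends FramedFStructure I M s where
  metric : SemiRiemannianMetric I M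
  ε : Fin s → ℝ
  ε_eq : ∀ α, ε α = 1 ∨ ε α = -1
  compatible : ∀ x v w, metric.val x (φ x v) (φ x w) =
    metric.val x v w - ∑ α, ε α * (η α x v * η α x w)
  normal : ∀ (X Y : ∀ x : M, TangentSpace I x) (x : M),
    MDiffAt (T% X) x → MDiffAt (T% Y) x →
      nijenhuis φ X Y x + (2 : ℝ) • ∑ α, extDerivOneForm (η α) X Y x • ξ α x = 0
  dη_eq : ∀ (α : Fin s) (X Y : ∀ x : M, TangentSpace I x) (x : M),
    MDiffAt (T% X) x → MDiffAt (T% Y) x →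
      extDerivOneForm (η α) X Y x = metric.val x (X x) (φ x (Y x))

end SManifold

/-! ### Contact CR-submanifolds -/

section ContactCR

variable {E : Type*} [NormedAddCommGroup E] [NormedSpace ℝ E]
  {H : Type*} [TopologicalSpace H] {I : ModelWithCorners ℝ E H}
  {M : Type*} [TopologicalSpace M] [ChartedSpace H M] [IsManifold I ∞ M]
  {E' : Type*} [NormedAddCommGroup E'] [NormedSpace ℝ E']
  {H' : Type*} [TopologicalSpace H'] {I' : ModelWithCorners ℝ E' H'}
  {N : Type*} [TopologicalSpace N] [ChartedSpace H' N] [IsManifold I' ∞ N]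
  {s : ℕ}

/-- `f : N → M` is an (immersed, nondegenerate) contact CR-submanifold of the indefinite S-manifold
`M`, with `φ`-invariant distribution `D`. Nondegeneracy of the induced metric and of its restriction
to `D` express the decompositions `TM = TN ⊕ TN^⊥` and `TN = D ⊕ D^⊥`. -/
structure IsContactCRSubmanifold (S : IndefiniteSStructure I M s) (f : N → M)
    (D : ∀ p : N, Submodule ℝ (TangentSpace I' p)) : Prop where
  immersion : IsSmoothImmersion I' I f
  nondegenerate : ∀ (p : N) (u : TangentSpace I' p),
    (∀ v, inducedMetric I' S.metric.val f p u v = 0) → u = 0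
  smooth : IsSmoothDistribution D
  isCompl : ∀ p, IsCompl (D p) (orthDistribution (inducedMetric I' S.metric.val f) D p)
  /-- `N` is tangent to every `ξ_α`, and `ξ_α` lies in `D` or in `D^⊥` -/
  tangent_ξ : ∀ (α : Fin s) (p : N), ∃ u : TangentSpace I' p,
    mfderiv I' I f p u = S.ξ α (f p) ∧
      (u ∈ D p ∨ u ∈ orthDistribution (inducedMetric I' S.metric.val f) D p)
  /-- `φ D ⊆ D` -/
  invariant : ∀ p, ∀ u ∈ D p, ∃ v ∈ D p, mfderiv I' I f p v = S.φ (f p) (mfderiv I' I f p u)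
  /-- `φ D^⊥ ⊆ TN^⊥` -/
  anti_invariant : ∀ p, ∀ z ∈ orthDistribution (inducedMetric I' S.metric.val f) D p,
    ∀ u : TangentSpace I' p,
      S.metric.val (f p) (S.φ (f p) (mfderiv I' I f p z)) (mfderiv I' I f p u) = 0

end ContactCR

end

noncomputable section

set_option linter.unusedSectionVars false

section Calculus

variable {E : Type*} [NormedAddCommGroup E] [NormedSpace ℝ E]
  {M : Type*} [TopologicalSpace M] [ChartedSpace E M]
  {E' : Type*} [NormedAddCommGroup E'] [NormedSpace ℝ E']
  {M' : Type*} [TopologicalSpace M'] [ChartedSpace E' M']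
  {F G : Type*} [NormedAddCommGroup F] [NormedSpace ℝ F] [NormedAddCommGroup G] [NormedSpace ℝ G]

theorem mvfderiv_clm_apply {c : M → F →L[ℝ] G} {u : M → F} {p : M}
    (hc : MDifferentiableAt 𝓘(ℝ, E) 𝓘(ℝ, F →L[ℝ] G) c p)
    (hu : MDifferentiableAt 𝓘(ℝ, E) 𝓘(ℝ, F) u p) (v : TangentSpace 𝓘(ℝ, E) p) :
    mvfderiv 𝓘(ℝ, E) (fun q ↦ c q (u q)) p v =
      mvfderiv 𝓘(ℝ, E) c p v (u p) + c p (mvfderiv 𝓘(ℝ, E) u p v) := by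
  have hcu : MDifferentiableAt 𝓘(ℝ, E) 𝓘(ℝ, G) (fun q ↦ c q (u q)) p := hc.clm_apply hu
  have h1 := hc.hasMFDerivAt.2
  have h2 := hu.hasMFDerivAt.2
  have h3 := h1.clm_apply h2
  have h4 : HasMFDerivAt 𝓘(ℝ, E) 𝓘(ℝ, G) (fun q ↦ c q (u q)) p _ := ⟨hcu.continuousAt, h3⟩
  have h5 := h4.mfderiv
  have h6 : mvfderiv 𝓘(ℝ, E) (fun q ↦ c q (u q)) p v =
    mfderiv 𝓘(ℝ, E) 𝓘(ℝ, G) (fun q ↦ c q (u q)) p v := rfl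
  rw [h6, h5]
  simp [writtenInExtChartAt, extChartAt]
  rw [add_comm]
  rfl

theorem mvfderiv_fun_comp_apply {g : M' → F} {f : M → M'} {p : M}
    (hg : MDifferentiableAt 𝓘(ℝ, E') 𝓘(ℝ, F) g (f p))
    (hf : MDifferentiableAt 𝓘(ℝ, E) 𝓘(ℝ, E') f p) (v : TangentSpace 𝓘(ℝ, E) p) :
    mvfderiv 𝓘(ℝ, E) (fun q ↦ g (f q)) p v =
      mvfderiv 𝓘(ℝ, E') g (f p) (mfderiv 𝓘(ℝ, E) 𝓘(ℝ, E') f p v) := by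
  have := mfderiv_comp p hg hf
  exact congrArg (fun L ↦ L v) this

theorem mvfderiv_congr_of_eventuallyEq {g h : M → F} {p : M} (hgh : g =ᶠ[𝓝 p] h) :
    mvfderiv 𝓘(ℝ, E) g p = mvfderiv 𝓘(ℝ, E) h p := by
  have h1 := hgh.mfderiv_eq (I := 𝓘(ℝ, E)) (I' := 𝓘(ℝ, F))
  exact h1

theorem mvfderiv_eq_zero_of_eventuallyEq_const {g : M → F} {p : M} {c : F}
    (h : ∀ᶠ q in 𝓝 p, g q = c) (v : TangentSpace 𝓘(ℝ, E) p) :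
    mvfderiv 𝓘(ℝ, E) g p v = 0 := by
  rw [mvfderiv_congr_of_eventuallyEq (h := fun _ ↦ c) h, mvfderiv_const]
  rfl

theorem mvfderiv_clm_const_apply {u : M → F} {p : M} (L : F →L[ℝ] G)
    (hu : MDifferentiableAt 𝓘(ℝ, E) 𝓘(ℝ, F) u p) (v : TangentSpace 𝓘(ℝ, E) p) :
    mvfderiv 𝓘(ℝ, E) (fun q ↦ L (u q)) p v = L (mvfderiv 𝓘(ℝ, E) u p v) := by
  have h := mvfderiv_clm_apply (c := fun _ : M ↦ L) mdifferentiableAt_const hu v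
  rw [h, mvfderiv_const]
  simp

theorem mdifferentiableAt_clm_of_apply [FiniteDimensional ℝ F] {c : M → F →L[ℝ] G} {p : M}
    (h : ∀ a, MDifferentiableAt 𝓘(ℝ, E) 𝓘(ℝ, G) (fun q ↦ c q a) p) :
    MDifferentiableAt 𝓘(ℝ, E) 𝓘(ℝ, F →L[ℝ] G) c p := by
  let b := Module.finBasis ℝ F
  have hc : c = fun q ↦ ∑ i, (ContinuousLinearMap.smulRightL ℝ F G
      (LinearMap.toContinuousLinearMap (b.coord i))) (c q (b i)) := by
    funext q
    ext v
    conv_lhs => rw [← b.sum_repr v, map_sum]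
    simp
  rw [hc]
  have := MDifferentiableAt.sum (I := 𝓘(ℝ, E)) (z := p) (t := Finset.univ) (f := fun i q ↦
    (ContinuousLinearMap.smulRightL ℝ F G
      (LinearMap.toContinuousLinearMap (b.coord i))) (c q (b i))) fun i _ ↦ ?_
  · convert! this using 1
    funext q
    simp
  exact (ContinuousLinearMap.mdifferentiableAt _).comp p (h (b i))

theorem contMDiffAt_clm_of_apply [FiniteDimensional ℝ F] {c : M → F →L[ℝ] G} {p : M}
    {n : WithTop ℕ∞} (h : ∀ a, ContMDiffAt 𝓘(ℝ, E) 𝓘(ℝ, G) n (fun q ↦ c q a) p) :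
    ContMDiffAt 𝓘(ℝ, E) 𝓘(ℝ, F →L[ℝ] G) n c p := by
  let b := Module.finBasis ℝ F
  have hc : c = fun q ↦ ∑ i, (ContinuousLinearMap.smulRightL ℝ F G
      (LinearMap.toContinuousLinearMap (b.coord i))) (c q (b i)) := by
    funext q
    ext v
    conv_lhs => rw [← b.sum_repr v, map_sum]
    simp
  rw [hc]
  refine contMDiffAt_finsetSum fun i _ ↦ ?_
  exact (ContinuousLinearMap.contMDiffAt _).comp p (h (b i))

end Calculus

section Frames

variable {E : Type*} [NormedAddCommGroup E] [NormedSpace ℝ E]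
  {M : Type*} [TopologicalSpace M] [ChartedSpace E M] [IsManifold 𝓘(ℝ, E) ∞ M]

/-- The coordinates of tangent vectors at `y` in the preferred trivialization at `p`. -/
def tangentCoord (p y : M) : TangentSpace 𝓘(ℝ, E) y →L[ℝ] E :=
  (trivializationAt E (TangentSpace 𝓘(ℝ, E)) p).continuousLinearMapAt ℝ y

/-- The coordinate frame at `y` of the preferred trivialization at `p`. -/
def coordFrame (p y : M) : E →L[ℝ] TangentSpace 𝓘(ℝ, E) y :=
  (trivializationAt E (TangentSpace 𝓘(ℝ, E)) p).symmL ℝ y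

theorem tangentCoord_coordFrame {p y : M} (hy : y ∈ (chartAt E p).source) (a : E) :
    tangentCoord p y (coordFrame p y a) = a :=
  (trivializationAt E (TangentSpace 𝓘(ℝ, E)) p).continuousLinearMapAt_symmL
    (show y ∈ (trivializationAt E (TangentSpace 𝓘(ℝ, E)) p).baseSet from hy) a

theorem coordFrame_tangentCoord {p y : M} (hy : y ∈ (chartAt E p).source)
    (v : TangentSpace 𝓘(ℝ, E) y) : coordFrame p y (tangentCoord p y v) = v :=
  (trivializationAt E (TangentSpace 𝓘(ℝ, E)) p).symmL_continuousLinearMapAt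
    (show y ∈ (trivializationAt E (TangentSpace 𝓘(ℝ, E)) p).baseSet from hy) v

theorem trivializationAt_snd_eq_tangentCoord {p y : M} (hy : y ∈ (chartAt E p).source)
    (v : TangentSpace 𝓘(ℝ, E) y) :
    (trivializationAt E (TangentSpace 𝓘(ℝ, E) : M → Type _) p (TotalSpace.mk' E y v)).2 =
      tangentCoord p y v := by
  have hy' : y ∈ (trivializationAt E (TangentSpace 𝓘(ℝ, E)) p).baseSet := hy
  unfold tangentCoord
  rw [Trivialization.continuousLinearMapAt_apply, Trivialization.coe_linearMapAt_of_mem _ hy']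

theorem extend_eq_coordFrame {p : M} (v : TangentSpace 𝓘(ℝ, E) p) {y : M}
    (hy : y ∈ (chartAt E p).source) :
    extend E v y = coordFrame p y (tangentCoord p p v) := by
  unfold extend
  rw [← trivializationAt_snd_eq_tangentCoord (mem_chart_source E p)]
  exact ((trivializationAt E (TangentSpace 𝓘(ℝ, E)) p).symmL_apply (R := ℝ) (b := y) hy _).symm

omit [NormedSpace ℝ E] [IsManifold 𝓘(ℝ, E) ∞ M] in
theorem chartAt_source_mem_nhds {p y : M} (hy : y ∈ (chartAt E p).source) :
    (chartAt E p).source ∈ 𝓝 y := (chartAt E p).open_source.mem_nhds hy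

theorem tangentCoord_eq_mfderiv {p y : M} (hy : y ∈ (chartAt E p).source) :
    tangentCoord p y = mfderiv 𝓘(ℝ, E) 𝓘(ℝ, E) (chartAt E p) y := by
  have := TangentBundle.continuousLinearMapAt_trivializationAt (I := 𝓘(ℝ, E)) hy
  simpa [tangentCoord, extChartAt] using this

theorem contMDiffAt_coordFrame {p y : M} (hy : y ∈ (chartAt E p).source) (a : E) :
    ContMDiffAt 𝓘(ℝ, E) 𝓘(ℝ, E).tangent ∞
      (fun q ↦ TotalSpace.mk' E q (coordFrame p q a)) y := by
  have hy' : y ∈ (trivializationAt E (TangentSpace 𝓘(ℝ, E)) p).baseSet := hy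
  refine ((trivializationAt E (TangentSpace 𝓘(ℝ, E)) p).contMDiffAt_section_iff hy').2 ?_
  refine contMDiffAt_const (c := a) |>.congr_of_eventuallyEq ?_
  filter_upwards [chartAt_source_mem_nhds hy] with q hq
  rw [trivializationAt_snd_eq_tangentCoord hq, tangentCoord_coordFrame hq]

theorem mdifferentiableAt_coordFrame {p y : M} (hy : y ∈ (chartAt E p).source) (a : E) :
    MDifferentiableAt 𝓘(ℝ, E) 𝓘(ℝ, E).tangent
      (fun q ↦ TotalSpace.mk' E q (coordFrame p q a)) y :=
  (contMDiffAt_coordFrame hy a).mdifferentiableAt (by simp)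

/-- The derivative of a function along a coordinate field. -/
theorem mvfderiv_coordFrame {F : Type*} [NormedAddCommGroup F] [NormedSpace ℝ F]
    {p y : M} (hy : y ∈ (chartAt E p).source) {ψ : M → F}
    (hψ : MDifferentiableAt 𝓘(ℝ, E) 𝓘(ℝ, F) ψ y) (a : E) :
    mvfderiv 𝓘(ℝ, E) ψ y (coordFrame p y a) =
      fderiv ℝ (ψ ∘ (chartAt E p).symm) (chartAt E p y) a := by
  have hy2 : (chartAt E p) y ∈ (chartAt E p).target := (chartAt E p).map_source hy
  have h1 : MDifferentiableAt 𝓘(ℝ, E) 𝓘(ℝ, F) (ψ ∘ (chartAt E p).symm) (chartAt E p y) := by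
    refine MDifferentiableAt.comp (I' := 𝓘(ℝ, E)) _ ?_
      (mdifferentiableAt_atlas_symm (chart_mem_atlas E p) hy2)
    rwa [(chartAt E p).left_inv hy]
  have h2 : MDifferentiableAt 𝓘(ℝ, E) 𝓘(ℝ, E) (chartAt E p) y :=
    mdifferentiableAt_atlas (chart_mem_atlas E p) hy
  have h3 : ψ =ᶠ[𝓝 y] fun q ↦ (ψ ∘ (chartAt E p).symm) (chartAt E p q) := by
    filter_upwards [chartAt_source_mem_nhds hy] with q hq
    simp [(chartAt E p).left_inv hq]
  rw [mvfderiv_congr_of_eventuallyEq h3, mvfderiv_fun_comp_apply h1 h2, ← tangentCoord_eq_mfderiv hy]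
  refine (congrArg _ (tangentCoord_coordFrame hy a)).trans ?_
  unfold mvfderiv
  rw [mfderiv_eq_fderiv]
  rfl

/-- The constant vector field on a vector space. -/
def constField (c : E) (x : E) : TangentSpace 𝓘(ℝ, E) x := c

theorem mdifferentiableAt_constField (c x : E) :
    MDifferentiableAt 𝓘(ℝ, E) 𝓘(ℝ, E).tangent
      (fun x : E ↦ TotalSpace.mk' E x (constField c x)) x :=
  ((contMDiffAt_vectorSpace_iff_contDiffAt (n := ∞) (V := constField c)).2
    contDiffAt_const).mdifferentiableAt (by simp)

theorem mpullback_constField {p q : M} (hq : q ∈ (chartAt E p).source) (c : E) :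
    VectorField.mpullback 𝓘(ℝ, E) 𝓘(ℝ, E) (chartAt E p) (constField c) q = coordFrame p q c := by
  rw [VectorField.mpullback_apply, ← tangentCoord_eq_mfderiv (E := E) hq]
  have : ContinuousLinearMap.inverse (tangentCoord (E := E) p q) = coordFrame p q := by
    refine ContinuousLinearMap.inverse_eq ?_ ?_
    · ext v
      exact tangentCoord_coordFrame hq v
    · ext v
      exact coordFrame_tangentCoord hq v
  exact congrArg (fun L ↦ L c) this

/-- Coordinate fields commute. -/
theorem mlieBracket_coordFrame [CompleteSpace E] {p y : M} (hy : y ∈ (chartAt E p).source)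
    (a b : E) :
    VectorField.mlieBracket 𝓘(ℝ, E) (fun q : M ↦ coordFrame p q a) (fun q ↦ coordFrame p q b) y
      = 0 := by
  have ev : ∀ c : E, (fun q : M ↦ coordFrame p q c) =ᶠ[𝓝 y]
      VectorField.mpullback 𝓘(ℝ, E) 𝓘(ℝ, E) (chartAt E p) (constField c) := by
    intro c
    filter_upwards [chartAt_source_mem_nhds hy] with q hq
    exact (mpullback_constField hq c).symm
  rw [(ev a).mlieBracket_vectorField_eq (ev b)]
  have : IsManifold 𝓘(ℝ, E) (minSmoothness ℝ 2) M := by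
    rw [minSmoothness_of_isRCLikeNormedField]
    infer_instance
  have : IsManifold 𝓘(ℝ, E) (minSmoothness ℝ 3) M := by
    rw [minSmoothness_of_isRCLikeNormedField]
    infer_instance
  rw [← VectorField.mpullback_mlieBracket (n := ∞) (mdifferentiableAt_constField a _)
    (mdifferentiableAt_constField b _)
    (contMDiffAt_of_mem_maximalAtlas (IsManifold.chart_mem_maximalAtlas p) hy)
      (by rw [minSmoothness_of_isRCLikeNormedField]; exact WithTop.coe_le_coe.2 le_top)]
  rw [VectorField.mpullback_apply, ← VectorField.mlieBracketWithin_univ,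
    VectorField.mlieBracketWithin_eq_lieBracketWithin]
  have : VectorField.lieBracketWithin ℝ (fun _ : E ↦ a) (fun _ ↦ b) univ (chartAt E p y) = 0 := by
    simp [VectorField.lieBracketWithin]
  exact (congrArg _ this).trans (map_zero _)

end Frames

section AlongMap

variable {E : Type*} [NormedAddCommGroup E] [NormedSpace ℝ E]
  {M : Type*} [TopologicalSpace M] [ChartedSpace E M] [IsManifold 𝓘(ℝ, E) ∞ M]
  {F : Type*} [NormedAddCommGroup F] [NormedSpace ℝ F]
  {N : Type*} [TopologicalSpace N] [ChartedSpace F N]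

variable (F) in
/-- Differentiability at a point of a vector field along a map. -/
def DiffAlong (f : N → M) (σ : ∀ q : N, TangentSpace 𝓘(ℝ, E) (f q)) (p : N) : Prop :=
  MDifferentiableAt 𝓘(ℝ, F) 𝓘(ℝ, E).tangent (fun q ↦ TotalSpace.mk' E (f q) (σ q)) p

omit [NormedSpace ℝ E] [IsManifold 𝓘(ℝ, E) ∞ M] in
theorem eventually_mem_chart_source {f : N → M} {p : N} (hf : ContinuousAt f p) :
    ∀ᶠ q in 𝓝 p, f q ∈ (chartAt E (f p)).source :=
  hf.eventually_mem (chart_source_mem_nhds E (f p))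

theorem diffAlong_iff {f : N → M} {σ : ∀ q : N, TangentSpace 𝓘(ℝ, E) (f q)} {p : N}
    (hf : MDifferentiableAt 𝓘(ℝ, F) 𝓘(ℝ, E) f p) :
    DiffAlong F f σ p ↔ MDifferentiableAt 𝓘(ℝ, F) 𝓘(ℝ, E)
      (fun q ↦ tangentCoord (f p) (f q) (σ q)) p := by
  have h1 := mdifferentiableAt_totalSpace (IB := 𝓘(ℝ, E)) (IM := 𝓘(ℝ, F))
    (fun q ↦ TotalSpace.mk' E (E := (TangentSpace 𝓘(ℝ, E) : M → Type _)) (f q) (σ q)) (x₀ := p)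
  have h2 : (fun q ↦ (trivializationAt E (TangentSpace 𝓘(ℝ, E) : M → Type _) (f p)
      (TotalSpace.mk' E (f q) (σ q))).2) =ᶠ[𝓝 p] fun q ↦ tangentCoord (f p) (f q) (σ q) := by
    filter_upwards [eventually_mem_chart_source (E := E) hf.continuousAt] with q hq
    exact trivializationAt_snd_eq_tangentCoord (E := E) hq _
  constructor
  · intro h
    exact (h1.1 h).2.congr_of_eventuallyEq h2.symm
  · intro h
    exact h1.2 ⟨hf, h.congr_of_eventuallyEq h2⟩

theorem DiffAlong.coord {f : N → M} {σ : ∀ q : N, TangentSpace 𝓘(ℝ, E) (f q)} {p : N}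
    (h : DiffAlong F f σ p) (hf : MDifferentiableAt 𝓘(ℝ, F) 𝓘(ℝ, E) f p) :
    MDifferentiableAt 𝓘(ℝ, F) 𝓘(ℝ, E) (fun q ↦ tangentCoord (f p) (f q) (σ q)) p :=
  (diffAlong_iff hf).1 h

theorem mdifferentiableAt_tangentCoord {X : ∀ q : M, TangentSpace 𝓘(ℝ, E) q} {p : M}
    (h : MDifferentiableAt 𝓘(ℝ, E) 𝓘(ℝ, E).tangent (fun q ↦ TotalSpace.mk' E q (X q)) p) :
    MDifferentiableAt 𝓘(ℝ, E) 𝓘(ℝ, E) (fun q ↦ tangentCoord p q (X q)) p :=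
  DiffAlong.coord (F := E) (f := fun q : M ↦ q) h mdifferentiableAt_id

theorem DiffAlong.of_field {f : N → M} {X : ∀ q : M, TangentSpace 𝓘(ℝ, E) q} {p : N}
    (hX : MDifferentiableAt 𝓘(ℝ, E) 𝓘(ℝ, E).tangent (fun q ↦ TotalSpace.mk' E q (X q)) (f p))
    (hf : MDifferentiableAt 𝓘(ℝ, F) 𝓘(ℝ, E) f p) :
    DiffAlong F f (fun q ↦ X (f q)) p :=
  MDifferentiableAt.comp p hX hf

variable [IsManifold 𝓘(ℝ, F) ∞ N]

theorem DiffAlong.mfderiv_field {f : N → M} (hf : ContMDiff 𝓘(ℝ, F) 𝓘(ℝ, E) ∞ f)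
    {Y : ∀ q : N, TangentSpace 𝓘(ℝ, F) q} {p : N}
    (hY : MDifferentiableAt 𝓘(ℝ, F) 𝓘(ℝ, F).tangent (fun q ↦ TotalSpace.mk' F q (Y q)) p) :
    DiffAlong F f (fun q ↦ mfderiv 𝓘(ℝ, F) 𝓘(ℝ, E) f q (Y q)) p := by
  have h := hf.contMDiff_tangentMap (m := ∞) le_rfl
  exact ((h.mdifferentiable (by simp)) _).comp p hY

end AlongMap

section Connection

variable {E : Type*} [NormedAddCommGroup E] [NormedSpace ℝ E] [FiniteDimensional ℝ E]
  {M : Type*} [TopologicalSpace M] [ChartedSpace E M] [IsManifold 𝓘(ℝ, E) ∞ M]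
  {F : Type*} [NormedAddCommGroup F] [NormedSpace ℝ F]
  {N : Type*} [TopologicalSpace N] [ChartedSpace F N]
  (cov : CovariantDerivative 𝓘(ℝ, E) E (TangentSpace 𝓘(ℝ, E) : M → Type _))

/-- The covariant derivatives at `p` of the coordinate fields at `p`. -/
def christoffel (p : M) (a : E) : TangentSpace 𝓘(ℝ, E) p →L[ℝ] TangentSpace 𝓘(ℝ, E) p :=
  cov (fun q ↦ coordFrame p q a) p

variable {cov}

omit [FiniteDimensional ℝ E] in
theorem cov_congr {X Y : ∀ q : M, TangentSpace 𝓘(ℝ, E) q} {p : M}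
    (hX : MDifferentiableAt 𝓘(ℝ, E) 𝓘(ℝ, E).tangent (fun q ↦ TotalSpace.mk' E q (X q)) p)
    (h : ∀ᶠ q in 𝓝 p, Y q = X q) : cov Y p = cov X p := by
  refine cov.isCovariantDerivativeOnUniv.congr_of_eventuallyEq ?_ hX Filter.univ_mem h
  exact hX.congr_of_eventuallyEq (h.mono fun q hq ↦ by simp only [hq])

omit [FiniteDimensional ℝ E] in
theorem cov_extend (p : M) (v : TangentSpace 𝓘(ℝ, E) p) :
    cov (extend E v) p = christoffel cov p (tangentCoord p p v) := by
  refine cov_congr (mdifferentiableAt_coordFrame (mem_chart_source E p) _) ?_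
  filter_upwards [chart_source_mem_nhds E p] with q hq
  exact extend_eq_coordFrame v hq

/-- A covariant derivative in coordinates. -/
theorem cov_apply_eq {X : ∀ q : M, TangentSpace 𝓘(ℝ, E) q} {p : M}
    (hX : MDifferentiableAt 𝓘(ℝ, E) 𝓘(ℝ, E).tangent (fun q ↦ TotalSpace.mk' E q (X q)) p)
    (u : TangentSpace 𝓘(ℝ, E) p) :
    cov X p u = coordFrame p p (mvfderiv 𝓘(ℝ, E) (fun q ↦ tangentCoord p q (X q)) p u) +
      christoffel cov p (tangentCoord p p (X p)) u := by
  let Φ : (∀ q : M, TangentSpace 𝓘(ℝ, E) q) → TangentSpace 𝓘(ℝ, E) p := fun X ↦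
    cov X p u - coordFrame p p (mvfderiv 𝓘(ℝ, E) (fun q ↦ tangentCoord p q (X q)) p u)
  have hΦ : TensorialAt 𝓘(ℝ, E) E Φ p := by
    constructor
    · intro h σ hh hσ
      have h1 := cov.isCovariantDerivativeOnUniv.leibniz hσ hh
      have h2 := mdifferentiableAt_tangentCoord hσ
      have h3 : (fun q ↦ tangentCoord p q ((h • σ) q)) = h • fun q ↦ tangentCoord p q (σ q) := by
        funext q
        simp
      simp only [Φ]
      rw [h1, h3, mvfderiv_smul hh h2]
      simp only [_root_.add_apply, _root_.smul_apply,
        ContinuousLinearMap.smulRight_apply, map_add, map_smul,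
        coordFrame_tangentCoord (mem_chart_source E p)]
      module
    · intro σ τ hσ hτ
      have h1 := cov.isCovariantDerivativeOnUniv.add hσ hτ
      have h3 : (fun q ↦ tangentCoord p q ((σ + τ) q)) =
          (fun q ↦ tangentCoord p q (σ q)) + fun q ↦ tangentCoord p q (τ q) := by
        funext q
        simp
      simp only [Φ]
      rw [h1, h3, mvfderiv_add (mdifferentiableAt_tangentCoord hσ)
        (mdifferentiableAt_tangentCoord hτ)]
      simp only [_root_.add_apply, map_add]
      module
  have key := hΦ.pointwise hX
    (mdifferentiableAt_coordFrame (mem_chart_source E p) (tangentCoord p p (X p)))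
    (coordFrame_tangentCoord (mem_chart_source E p) _).symm
  have hz : mvfderiv 𝓘(ℝ, E) (fun q ↦ tangentCoord p q
      (coordFrame p q (tangentCoord p p (X p)))) p u = 0 := by
    refine mvfderiv_eq_zero_of_eventuallyEq_const (c := tangentCoord p p (X p)) ?_ u
    filter_upwards [chart_source_mem_nhds E p] with q hq
    exact tangentCoord_coordFrame hq _
  simp only [Φ, hz, map_zero, sub_zero] at key
  rw [sub_eq_iff_eq_add'] at key
  exact key

omit [FiniteDimensional ℝ E] in
theorem covAlong_apply_eq {f : N → M} {σ : ∀ q : N, TangentSpace 𝓘(ℝ, E) (f q)} {p : N}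
    (hf : ContinuousAt f p) (u : TangentSpace 𝓘(ℝ, F) p) :
    covAlong 𝓘(ℝ, F) cov f σ p u =
      coordFrame (f p) (f p)
        (mvfderiv 𝓘(ℝ, F) (fun q ↦ tangentCoord (f p) (f q) (σ q)) p u) +
      christoffel cov (f p) (tangentCoord (f p) (f p) (σ p))
        (mfderiv 𝓘(ℝ, F) 𝓘(ℝ, E) f p u) := by
  have h2 : (fun q ↦ (trivializationAt E (TangentSpace 𝓘(ℝ, E) : M → Type _) (f p)
      (TotalSpace.mk' E (f q) (σ q))).2) =ᶠ[𝓝 p] fun q ↦ tangentCoord (f p) (f q) (σ q) := by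
    filter_upwards [eventually_mem_chart_source (E := E) hf] with q hq
    exact trivializationAt_snd_eq_tangentCoord (E := E) hq _
  unfold covAlong
  rw [mvfderiv_congr_of_eventuallyEq h2, cov_extend]
  congr 1
  exact ((trivializationAt E (TangentSpace 𝓘(ℝ, E)) (f p)).symmL_apply (R := ℝ)
    (mem_chart_source E (f p)) _).symm

omit [FiniteDimensional ℝ E] in
theorem covAlong_congr {f : N → M} {σ τ : ∀ q : N, TangentSpace 𝓘(ℝ, E) (f q)} {p : N}
    (hf : ContinuousAt f p) (h : ∀ᶠ q in 𝓝 p, σ q = τ q) (u : TangentSpace 𝓘(ℝ, F) p) :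
    covAlong 𝓘(ℝ, F) cov f σ p u = covAlong 𝓘(ℝ, F) cov f τ p u := by
  rw [covAlong_apply_eq hf, covAlong_apply_eq hf, h.self_of_nhds]
  congr 2
  have h' : (fun q ↦ tangentCoord (f p) (f q) (σ q)) =ᶠ[𝓝 p]
      fun q ↦ tangentCoord (f p) (f q) (τ q) := h.mono fun q hq ↦ by simp only [hq]
  rw [mvfderiv_congr_of_eventuallyEq h']

/-- The covariant derivative along `f` of a vector field restricted to `f`. -/
theorem covAlong_comp {f : N → M} {X : ∀ q : M, TangentSpace 𝓘(ℝ, E) q} {p : N}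
    (hX : MDifferentiableAt 𝓘(ℝ, E) 𝓘(ℝ, E).tangent (fun q ↦ TotalSpace.mk' E q (X q)) (f p))
    (hf : MDifferentiableAt 𝓘(ℝ, F) 𝓘(ℝ, E) f p) (u : TangentSpace 𝓘(ℝ, F) p) :
    covAlong 𝓘(ℝ, F) cov f (fun q ↦ X (f q)) p u =
      cov X (f p) (mfderiv 𝓘(ℝ, F) 𝓘(ℝ, E) f p u) := by
  rw [covAlong_apply_eq hf.continuousAt, cov_apply_eq hX]
  congr 2
  exact mvfderiv_fun_comp_apply (mdifferentiableAt_tangentCoord hX) hf u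

section Metric

variable (g : BilinField 𝓘(ℝ, E) M)

/-- Differentiability at a point of a field of bilinear forms. -/
def DiffBilinAt (p : M) : Prop :=
  ∀ a b : E, MDifferentiableAt 𝓘(ℝ, E) 𝓘(ℝ, ℝ)
    (fun q ↦ g q (coordFrame p q a) (coordFrame p q b)) p

/-- The coordinates at `y` of a field of bilinear forms in the preferred trivialization at `p`. -/
def bilinCoord (p y : M) : E →L[ℝ] E →L[ℝ] ℝ :=
  ContinuousLinearMap.precomp ℝ (coordFrame p y) ∘L g y ∘L coordFrame p y

omit [FiniteDimensional ℝ E] in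
theorem bilinCoord_apply (p y : M) (a b : E) :
    bilinCoord g p y a b = g y (coordFrame p y a) (coordFrame p y b) := rfl

variable {g}

theorem DiffBilinAt.mdifferentiableAt_bilinCoord {p : M} (hg : DiffBilinAt g p) :
    MDifferentiableAt 𝓘(ℝ, E) 𝓘(ℝ, E →L[ℝ] E →L[ℝ] ℝ) (bilinCoord g p) p :=
  mdifferentiableAt_clm_of_apply fun a ↦ mdifferentiableAt_clm_of_apply fun b ↦ hg a b

omit [FiniteDimensional ℝ E] in
theorem bilin_along_eventuallyEq {f : N → M} {σ τ : ∀ q : N, TangentSpace 𝓘(ℝ, E) (f q)} {p : N}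
    (hf : ContinuousAt f p) :
    (fun q ↦ g (f q) (σ q) (τ q)) =ᶠ[𝓝 p] fun q ↦ bilinCoord g (f p) (f q)
      (tangentCoord (f p) (f q) (σ q)) (tangentCoord (f p) (f q) (τ q)) := by
  filter_upwards [eventually_mem_chart_source (E := E) hf] with q hq
  rw [bilinCoord_apply, coordFrame_tangentCoord hq, coordFrame_tangentCoord hq]

theorem mdifferentiableAt_bilin_along {f : N → M} {σ τ : ∀ q : N, TangentSpace 𝓘(ℝ, E) (f q)}
    {p : N} (hg : DiffBilinAt g (f p)) (hf : MDifferentiableAt 𝓘(ℝ, F) 𝓘(ℝ, E) f p)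
    (hσ : DiffAlong F f σ p) (hτ : DiffAlong F f τ p) :
    MDifferentiableAt 𝓘(ℝ, F) 𝓘(ℝ, ℝ) (fun q ↦ g (f q) (σ q) (τ q)) p := by
  have h1 : MDifferentiableAt 𝓘(ℝ, F) 𝓘(ℝ, E →L[ℝ] E →L[ℝ] ℝ)
      (fun q ↦ bilinCoord g (f p) (f q)) p := hg.mdifferentiableAt_bilinCoord.comp p hf
  exact ((h1.clm_apply (hσ.coord hf)).clm_apply (hτ.coord hf)).congr_of_eventuallyEq
    (bilin_along_eventuallyEq hf.continuousAt)

/-- Metric compatibility for vector fields along a map. -/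
theorem mvfderiv_bilin_along (hcov : IsLeviCivita g cov) {f : N → M}
    {σ τ : ∀ q : N, TangentSpace 𝓘(ℝ, E) (f q)}
    {p : N} (hg : DiffBilinAt g (f p)) (hf : MDifferentiableAt 𝓘(ℝ, F) 𝓘(ℝ, E) f p)
    (hσ : DiffAlong F f σ p) (hτ : DiffAlong F f τ p) (u : TangentSpace 𝓘(ℝ, F) p) :
    mvfderiv 𝓘(ℝ, F) (fun q ↦ g (f q) (σ q) (τ q)) p u =
      g (f p) (covAlong 𝓘(ℝ, F) cov f σ p u) (τ p) +
      g (f p) (σ p) (covAlong 𝓘(ℝ, F) cov f τ p u) := by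
  have h1 : MDifferentiableAt 𝓘(ℝ, F) 𝓘(ℝ, E →L[ℝ] E →L[ℝ] ℝ)
      (fun q ↦ bilinCoord g (f p) (f q)) p := hg.mdifferentiableAt_bilinCoord.comp p hf
  have h2 := hσ.coord hf
  have h3 := hτ.coord hf
  have hs : f p ∈ (chartAt E (f p)).source := mem_chart_source E (f p)
  have hmet : ∀ (a b : E) (w : TangentSpace 𝓘(ℝ, E) (f p)),
      mvfderiv 𝓘(ℝ, E) (bilinCoord g (f p)) (f p) w a b =
        g (f p) (christoffel cov (f p) a w) (coordFrame (f p) (f p) b) +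
        g (f p) (coordFrame (f p) (f p) a) (christoffel cov (f p) b w) := by
    intro a b w
    have e1 := hcov.metric _ _ (f p) w (mdifferentiableAt_coordFrame hs a)
      (mdifferentiableAt_coordFrame hs b)
    have hB := hg.mdifferentiableAt_bilinCoord
    have e2 := mvfderiv_clm_apply (u := fun _ ↦ b)
      (hB.clm_apply (mdifferentiableAt_const (c := a))) mdifferentiableAt_const w
    rw [mvfderiv_clm_apply (u := fun _ ↦ a) hB mdifferentiableAt_const] at e2
    simp only [mvfderiv_const, _root_.zero_apply, map_zero, add_zero] at e2
    rw [← e2]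
    exact e1
  rw [mvfderiv_congr_of_eventuallyEq (bilin_along_eventuallyEq hf.continuousAt),
    mvfderiv_clm_apply (h1.clm_apply h2) h3, mvfderiv_clm_apply h1 h2,
    mvfderiv_fun_comp_apply hg.mdifferentiableAt_bilinCoord hf]
  simp only [_root_.add_apply]
  rw [hmet, covAlong_apply_eq hf.continuousAt, covAlong_apply_eq hf.continuousAt]
  simp only [bilinCoord_apply, coordFrame_tangentCoord hs, map_add,
    _root_.add_apply]
  ring

end Metric

section Endomorphism

variable (φ : ∀ q : M, TangentSpace 𝓘(ℝ, E) q →L[ℝ] TangentSpace 𝓘(ℝ, E) q)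

/-- Differentiability at a point of a field of endomorphisms. -/
def DiffEndoAt (p : M) : Prop :=
  ∀ a : E, MDifferentiableAt 𝓘(ℝ, E) 𝓘(ℝ, E).tangent
    (fun q ↦ TotalSpace.mk' E q (φ q (coordFrame p q a))) p

/-- The coordinates at `y` of an endomorphism field in the preferred trivialization at `p`. -/
def endoCoord (p y : M) : E →L[ℝ] E := tangentCoord p y ∘L φ y ∘L coordFrame p y

variable (cov) in
/-- The covariant derivative `(∇_w φ) v` of an endomorphism field `φ`. -/
def nablaEndo (p : M) (w v : TangentSpace 𝓘(ℝ, E) p) : TangentSpace 𝓘(ℝ, E) p :=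
  cov (fun q ↦ φ q (coordFrame p q (tangentCoord p p v))) p w -
    φ p (christoffel cov p (tangentCoord p p v) w)

variable {φ}

theorem DiffEndoAt.mdifferentiableAt_endoCoord {p : M} (hφ : DiffEndoAt φ p) :
    MDifferentiableAt 𝓘(ℝ, E) 𝓘(ℝ, E →L[ℝ] E) (endoCoord φ p) p :=
  mdifferentiableAt_clm_of_apply fun a ↦ mdifferentiableAt_tangentCoord (hφ a)

omit [FiniteDimensional ℝ E] in
theorem endo_along_eventuallyEq {f : N → M} {σ : ∀ q : N, TangentSpace 𝓘(ℝ, E) (f q)} {p : N}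
    (hf : ContinuousAt f p) :
    (fun q ↦ tangentCoord (f p) (f q) (φ (f q) (σ q))) =ᶠ[𝓝 p] fun q ↦
      endoCoord φ (f p) (f q) (tangentCoord (f p) (f q) (σ q)) := by
  filter_upwards [eventually_mem_chart_source (E := E) hf] with q hq
  simp [endoCoord, coordFrame_tangentCoord hq]

theorem DiffAlong.endo {f : N → M} {σ : ∀ q : N, TangentSpace 𝓘(ℝ, E) (f q)} {p : N}
    (hφ : DiffEndoAt φ (f p)) (hf : MDifferentiableAt 𝓘(ℝ, F) 𝓘(ℝ, E) f p)
    (hσ : DiffAlong F f σ p) : DiffAlong F f (fun q ↦ φ (f q) (σ q)) p := by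
  have h1 : MDifferentiableAt 𝓘(ℝ, F) 𝓘(ℝ, E →L[ℝ] E)
      (fun q ↦ endoCoord φ (f p) (f q)) p := hφ.mdifferentiableAt_endoCoord.comp p hf
  exact (diffAlong_iff hf).2 ((h1.clm_apply (hσ.coord hf)).congr_of_eventuallyEq
    (endo_along_eventuallyEq hf.continuousAt))

/-- The Leibniz rule for `φ σ`, where `σ` is a vector field along a map. -/
theorem covAlong_endo {f : N → M} {σ : ∀ q : N, TangentSpace 𝓘(ℝ, E) (f q)} {p : N}
    (hφ : DiffEndoAt φ (f p)) (hf : MDifferentiableAt 𝓘(ℝ, F) 𝓘(ℝ, E) f p)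
    (hσ : DiffAlong F f σ p) (u : TangentSpace 𝓘(ℝ, F) p) :
    covAlong 𝓘(ℝ, F) cov f (fun q ↦ φ (f q) (σ q)) p u =
      nablaEndo cov φ (f p) (mfderiv 𝓘(ℝ, F) 𝓘(ℝ, E) f p u) (σ p) +
        φ (f p) (covAlong 𝓘(ℝ, F) cov f σ p u) := by
  have hΦ := hφ.mdifferentiableAt_endoCoord
  have h1 : MDifferentiableAt 𝓘(ℝ, F) 𝓘(ℝ, E →L[ℝ] E)
      (fun q ↦ endoCoord φ (f p) (f q)) p := hΦ.comp p hf
  have h2 := hσ.coord hf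
  have hs : f p ∈ (chartAt E (f p)).source := mem_chart_source E (f p)
  rw [covAlong_apply_eq hf.continuousAt, covAlong_apply_eq hf.continuousAt, nablaEndo,
    cov_apply_eq (hφ _), mvfderiv_congr_of_eventuallyEq (endo_along_eventuallyEq hf.continuousAt),
    mvfderiv_clm_apply h1 h2, mvfderiv_fun_comp_apply hΦ hf]
  have e2 := mvfderiv_clm_apply (u := fun _ ↦ tangentCoord (f p) (f p) (σ p)) hΦ
    mdifferentiableAt_const (mfderiv 𝓘(ℝ, F) 𝓘(ℝ, E) f p u)
  simp only [mvfderiv_const, _root_.zero_apply, map_zero, add_zero] at e2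
  have e3 : mvfderiv 𝓘(ℝ, E) (fun q ↦ tangentCoord (f p) q (φ q (coordFrame (f p) q
      (tangentCoord (f p) (f p) (σ p))))) (f p) (mfderiv 𝓘(ℝ, F) 𝓘(ℝ, E) f p u) =
      mvfderiv 𝓘(ℝ, E) (endoCoord φ (f p)) (f p) (mfderiv 𝓘(ℝ, F) 𝓘(ℝ, E) f p u)
        (tangentCoord (f p) (f p) (σ p)) := e2
  rw [e3]
  simp only [map_add, endoCoord, ContinuousLinearMap.comp_apply, coordFrame_tangentCoord hs]
  abel

end Endomorphism

end Connection

section Inverse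

variable {V W : Type*} [NormedAddCommGroup V] [NormedSpace ℝ V] [CompleteSpace V]
  [NormedAddCommGroup W] [NormedSpace ℝ W]

theorem eventually_inverse_apply_apply :
    ∀ᶠ L in 𝓝 (ContinuousLinearMap.id ℝ V), ∀ v, L.inverse (L v) = v ∧ L (L.inverse v) = v := by
  have h := ContinuousLinearEquiv.nhds (ContinuousLinearEquiv.refl ℝ V)
  filter_upwards [h] with L hL v
  obtain ⟨e, rfl⟩ := hL
  simp [ContinuousLinearMap.inverse_equiv]

theorem contDiffAt_inverse_id {n : WithTop ℕ∞} :
    ContDiffAt ℝ n (ContinuousLinearMap.inverse : (V →L[ℝ] V) → V →L[ℝ] V)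
      (ContinuousLinearMap.id ℝ V) :=
  contDiffAt_map_inverse (ContinuousLinearEquiv.refl ℝ V)

end Inverse

section Hessian

variable {E : Type*} [NormedAddCommGroup E] [NormedSpace ℝ E]
  {M : Type*} [TopologicalSpace M] [ChartedSpace E M] [IsManifold 𝓘(ℝ, E) ∞ M]

/-- Derivatives of a function along coordinate fields commute. -/
theorem mvfderiv_mvfderiv_coordFrame_comm {G : Type*} [NormedAddCommGroup G] [NormedSpace ℝ G]
    {p : M} {ψ : M → G} (hψ : ContMDiffAt 𝓘(ℝ, E) 𝓘(ℝ, G) ∞ ψ p) (a b : E) :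
    mvfderiv 𝓘(ℝ, E) (fun q ↦ mvfderiv 𝓘(ℝ, E) ψ q (coordFrame p q a)) p (coordFrame p p b) =
    mvfderiv 𝓘(ℝ, E) (fun q ↦ mvfderiv 𝓘(ℝ, E) ψ q (coordFrame p q b)) p (coordFrame p p a) := by
  have hs : p ∈ (chartAt E p).source := mem_chart_source E p
  have ht : chartAt E p p ∈ (chartAt E p).target := mem_chart_target E p
  have hC : ContDiffAt ℝ ∞ (ψ ∘ (chartAt E p).symm) (chartAt E p p) := by
    rw [← contMDiffAt_iff_contDiffAt]
    refine ContMDiffAt.comp (I' := 𝓘(ℝ, E)) _ ?_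
      (contMDiffAt_symm_of_mem_maximalAtlas (IsManifold.chart_mem_maximalAtlas p) ht)
    rwa [(chartAt E p).left_inv hs]
  have hev : ∀ᶠ q in 𝓝 p, ContMDiffAt 𝓘(ℝ, E) 𝓘(ℝ, G) 1 ψ q :=
    (contMDiffAt_iff_contMDiffAt_nhds (by simp)).1
      (hψ.of_le (WithTop.coe_le_coe.2 le_top))
  have hC1 : ContDiffAt ℝ ∞ (fderiv ℝ (ψ ∘ (chartAt E p).symm)) (chartAt E p p) :=
    hC.fderiv_right (by rfl)
  have hd1 := hC1.differentiableAt (by simp)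
  have key : ∀ a b : E,
      mvfderiv 𝓘(ℝ, E) (fun q ↦ mvfderiv 𝓘(ℝ, E) ψ q (coordFrame p q a)) p (coordFrame p p b) =
        fderiv ℝ (fderiv ℝ (ψ ∘ (chartAt E p).symm)) (chartAt E p p) b a := by
    intro a b
    have h1 : (fun q ↦ mvfderiv 𝓘(ℝ, E) ψ q (coordFrame p q a)) =ᶠ[𝓝 p]
        fun q ↦ fderiv ℝ (ψ ∘ (chartAt E p).symm) (chartAt E p q) a := by
      filter_upwards [hev, chart_source_mem_nhds E p] with q hq hq'
      exact mvfderiv_coordFrame hq' (hq.mdifferentiableAt (by simp)) a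
    have hd : DifferentiableAt ℝ (fun x ↦ fderiv ℝ (ψ ∘ (chartAt E p).symm) x a)
        (chartAt E p p) := hd1.clm_apply (differentiableAt_const _)
    have hM : MDifferentiableAt 𝓘(ℝ, E) 𝓘(ℝ, G)
        (fun q ↦ fderiv ℝ (ψ ∘ (chartAt E p).symm) (chartAt E p q) a) p :=
      MDifferentiableAt.comp (I' := 𝓘(ℝ, E)) p hd.mdifferentiableAt
        (mdifferentiableAt_atlas (chart_mem_atlas E p) hs)
    rw [mvfderiv_congr_of_eventuallyEq h1, mvfderiv_coordFrame hs hM]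
    have h2 : ((fun q ↦ fderiv ℝ (ψ ∘ (chartAt E p).symm) (chartAt E p q) a) ∘
        (chartAt E p).symm) =ᶠ[𝓝 (chartAt E p p)]
        fun x ↦ fderiv ℝ (ψ ∘ (chartAt E p).symm) x a := by
      filter_upwards [(chartAt E p).open_target.mem_nhds ht] with x hx
      simp only [Function.comp_apply, (chartAt E p).right_inv hx]
    rw [h2.fderiv_eq, fderiv_clm_apply hd1 (differentiableAt_const _)]
    simp
  rw [key, key]
  exact (hC.isSymmSndFDerivAt (by rw [minSmoothness_of_isRCLikeNormedField]; exact WithTop.coe_le_coe.2 le_top)) b a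

end Hessian

section Gauss

variable {E : Type*} [NormedAddCommGroup E] [NormedSpace ℝ E] [FiniteDimensional ℝ E]
  {M : Type*} [TopologicalSpace M] [ChartedSpace E M] [IsManifold 𝓘(ℝ, E) ∞ M]
  {F : Type*} [NormedAddCommGroup F] [NormedSpace ℝ F] [FiniteDimensional ℝ F]
  {N : Type*} [TopologicalSpace N] [ChartedSpace F N] [IsManifold 𝓘(ℝ, F) ∞ N]
  {cov : CovariantDerivative 𝓘(ℝ, E) E (TangentSpace 𝓘(ℝ, E) : M → Type _)}
  {g : BilinField 𝓘(ℝ, E) M}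

/-- The connection coefficients of a torsion-free connection are symmetric. -/
theorem cov_coordFrame_comm (hcov : IsLeviCivita g cov) {p y : M}
    (hy : y ∈ (chartAt E p).source) (a b : E) :
    cov (fun q ↦ coordFrame p q a) y (coordFrame p y b) =
      cov (fun q ↦ coordFrame p q b) y (coordFrame p y a) := by
  have h := hcov.torsion_free (fun q ↦ coordFrame p q b) (fun q ↦ coordFrame p q a) y
    (mdifferentiableAt_coordFrame hy b) (mdifferentiableAt_coordFrame hy a)
  rw [mlieBracket_coordFrame hy] at h
  exact sub_eq_zero.1 h

theorem christoffel_comm (hcov : IsLeviCivita g cov) (p : M) (v w : TangentSpace 𝓘(ℝ, E) p) :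
    christoffel cov p (tangentCoord p p v) w = christoffel cov p (tangentCoord p p w) v := by
  have hs : p ∈ (chartAt E p).source := mem_chart_source E p
  have h := cov_coordFrame_comm hcov hs (tangentCoord p p v) (tangentCoord p p w)
  rwa [coordFrame_tangentCoord hs, coordFrame_tangentCoord hs] at h

variable (F E) in
/-- The derivative of `f` at `q` in the preferred trivializations at `p` and `f p`. -/
def mapCoord (f : N → M) (p q : N) : F →L[ℝ] E :=
  tangentCoord (f p) (f q) ∘L mfderiv 𝓘(ℝ, F) 𝓘(ℝ, E) f q ∘L coordFrame p q

theorem mdifferentiableAt_mapCoord {f : N → M} (hf : ContMDiff 𝓘(ℝ, F) 𝓘(ℝ, E) ∞ f) (p : N) :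
    MDifferentiableAt 𝓘(ℝ, F) 𝓘(ℝ, F →L[ℝ] E) (mapCoord E F f p) p :=
  mdifferentiableAt_clm_of_apply fun a ↦
    (DiffAlong.mfderiv_field hf (mdifferentiableAt_coordFrame (mem_chart_source F p) a)).coord
      (hf.mdifferentiable (by simp) p)

theorem tangentCoord_mfderiv_field {f : N → M}
    (p : N) (Y : ∀ q : N, TangentSpace 𝓘(ℝ, F) q) :
    (fun q ↦ tangentCoord (f p) (f q) (mfderiv 𝓘(ℝ, F) 𝓘(ℝ, E) f q (Y q))) =ᶠ[𝓝 p]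
      fun q ↦ mapCoord E F f p q (tangentCoord p q (Y q)) := by
  filter_upwards [chart_source_mem_nhds F p] with q hq
  simp [mapCoord, coordFrame_tangentCoord hq]

theorem mvfderiv_mapCoord_comm {f : N → M} (hf : ContMDiff 𝓘(ℝ, F) 𝓘(ℝ, E) ∞ f) (p : N)
    (u v : TangentSpace 𝓘(ℝ, F) p) :
    mvfderiv 𝓘(ℝ, F) (mapCoord E F f p) p u (tangentCoord p p v) =
      mvfderiv 𝓘(ℝ, F) (mapCoord E F f p) p v (tangentCoord p p u) := by
  have hs : p ∈ (chartAt F p).source := mem_chart_source F p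
  have hψ : ∀ q, f q ∈ (chartAt E (f p)).source →
      ContMDiffAt 𝓘(ℝ, F) 𝓘(ℝ, E) ∞ (fun q ↦ chartAt E (f p) (f q)) q := fun q hq ↦
    ContMDiffAt.comp q
      (contMDiffAt_of_mem_maximalAtlas (IsManifold.chart_mem_maximalAtlas (f p)) hq) (hf q)
  have h1 : ∀ a : F, (fun q ↦ mapCoord E F f p q a) =ᶠ[𝓝 p] fun q ↦
      mvfderiv 𝓘(ℝ, F) (fun q ↦ chartAt E (f p) (f q)) q (coordFrame p q a) := by
    intro a
    filter_upwards [eventually_mem_chart_source (E := E) (hf.continuous.continuousAt (x := p))]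
      with q hq
    simp only [mapCoord, tangentCoord_eq_mfderiv hq]
    have h2 := mfderiv_comp q (mdifferentiableAt_atlas (I := 𝓘(ℝ, E)) (chart_mem_atlas E (f p)) hq)
      (hf.mdifferentiable (by simp) q)
    exact (congrArg (fun L ↦ L (coordFrame p q a)) h2).symm
  have h2 : ∀ u v : TangentSpace 𝓘(ℝ, F) p,
      mvfderiv 𝓘(ℝ, F) (mapCoord E F f p) p u (tangentCoord p p v) =
      mvfderiv 𝓘(ℝ, F) (fun q ↦ mvfderiv 𝓘(ℝ, F) (fun q ↦ chartAt E (f p) (f q)) q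
        (coordFrame p q (tangentCoord p p v))) p (coordFrame p p (tangentCoord p p u)) := by
    intro u v
    rw [← mvfderiv_congr_of_eventuallyEq (h1 _), mvfderiv_clm_apply
      (u := fun _ ↦ tangentCoord p p v) (mdifferentiableAt_mapCoord hf p) mdifferentiableAt_const]
    simp [mvfderiv_const, coordFrame_tangentCoord hs]
  rw [h2, h2]
  exact mvfderiv_mvfderiv_coordFrame_comm (hψ p (mem_chart_source E (f p))) _ _

variable (cov) in
/-- The second covariant derivative of the map `f`. -/
def covHess (f : N → M) (p : N) (u v : TangentSpace 𝓘(ℝ, F) p) : TangentSpace 𝓘(ℝ, E) (f p) :=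
  covAlong 𝓘(ℝ, F) cov f (fun q ↦ mfderiv 𝓘(ℝ, F) 𝓘(ℝ, E) f q
    (coordFrame p q (tangentCoord p p v))) p u

theorem covAlong_mfderiv_extend {f : N → M} {p : N} (hf : ContinuousAt f p)
    (u v : TangentSpace 𝓘(ℝ, F) p) :
    covAlong 𝓘(ℝ, F) cov f (fun q ↦ mfderiv 𝓘(ℝ, F) 𝓘(ℝ, E) f q (extend F v q)) p u =
      covHess cov f p u v := by
  refine covAlong_congr hf ?_ u
  filter_upwards [chart_source_mem_nhds F p] with q hq
  rw [extend_eq_coordFrame v hq]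

theorem covHess_eq {f : N → M} (hf : ContMDiff 𝓘(ℝ, F) 𝓘(ℝ, E) ∞ f) (p : N)
    (u v : TangentSpace 𝓘(ℝ, F) p) :
    covHess cov f p u v = coordFrame (f p) (f p)
        (mvfderiv 𝓘(ℝ, F) (mapCoord E F f p) p u (tangentCoord p p v)) +
      christoffel cov (f p) (tangentCoord (f p) (f p) (mfderiv 𝓘(ℝ, F) 𝓘(ℝ, E) f p v))
        (mfderiv 𝓘(ℝ, F) 𝓘(ℝ, E) f p u) := by
  unfold covHess
  rw [covAlong_apply_eq hf.continuous.continuousAt, coordFrame_tangentCoord (mem_chart_source F p)]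
  congr 2
  have h := mvfderiv_clm_apply (u := fun _ ↦ tangentCoord p p v) (mdifferentiableAt_mapCoord hf p)
    mdifferentiableAt_const u
  simp only [mvfderiv_const, _root_.zero_apply, map_zero, add_zero] at h
  exact h

theorem covHess_comm (hcov : IsLeviCivita g cov) {f : N → M}
    (hf : ContMDiff 𝓘(ℝ, F) 𝓘(ℝ, E) ∞ f) (p : N) (u v : TangentSpace 𝓘(ℝ, F) p) :
    covHess cov f p u v = covHess cov f p v u := by
  rw [covHess_eq hf, covHess_eq hf, mvfderiv_mapCoord_comm hf, christoffel_comm hcov]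

/-- The covariant derivative along `f` of the image of a vector field. -/
theorem covAlong_mfderiv_field {f : N → M} (hf : ContMDiff 𝓘(ℝ, F) 𝓘(ℝ, E) ∞ f) {p : N}
    {Y : ∀ q : N, TangentSpace 𝓘(ℝ, F) q}
    (hY : MDifferentiableAt 𝓘(ℝ, F) 𝓘(ℝ, F).tangent (fun q ↦ TotalSpace.mk' F q (Y q)) p)
    (u : TangentSpace 𝓘(ℝ, F) p) :
    covAlong 𝓘(ℝ, F) cov f (fun q ↦ mfderiv 𝓘(ℝ, F) 𝓘(ℝ, E) f q (Y q)) p u =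
      mfderiv 𝓘(ℝ, F) 𝓘(ℝ, E) f p
        (coordFrame p p (mvfderiv 𝓘(ℝ, F) (fun q ↦ tangentCoord p q (Y q)) p u)) +
      covHess cov f p u (Y p) := by
  have hs : f p ∈ (chartAt E (f p)).source := mem_chart_source E (f p)
  rw [covAlong_apply_eq hf.continuous.continuousAt, covHess_eq hf,
    mvfderiv_congr_of_eventuallyEq (tangentCoord_mfderiv_field p Y),
    mvfderiv_clm_apply (mdifferentiableAt_mapCoord hf p) (mdifferentiableAt_tangentCoord hY)]
  simp only [map_add]
  rw [mapCoord]
  simp only [ContinuousLinearMap.comp_apply, coordFrame_tangentCoord hs]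
  abel

/-- The induced metric is differentiable. -/
theorem DiffBilinAt.induced {f : N → M} (hf : ContMDiff 𝓘(ℝ, F) 𝓘(ℝ, E) ∞ f) {p : N}
    (hg : DiffBilinAt g (f p)) : DiffBilinAt (inducedMetric 𝓘(ℝ, F) g f) p := fun a b ↦
  mdifferentiableAt_bilin_along (g := g) (f := f) hg (hf.mdifferentiable (by simp) p)
    (DiffAlong.mfderiv_field hf (mdifferentiableAt_coordFrame (mem_chart_source F p) a))
    (DiffAlong.mfderiv_field hf (mdifferentiableAt_coordFrame (mem_chart_source F p) b))

/-- The Gauss formula: the tangential component of the ambient covariant derivative is the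
Levi-Civita connection of the induced metric. -/
theorem bilin_covAlong_mfderiv (hcov : IsLeviCivita g cov) (hsymm : ∀ x v w, g x v w = g x w v)
    {f : N → M} (hf : ContMDiff 𝓘(ℝ, F) 𝓘(ℝ, E) ∞ f)
    {covN : CovariantDerivative 𝓘(ℝ, F) F (TangentSpace 𝓘(ℝ, F) : N → Type _)}
    (hcovN : IsLeviCivita (inducedMetric 𝓘(ℝ, F) g f) covN) {p : N} (hg : DiffBilinAt g (f p))
    {Y : ∀ q : N, TangentSpace 𝓘(ℝ, F) q}
    (hY : MDifferentiableAt 𝓘(ℝ, F) 𝓘(ℝ, F).tangent (fun q ↦ TotalSpace.mk' F q (Y q)) p)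
    (u v : TangentSpace 𝓘(ℝ, F) p) :
    g (f p) (covAlong 𝓘(ℝ, F) cov f (fun q ↦ mfderiv 𝓘(ℝ, F) 𝓘(ℝ, E) f q (Y q)) p u)
        (mfderiv 𝓘(ℝ, F) 𝓘(ℝ, E) f p v) =
      inducedMetric 𝓘(ℝ, F) g f p (covN Y p u) v := by
  have hs : p ∈ (chartAt F p).source := mem_chart_source F p
  have hfd := hf.mdifferentiable (by simp) p
  let B : TangentSpace 𝓘(ℝ, F) p → TangentSpace 𝓘(ℝ, F) p → TangentSpace 𝓘(ℝ, F) p → ℝ :=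
    fun u y v ↦ g (f p) (covHess cov f p u y) (mfderiv 𝓘(ℝ, F) 𝓘(ℝ, E) f p v) -
      inducedMetric 𝓘(ℝ, F) g f p (christoffel covN p (tangentCoord p p y) u) v
  have hB1 : ∀ u y v, B u y v = B y u v := by
    intro u y v
    simp only [B]
    rw [covHess_comm hcov hf, christoffel_comm hcovN]
  have hB2 : ∀ u y v, B u y v = - B u v y := by
    intro u y v
    have hy := mdifferentiableAt_coordFrame hs (tangentCoord p p y)
    have hv := mdifferentiableAt_coordFrame hs (tangentCoord p p v)
    have e1 := mvfderiv_bilin_along hcov hg hfd (DiffAlong.mfderiv_field hf hy)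
      (DiffAlong.mfderiv_field hf hv) u
    have e2 := hcovN.metric _ _ p u hy hv
    have e3 := e1.symm.trans e2
    simp only [coordFrame_tangentCoord hs] at e3
    change g (f p) (covHess cov f p u y) (mfderiv 𝓘(ℝ, F) 𝓘(ℝ, E) f p v) +
      g (f p) (mfderiv 𝓘(ℝ, F) 𝓘(ℝ, E) f p y) (covHess cov f p u v) =
      inducedMetric 𝓘(ℝ, F) g f p (christoffel covN p (tangentCoord p p y) u) v +
      inducedMetric 𝓘(ℝ, F) g f p y (christoffel covN p (tangentCoord p p v) u) at e3
    rw [hsymm _ _ (covHess cov f p u v)] at e3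
    have e4 : inducedMetric 𝓘(ℝ, F) g f p y (christoffel covN p (tangentCoord p p v) u) =
      inducedMetric 𝓘(ℝ, F) g f p (christoffel covN p (tangentCoord p p v) u) y := hsymm _ _ _
    rw [e4] at e3
    simp only [B]
    linarith
  have hB : ∀ u y v, B u y v = 0 := by
    intro u y v
    have h1 := hB2 u y v
    have h2 := hB1 u v y
    have h3 := hB2 v u y
    have h4 := hB1 v y u
    have h5 := hB2 y v u
    have h6 := hB1 y u v
    linarith
  rw [covAlong_mfderiv_field hf hY, cov_apply_eq hY]
  simp only [map_add, _root_.add_apply, inducedMetric_apply]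
  have h := hB u (Y p) v
  simp only [B, inducedMetric_apply] at h
  linarith

/-- A vector field along an immersion that is tangent to it is the image of a differentiable
vector field. -/
theorem exists_field_of_tangent {f : N → M} (hf : IsSmoothImmersion 𝓘(ℝ, F) 𝓘(ℝ, E) f) {p : N}
    {σ : ∀ q : N, TangentSpace 𝓘(ℝ, E) (f q)} (hσ : DiffAlong F f σ p)
    {Y : ∀ q : N, TangentSpace 𝓘(ℝ, F) q}
    (hY : ∀ᶠ q in 𝓝 p, mfderiv 𝓘(ℝ, F) 𝓘(ℝ, E) f q (Y q) = σ q) :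
    MDifferentiableAt 𝓘(ℝ, F) 𝓘(ℝ, F).tangent (fun q ↦ TotalSpace.mk' F q (Y q)) p := by
  have hs : p ∈ (chartAt F p).source := mem_chart_source F p
  have hs' : f p ∈ (chartAt E (f p)).source := mem_chart_source E (f p)
  have hinj : LinearMap.ker (mapCoord E F f p p).toLinearMap = ⊥ := by
    refine LinearMap.ker_eq_bot'.2 fun a ha ↦ ?_
    have h1 : tangentCoord (f p) (f p) (mfderiv 𝓘(ℝ, F) 𝓘(ℝ, E) f p (coordFrame p p a)) = 0 := ha
    have h2 := congrArg (coordFrame (f p) (f p)) h1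
    rw [coordFrame_tangentCoord hs', map_zero] at h2
    have h3 := hf.injective_mfderiv p (h2.trans (map_zero _).symm)
    rw [← tangentCoord_coordFrame hs a, h3, map_zero]
  obtain ⟨L, hL⟩ := LinearMap.exists_leftInverse_of_injective _ hinj
  let L' : E →L[ℝ] F := LinearMap.toContinuousLinearMap L
  have hid : L' ∘L mapCoord E F f p p = ContinuousLinearMap.id ℝ F := by
    ext a
    exact congrArg (fun T ↦ T a) hL
  have hc : MDifferentiableAt 𝓘(ℝ, F) 𝓘(ℝ, F →L[ℝ] F) (fun q ↦ L' ∘L mapCoord E F f p q) p :=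
    mdifferentiableAt_const.clm_comp (mdifferentiableAt_mapCoord hf.contMDiff p)
  have hinv : MDifferentiableAt 𝓘(ℝ, F) 𝓘(ℝ, F →L[ℝ] F)
      (fun q ↦ (L' ∘L mapCoord E F f p q).inverse) p := by
    refine MDifferentiableAt.comp (I' := 𝓘(ℝ, F →L[ℝ] F)) (g := ContinuousLinearMap.inverse) p ?_ hc
    rw [hid]
    exact ((contDiffAt_inverse_id (n := 1)).differentiableAt (by simp)).mdifferentiableAt
  have hev : ∀ᶠ q in 𝓝 p, ∀ v, (L' ∘L mapCoord E F f p q).inverse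
      ((L' ∘L mapCoord E F f p q) v) = v := by
    have h := hc.continuousAt.tendsto
    simp only [hid] at h
    exact (h.eventually eventually_inverse_apply_apply).mono fun q hq v ↦ (hq v).1
  have hσ' := hσ.coord (hf.contMDiff.mdifferentiable (by simp) p)
  have hfin : MDifferentiableAt 𝓘(ℝ, F) 𝓘(ℝ, F) (fun q ↦ (L' ∘L mapCoord E F f p q).inverse
      (L' (tangentCoord (f p) (f q) (σ q)))) p :=
    hinv.clm_apply (L'.mdifferentiableAt.comp p hσ')
  refine (diffAlong_iff (F := F) (f := fun q : N ↦ q) mdifferentiableAt_id).2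
    (hfin.congr_of_eventuallyEq ?_)
  filter_upwards [hev, hY, tangentCoord_mfderiv_field (E := E) (f := f) p Y] with q h1 h2 h3
  rw [h2] at h3
  rw [h3]
  exact (h1 (tangentCoord p q (Y q))).symm

/-- The normal part of the covariant derivative of a tangent field along an immersion. -/
theorem bilin_covAlong_of_tangent {f : N → M} (hf : IsSmoothImmersion 𝓘(ℝ, F) 𝓘(ℝ, E) f) {p : N}
    {Y : ∀ q : N, TangentSpace 𝓘(ℝ, F) q}
    (hY : MDifferentiableAt 𝓘(ℝ, F) 𝓘(ℝ, F).tangent (fun q ↦ TotalSpace.mk' F q (Y q)) p)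
    {ν : TangentSpace 𝓘(ℝ, E) (f p)}
    (hν : ∀ v, g (f p) (mfderiv 𝓘(ℝ, F) 𝓘(ℝ, E) f p v) ν = 0) (u : TangentSpace 𝓘(ℝ, F) p) :
    g (f p) (covAlong 𝓘(ℝ, F) cov f (fun q ↦ mfderiv 𝓘(ℝ, F) 𝓘(ℝ, E) f q (Y q)) p u) ν =
      g (f p) (covHess cov f p u (Y p)) ν := by
  rw [covAlong_mfderiv_field hf.contMDiff hY, map_add, _root_.add_apply, hν, zero_add]

end Gauss

section NormalComponent

variable {V : Type*} [AddCommGroup V] [Module ℝ V] [TopologicalSpace V]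
  [IsTopologicalAddGroup V] [ContinuousSMul ℝ V]
  (b : V →L[ℝ] V →L[ℝ] ℝ) (W : Submodule ℝ V)

variable {b W}

theorem apply_normalComponent (h : IsCompl (orthComplement b W) W) (v : V) {ν : V}
    (hν : ν ∈ orthComplement b W) : b (normalComponent b W v) ν = b v ν := by
  have h1 : v - normalComponent b W v ∈ W := by
    rw [normalComponent, dif_pos h]
    have := Submodule.projection_add_projection_eq_self h v
    rw [sub_eq_of_eq_add' this.symm]
    exact Submodule.projection_apply_mem _ _
  have h2 := hν _ h1
  rw [map_sub, _root_.sub_apply, sub_eq_zero] at h2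
  exact h2.symm

theorem normalComponent_eq_zero_iff (h : IsCompl (orthComplement b W) W) {v : V} :
    normalComponent b W v = 0 ↔ v ∈ W := by
  rw [normalComponent, dif_pos h]
  exact Submodule.projection_apply_eq_zero_iff h

theorem isCompl_orthComplement_orthComplement {D : Submodule ℝ V}
    (hsymm : ∀ v w, b v w = b w v) (hb : ∀ v, (∀ w, b v w = 0) → v = 0)
    (h : IsCompl D (orthComplement b D)) :
    orthComplement b (orthComplement b D) = D := by
  refine le_antisymm (fun v hv ↦ ?_) fun v hv w hw ↦ by rw [hsymm]; exact hw v hv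
  obtain ⟨x, hx, z, hz, rfl⟩ := Submodule.mem_sup.1 (h.sup_eq_top ▸ Submodule.mem_top (x := v))
  have hz0 : z = 0 := by
    refine hb z fun w ↦ ?_
    obtain ⟨x', hx', z', hz', rfl⟩ := Submodule.mem_sup.1
      (h.sup_eq_top ▸ Submodule.mem_top (x := w))
    rw [map_add, hsymm z x', hz x' hx', zero_add]
    have h1 := hv z' hz'
    rw [map_add, hsymm z' x, hz' x hx, zero_add] at h1
    rw [hsymm, h1]
  rw [hz0, add_zero]
  exact hx

theorem isCompl_orthComplement_range [FiniteDimensional ℝ V] {U : Type*} [AddCommGroup U]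
    [Module ℝ U] [FiniteDimensional ℝ U] (hsymm : ∀ v w, b v w = b w v) (T : U →ₗ[ℝ] V)
    (hT : ∀ u, (∀ v, b (T u) (T v) = 0) → u = 0) :
    IsCompl (orthComplement b (LinearMap.range T)) (LinearMap.range T) := by
  let A : V →ₗ[ℝ] (U →ₗ[ℝ] ℝ) :=
    { toFun := fun v ↦ (b v).toLinearMap ∘ₗ T
      map_add' := fun v w ↦ by ext; simp
      map_smul' := fun c v ↦ by ext; simp }
  have hA : ∀ v u, A v u = b v (T u) := fun _ _ ↦ rfl
  have hinj : Function.Injective (A ∘ₗ T) := by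
    refine LinearMap.ker_eq_bot.1 (LinearMap.ker_eq_bot'.2 fun u hu ↦ hT u fun v ↦ ?_)
    exact congrArg (fun L ↦ L v) hu
  have hsurj : Function.Surjective (A ∘ₗ T) := by
    refine (LinearMap.injective_iff_surjective_of_finrank_eq_finrank ?_).1 hinj
    exact (Subspace.dual_finrank_eq (K := ℝ) (V := U)).symm
  refine ⟨Submodule.disjoint_def.2 ?_, codisjoint_iff_le_sup.2 fun v _ ↦ ?_⟩
  · rintro _ hv ⟨u, rfl⟩
    rw [hT u fun w ↦ ?_, map_zero]
    rw [hsymm]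
    exact hv _ ⟨w, rfl⟩
  · obtain ⟨u, hu⟩ := hsurj (A v)
    refine Submodule.mem_sup.2 ⟨v - T u, ?_, T u, ⟨u, rfl⟩, sub_add_cancel v _⟩
    rintro _ ⟨w, rfl⟩
    have h := congrArg (fun L ↦ L w) hu
    simp only [LinearMap.comp_apply, hA] at h
    rw [hsymm, map_sub, _root_.sub_apply, h, sub_self]

end NormalComponent

section SAlgebra

/-- A metric `f`-structure on a vector space. -/
structure FAlgebra (V : Type*) [AddCommGroup V] [Module ℝ V] (ι : Type*) [Fintype ι]
    [DecidableEq ι] where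
  g : V →ₗ[ℝ] V →ₗ[ℝ] ℝ
  φ : V →ₗ[ℝ] V
  ξ : ι → V
  η : ι → V →ₗ[ℝ] ℝ
  ε : ι → ℝ
  symm : ∀ X Y, g X Y = g Y X
  ε_sq : ∀ α, ε α * ε α = 1
  φ_sq : ∀ X, φ (φ X) = -X + ∑ α, η α X • ξ α
  φ_ξ : ∀ α, φ (ξ α) = 0
  η_ξ : ∀ α β, η α (ξ β) = if α = β then 1 else 0
  compatible : ∀ X Y, g (φ X) (φ Y) = g X Y - ∑ α, ε α * (η α X * η α Y)

/-- The tensors of an indefinite S-manifold at a point: `T Y X` stands for `(∇_X φ) Y` and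
`K α X` for `∇_X ξ_α`. -/
structure SAlgebra (V : Type*) [AddCommGroup V] [Module ℝ V] (ι : Type*) [Fintype ι]
    [DecidableEq ι] extends FAlgebra V ι where
  T : V → V →ₗ[ℝ] V
  K : ι → V →ₗ[ℝ] V
  T_skew : ∀ X Y Z, g (T Y X) Z = - g (T Z X) Y
  T_cyclic : ∀ X Y Z, g (T Y X) Z + g (T Z Y) X + g (T X Z) Y = 0
  T_normal : ∀ X Y Z, g (T Y (φ X)) Z - g (T X (φ Y)) Z + g (T Y X) (φ Z) - g (T X Y) (φ Z)
    + 2 * (g X (φ Y) * ∑ α, g (ξ α) Z) = 0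
  T_φ : ∀ X Y Z, g (T (φ Y) X) Z - g (T Y X) (φ Z) =
    ∑ α, (ε α * g (K α X) Y * g (ξ α) Z + η α Y * g (K α X) Z)
  T_ξ : ∀ α X Z, g (T (ξ α) X) Z = - g (φ (K α X)) Z
  K_alt : ∀ α X Y, g (K α X) Y - g (K α Y) X = 2 * ε α * g X (φ Y)
  K_ξ : ∀ α β X, g (K α X) (ξ β) + g (ξ α) (K β X) = 0

namespace FAlgebra

variable {V : Type*} [AddCommGroup V] [Module ℝ V] {ι : Type*} [Fintype ι] [DecidableEq ι]
  (S : FAlgebra V ι)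

theorem η_sum (α : ι) (c : ι → ℝ) : S.η α (∑ β, c β • S.ξ β) = c α := by
  simp [map_sum, S.η_ξ]

theorem η_φ (α : ι) (X : V) : S.η α (S.φ X) = 0 := by
  have h1 : S.φ (S.φ (S.φ X)) = - S.φ X := by
    conv_lhs => rw [S.φ_sq X]
    simp [map_sum, S.φ_ξ]
  have h2 := S.φ_sq (S.φ X)
  rw [h1] at h2
  have h3 : ∑ α, S.η α (S.φ X) • S.ξ α = 0 := by
    have h4 : -S.φ X + 0 = -S.φ X + ∑ α, S.η α (S.φ X) • S.ξ α := by rw [add_zero]; exact h2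
    exact (add_left_cancel h4).symm
  rw [← S.η_sum α fun β ↦ S.η β (S.φ X), h3, map_zero]

theorem g_ξ (α : ι) (X : V) : S.g X (S.ξ α) = S.ε α * S.η α X := by
  have h := S.compatible X (S.ξ α)
  simp only [S.φ_ξ, map_zero, S.η_ξ] at h
  simp at h
  linarith

theorem g_φ_ξ (α : ι) (X : V) : S.g (S.φ X) (S.ξ α) = 0 := by
  rw [S.g_ξ, S.η_φ, mul_zero]

theorem g_ξ_φ (α : ι) (X : V) : S.g (S.ξ α) (S.φ X) = 0 := by
  rw [S.symm, S.g_φ_ξ]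

theorem g_φ_left (X Y : V) : S.g (S.φ X) Y = - S.g X (S.φ Y) := by
  have h := S.compatible (S.φ X) Y
  rw [S.φ_sq] at h
  simp only [map_add, map_neg, map_sum, map_smul, LinearMap.add_apply, LinearMap.neg_apply,
    LinearMap.sum_apply, LinearMap.smul_apply, S.g_ξ_φ, S.η_φ, smul_zero, zero_mul, mul_zero,
    Finset.sum_const_zero, add_zero, sub_zero] at h
  exact h.symm

theorem eq_horizontal_add (X : V) : X = -S.φ (S.φ X) + ∑ α, S.η α X • S.ξ α := by
  rw [S.φ_sq]
  abel

/-- Vectors annihilated by all `η^α`. -/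
def Horizontal (X : V) : Prop := ∀ α, S.η α X = 0

variable {S} in
theorem Horizontal.g_ξ {X : V} (h : S.Horizontal X) (α : ι) : S.g (S.ξ α) X = 0 := by
  rw [S.symm, FAlgebra.g_ξ, h, mul_zero]

theorem horizontal_φ (X : V) : S.Horizontal (S.φ X) := fun α ↦ S.η_φ α X

variable {S} in
theorem Horizontal.φ_sq {X : V} (h : S.Horizontal X) : S.φ (S.φ X) = -X := by
  rw [FAlgebra.φ_sq]
  simp [h _]

end FAlgebra

namespace SAlgebra

open FAlgebra

variable {V : Type*} [AddCommGroup V] [Module ℝ V] {ι : Type*} [Fintype ι] [DecidableEq ι]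
  (S : SAlgebra V ι)

theorem T_add (X Y Y' Z : V) : S.g (S.T (Y + Y') X) Z = S.g (S.T Y X) Z + S.g (S.T Y' X) Z := by
  rw [S.T_skew, S.T_skew X Y, S.T_skew X Y', map_add]
  ring

theorem T_sum_smul (X Z : V) (c : ι → ℝ) (Y : ι → V) :
    S.g (S.T (∑ α, c α • Y α) X) Z = ∑ α, c α * S.g (S.T (Y α) X) Z := by
  rw [S.T_skew]
  simp only [map_sum, map_smul, smul_eq_mul, S.T_skew X (Y _), mul_neg, Finset.sum_neg_distrib]

theorem T_neg (X Y Z : V) : S.g (S.T (-Y) X) Z = - S.g (S.T Y X) Z := by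
  rw [S.T_skew, S.T_skew X Y, map_neg]

variable {S} in
/-- `∇φ` vanishes on horizontal vectors. -/
theorem T_eq_zero_of_horizontal {X Y Z : V} (hX : S.Horizontal X) (hY : S.Horizontal Y)
    (hZ : S.Horizontal Z) : S.g (S.T Y X) Z = 0 := by
  have key : ∀ {X Y Z : V}, S.Horizontal X → S.Horizontal Y → S.Horizontal Z →
      S.g (S.T Y (S.φ X)) Z + S.g (S.T Z (S.φ Y)) X = S.g (S.T X (S.φ Z)) Y := by
    intro X Y Z hX hY hZ
    have h1 := S.T_normal X Y Z
    simp only [hZ.g_ξ, Finset.sum_const_zero, mul_zero, add_zero] at h1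
    have h2 := S.T_cyclic X Y (S.φ Z)
    have h3 := S.T_skew (S.φ Y) X Z
    have h4 := S.T_skew Y X (S.φ Z)
    linarith
  have h : ∀ {X Y Z : V}, S.Horizontal X → S.Horizontal Y → S.Horizontal Z →
      S.g (S.T Y (S.φ X)) Z = 0 := by
    intro X Y Z hX hY hZ
    have h1 := key hX hY hZ
    have h2 := key hY hZ hX
    have h3 := key hZ hX hY
    linarith
  have h1 := h (S.horizontal_φ X) hY hZ
  rw [hX.φ_sq, map_neg, map_neg, LinearMap.neg_apply, neg_eq_zero] at h1
  exact h1

theorem T_ξ' (α : ι) (X Y : V) : S.g (S.T Y X) (S.ξ α) = S.g (S.φ (S.K α X)) Y := by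
  rw [S.T_skew, S.T_ξ, neg_neg]

theorem T_apply_ξ_aux {Y Z : V} (hZ : S.Horizontal Z) (α : ι) :
    S.g (S.T Y (S.ξ α)) (S.φ Z) = S.g (S.K α (S.φ Y)) (S.φ Z) - S.g (S.K α Y) Z := by
  have h1 := S.T_normal (S.ξ α) Y Z
  simp only [S.φ_ξ, map_zero, LinearMap.zero_apply, hZ.g_ξ, Finset.sum_const_zero, mul_zero,
    add_zero] at h1
  rw [S.T_ξ, S.T_ξ, S.g_φ_left, S.g_φ_left, hZ.φ_sq, map_neg] at h1
  linarith

theorem T_apply_ξ_aux' {Y Z : V} (hZ : S.Horizontal Z) (α : ι) :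
    S.g (S.T Y (S.ξ α)) (S.φ Z) = - S.g (S.K α (S.φ Z)) (S.φ Y) - S.g (S.K α Y) Z := by
  have h1 := S.T_cyclic (S.ξ α) Y (S.φ Z)
  rw [S.T_ξ] at h1
  have h2 := S.T_ξ' α Y (S.φ Z)
  rw [S.g_φ_left, hZ.φ_sq] at h2
  rw [S.g_φ_left] at h1
  simp only [map_neg, neg_neg] at h1 h2
  linarith

theorem K_φ_skew {Y Z : V} (hZ : S.Horizontal Z) (α : ι) :
    S.g (S.K α (S.φ Y)) (S.φ Z) = - S.g (S.K α (S.φ Z)) (S.φ Y) := by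
  have h1 := S.T_apply_ξ_aux (Y := Y) hZ α
  have h2 := S.T_apply_ξ_aux' (Y := Y) hZ α
  linarith

theorem K_horizontal {Y Z : V} (hY : S.Horizontal Y) (hZ : S.Horizontal Z) (α : ι) :
    S.g (S.K α Y) Z = S.ε α * S.g Y (S.φ Z) := by
  have h1 := S.K_φ_skew (Y := S.φ Y) (S.horizontal_φ Z) α
  rw [hY.φ_sq, hZ.φ_sq] at h1
  simp only [map_neg, LinearMap.neg_apply, neg_neg] at h1
  have h2 := S.K_alt α Y Z
  linarith

theorem T_ξ_horizontal {Y Z : V} (hY : S.Horizontal Y) (hZ : S.Horizontal Z) (α : ι) :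
    S.g (S.T Y (S.ξ α)) Z = 0 := by
  have h1 := S.T_apply_ξ_aux (Y := Y) (S.horizontal_φ Z) α
  rw [hZ.φ_sq, map_neg, S.K_horizontal (S.horizontal_φ Y) (hZ.φ_sq ▸ S.horizontal_φ (S.φ Z)),
    S.K_horizontal hY (S.horizontal_φ Z)] at h1
  simp only [map_neg, S.g_φ_left, hZ.φ_sq, neg_neg] at h1
  linarith

theorem K_ξ_antisymm (α β : ι) (Y : V) : S.g (S.K α (S.ξ β)) Y = - S.g (S.K β (S.ξ α)) Y := by
  have h1 := S.K_alt α (S.ξ β) Y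
  have h2 := S.K_alt β (S.ξ α) Y
  have h3 := S.K_ξ α β Y
  rw [S.g_ξ_φ] at h1 h2
  rw [S.symm (S.ξ α)] at h3
  linarith

theorem K_ξ_left (α β : ι) (Y : V) : S.g (S.K α (S.ξ β)) Y = 0 := by
  have hv : ∀ α β γ, S.g (S.K α (S.ξ β)) (S.ξ γ) = 0 := by
    intro α β γ
    have s23 : ∀ α β γ, S.g (S.K α (S.ξ β)) (S.ξ γ) = S.g (S.K α (S.ξ γ)) (S.ξ β) := by
      intro α β γ
      have h := S.K_alt α (S.ξ β) (S.ξ γ)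
      rw [S.g_ξ_φ] at h
      linarith
    have a13 : ∀ α β γ, S.g (S.K α (S.ξ β)) (S.ξ γ) = - S.g (S.K γ (S.ξ β)) (S.ξ α) := by
      intro α β γ
      have h := S.K_ξ α γ (S.ξ β)
      rw [S.symm (S.ξ α)] at h
      linarith
    have h1 := S.K_ξ_antisymm α β (S.ξ γ)
    have h2 := s23 β α γ
    have h3 := S.K_ξ_antisymm β γ (S.ξ α)
    have h4 := a13 α β γ
    linarith
  have hh : ∀ {Y : V}, S.Horizontal Y → S.g (S.K α (S.ξ β)) Y = 0 := by
    intro Y hY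
    have h1 := S.T_normal (S.ξ α) (S.ξ β) Y
    simp only [S.φ_ξ, map_zero, LinearMap.zero_apply, S.T_ξ, zero_mul, mul_zero, add_zero,
      S.g_φ_left, hY.φ_sq, map_neg, neg_neg] at h1
    have h2 := S.K_ξ_antisymm α β Y
    linarith
  rw [S.eq_horizontal_add Y]
  simp only [map_add, map_neg, map_sum, map_smul, hv, hh (S.horizontal_φ _), smul_zero,
    Finset.sum_const_zero, neg_zero, add_zero]

/-- `∇_X ξ_α = -ε_α φ X`. -/
theorem K_eq (α : ι) (X Y : V) : S.g (S.K α X) Y = S.ε α * S.g X (S.φ Y) := by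
  have h2 : ∀ (β : ι) (X : V), S.g (S.K α X) (S.ξ β) = 0 := by
    intro β X
    have h := S.K_alt α X (S.ξ β)
    rw [S.K_ξ_left, S.φ_ξ, map_zero, mul_zero] at h
    linarith
  conv_lhs => rw [S.eq_horizontal_add X, S.eq_horizontal_add Y]
  conv_rhs => rw [S.eq_horizontal_add X, S.eq_horizontal_add Y]
  have h3 := S.K_horizontal (S.horizontal_φ (S.φ X)) (S.horizontal_φ (S.φ Y)) α
  simp only [map_add, map_neg, map_sum, map_smul, LinearMap.add_apply, LinearMap.neg_apply,
    LinearMap.sum_apply, LinearMap.smul_apply, S.K_ξ_left, h2, h3, S.φ_ξ, S.g_ξ_φ,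
    smul_zero, Finset.sum_const_zero, add_zero, neg_zero, neg_neg]

/-- `(∇_X φ) Y = ∑ α, ε_α η^α(Y) φ² X + g(φ X, φ Y) ξ_α`. -/
theorem T_eq (X Y Z : V) : S.g (S.T Y X) Z =
    ∑ α, S.ε α * (S.η α Y * S.g (S.φ (S.φ X)) Z + S.g (S.φ X) (S.φ Y) * S.η α Z) := by
  have h0 : S.g (S.T (-S.φ (S.φ Y)) X) (-S.φ (S.φ Z)) = 0 := by
    have hY := S.horizontal_φ (S.φ Y)
    have hZ := S.horizontal_φ (S.φ Z)
    rw [S.T_neg]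
    conv_lhs => rw [S.eq_horizontal_add X]
    simp only [map_add, map_neg, map_sum, map_smul, LinearMap.add_apply, LinearMap.neg_apply,
      LinearMap.sum_apply, LinearMap.smul_apply, S.T_ξ_horizontal hY hZ,
      T_eq_zero_of_horizontal (S.horizontal_φ (S.φ X)) hY hZ]
    simp
  have hT : ∀ α Z, S.g (S.T (S.ξ α) X) Z = S.ε α * S.g (S.φ (S.φ X)) Z := by
    intro α Z
    rw [S.T_ξ, S.g_φ_left, S.K_eq, S.g_φ_left, S.g_φ_left]
    ring
  have hT' : ∀ α, S.g (S.T (-S.φ (S.φ Y)) X) (S.ξ α) = S.ε α * S.g (S.φ X) (S.φ Y) := by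
    intro α
    rw [S.T_skew, hT, map_neg, S.g_φ_left]
    have : S.φ (S.φ (S.φ Y)) = - S.φ Y := (S.horizontal_φ Y).φ_sq
    rw [this, map_neg]
    ring
  conv_lhs => rw [S.eq_horizontal_add Y, S.T_add, S.T_sum_smul]
  simp only [hT]
  conv_lhs =>
    enter [1, 2]
    rw [S.eq_horizontal_add Z]
  rw [map_add, h0, map_sum]
  simp only [map_smul, hT', smul_eq_mul, zero_add, ← Finset.sum_add_distrib]
  exact Finset.sum_congr rfl fun α _ ↦ by ring

end SAlgebra

end SAlgebra

section TensorFields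

variable {E : Type*} [NormedAddCommGroup E] [NormedSpace ℝ E] [FiniteDimensional ℝ E]
  {M : Type*} [TopologicalSpace M] [ChartedSpace E M] [IsManifold 𝓘(ℝ, E) ∞ M]

theorem mvfderiv_finset_sum {ι F : Type*} [NormedAddCommGroup F] [NormedSpace ℝ F]
    (s : Finset ι) {f : ι → M → F} {p : M}
    (hf : ∀ i ∈ s, MDifferentiableAt 𝓘(ℝ, E) 𝓘(ℝ, F) (f i) p) (u : TangentSpace 𝓘(ℝ, E) p) :
    MDifferentiableAt 𝓘(ℝ, E) 𝓘(ℝ, F) (fun q ↦ ∑ i ∈ s, f i q) p ∧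
    mvfderiv 𝓘(ℝ, E) (fun q ↦ ∑ i ∈ s, f i q) p u = ∑ i ∈ s, mvfderiv 𝓘(ℝ, E) (f i) p u := by
  classical
  induction s using Finset.induction_on with
  | empty => exact ⟨mdifferentiableAt_const, by simp [mvfderiv_const]⟩
  | insert i s hi ih =>
    obtain ⟨h1, h2⟩ := ih fun j hj ↦ hf j (Finset.mem_insert_of_mem hj)
    have h3 := hf i (Finset.mem_insert_self i s)
    simp only [Finset.sum_insert hi]
    have h4 := mvfderiv_add h3 h1
    refine ⟨h3.add h1, ?_⟩
    rw [← h2]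
    exact congrArg (fun L ↦ L u) h4

theorem contMDiffAt_form_apply {η : ∀ x : M, TangentSpace 𝓘(ℝ, E) x →L[ℝ] ℝ}
    (hη : ContMDiff 𝓘(ℝ, E) (𝓘(ℝ, E).prod 𝓘(ℝ, E →L[ℝ] ℝ)) ∞
      (fun x ↦ TotalSpace.mk' (E →L[ℝ] ℝ) (E := fun x : M ↦ TangentSpace 𝓘(ℝ, E) x →L[ℝ] ℝ) x
        (η x))) {X : ∀ x : M, TangentSpace 𝓘(ℝ, E) x} {p : M}
    (hX : ContMDiffAt 𝓘(ℝ, E) 𝓘(ℝ, E).tangent ∞ (fun q ↦ TotalSpace.mk' E q (X q)) p) :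
    ContMDiffAt 𝓘(ℝ, E) 𝓘(ℝ, ℝ) ∞ (fun q ↦ η q (X q)) p := by
  have h : ContMDiffAt 𝓘(ℝ, E) (𝓘(ℝ, E).prod 𝓘(ℝ)) ∞
      (fun m ↦ TotalSpace.mk' ℝ (E := Bundle.Trivial M ℝ) m (η m (X m))) p :=
    ContMDiffAt.clm_bundle_apply (E₁ := (TangentSpace 𝓘(ℝ, E) : M → Type _)) (F₁ := E)
      (E₂ := Bundle.Trivial M ℝ) (F₂ := ℝ) (hη p) hX
  simp only [contMDiffAt_totalSpace] at h
  exact h.2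

theorem SemiRiemannianMetric.contMDiffAt_apply (g : SemiRiemannianMetric 𝓘(ℝ, E) M)
    {X Y : ∀ x : M, TangentSpace 𝓘(ℝ, E) x} {p : M}
    (hX : ContMDiffAt 𝓘(ℝ, E) 𝓘(ℝ, E).tangent ∞ (fun q ↦ TotalSpace.mk' E q (X q)) p)
    (hY : ContMDiffAt 𝓘(ℝ, E) 𝓘(ℝ, E).tangent ∞ (fun q ↦ TotalSpace.mk' E q (Y q)) p) :
    ContMDiffAt 𝓘(ℝ, E) 𝓘(ℝ, ℝ) ∞ (fun q ↦ g.val q (X q) (Y q)) p := by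
  have h : ContMDiffAt 𝓘(ℝ, E) (𝓘(ℝ, E).prod 𝓘(ℝ)) ∞
      (fun m ↦ TotalSpace.mk' ℝ (E := Bundle.Trivial M ℝ) m (g.val m (X m) (Y m))) p :=
    ContMDiffAt.clm_bundle_apply₂ (E₁ := (TangentSpace 𝓘(ℝ, E) : M → Type _)) (F₁ := E)
      (E₂ := (TangentSpace 𝓘(ℝ, E) : M → Type _)) (F₂ := E)
      (E₃ := Bundle.Trivial M ℝ) (F₃ := ℝ) (g.contMDiff p) hX hY
  simp only [contMDiffAt_totalSpace] at h
  exact h.2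

theorem SemiRiemannianMetric.diffBilinAt (g : SemiRiemannianMetric 𝓘(ℝ, E) M) (p : M) :
    DiffBilinAt g.val p := fun a b ↦
  (g.contMDiffAt_apply (contMDiffAt_coordFrame (mem_chart_source E p) a)
    (contMDiffAt_coordFrame (mem_chart_source E p) b)).mdifferentiableAt (by simp)

theorem FramedFStructure.contMDiffAt_φ_apply {s : ℕ} (S : FramedFStructure 𝓘(ℝ, E) M s)
    {X : ∀ x : M, TangentSpace 𝓘(ℝ, E) x} {p : M}
    (hX : ContMDiffAt 𝓘(ℝ, E) 𝓘(ℝ, E).tangent ∞ (fun q ↦ TotalSpace.mk' E q (X q)) p) :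
    ContMDiffAt 𝓘(ℝ, E) 𝓘(ℝ, E).tangent ∞ (fun q ↦ TotalSpace.mk' E q (S.φ q (X q))) p :=
  ContMDiffAt.clm_bundle_apply (E₁ := (TangentSpace 𝓘(ℝ, E) : M → Type _)) (F₁ := E)
      (E₂ := (TangentSpace 𝓘(ℝ, E) : M → Type _)) (F₂ := E) (S.contMDiff_φ p) hX

theorem FramedFStructure.diffEndoAt {s : ℕ} (S : FramedFStructure 𝓘(ℝ, E) M s) (p : M) :
    DiffEndoAt S.φ p := fun a ↦
  (S.contMDiffAt_φ_apply (contMDiffAt_coordFrame (mem_chart_source E p) a)).mdifferentiableAt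
    (by simp)

theorem mdifferentiableAt_mvfderiv_coordFrame {G : Type*} [NormedAddCommGroup G] [NormedSpace ℝ G]
    {p : M} {ψ : M → G} (hψ : ContMDiffAt 𝓘(ℝ, E) 𝓘(ℝ, G) ∞ ψ p) (a : E) :
    MDifferentiableAt 𝓘(ℝ, E) 𝓘(ℝ, G)
      (fun q ↦ mvfderiv 𝓘(ℝ, E) ψ q (coordFrame p q a)) p := by
  have hs : p ∈ (chartAt E p).source := mem_chart_source E p
  have ht : chartAt E p p ∈ (chartAt E p).target := mem_chart_target E p
  have hC : ContDiffAt ℝ ∞ (ψ ∘ (chartAt E p).symm) (chartAt E p p) := by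
    rw [← contMDiffAt_iff_contDiffAt]
    refine ContMDiffAt.comp (I' := 𝓘(ℝ, E)) _ ?_
      (contMDiffAt_symm_of_mem_maximalAtlas (IsManifold.chart_mem_maximalAtlas p) ht)
    rwa [(chartAt E p).left_inv hs]
  have hev : ∀ᶠ q in 𝓝 p, ContMDiffAt 𝓘(ℝ, E) 𝓘(ℝ, G) 1 ψ q :=
    (contMDiffAt_iff_contMDiffAt_nhds (by simp)).1
      (hψ.of_le (WithTop.coe_le_coe.2 le_top))
  have hC1 : ContDiffAt ℝ ∞ (fderiv ℝ (ψ ∘ (chartAt E p).symm)) (chartAt E p p) :=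
    hC.fderiv_right (by rfl)
  have hd : DifferentiableAt ℝ (fun x ↦ fderiv ℝ (ψ ∘ (chartAt E p).symm) x a)
      (chartAt E p p) := (hC1.differentiableAt (by simp)).clm_apply (differentiableAt_const _)
  refine (MDifferentiableAt.comp (I' := 𝓘(ℝ, E)) p hd.mdifferentiableAt
        (mdifferentiableAt_atlas (chart_mem_atlas E p) hs)).congr_of_eventuallyEq ?_
  filter_upwards [hev, chart_source_mem_nhds E p] with q hq hq'
  exact mvfderiv_coordFrame hq' (hq.mdifferentiableAt (by simp)) a

/-- The Leibniz rule for an endomorphism field applied to a vector field. -/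
theorem cov_endo {cov : CovariantDerivative 𝓘(ℝ, E) E (TangentSpace 𝓘(ℝ, E) : M → Type _)}
    {φ : ∀ q : M, TangentSpace 𝓘(ℝ, E) q →L[ℝ] TangentSpace 𝓘(ℝ, E) q} {p : M}
    (hφ : DiffEndoAt φ p) {Y : ∀ q : M, TangentSpace 𝓘(ℝ, E) q}
    (hY : MDifferentiableAt 𝓘(ℝ, E) 𝓘(ℝ, E).tangent (fun q ↦ TotalSpace.mk' E q (Y q)) p)
    (hφY : MDifferentiableAt 𝓘(ℝ, E) 𝓘(ℝ, E).tangent (fun q ↦ TotalSpace.mk' E q (φ q (Y q))) p)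
    (u : TangentSpace 𝓘(ℝ, E) p) :
    cov (fun q ↦ φ q (Y q)) p u = nablaEndo cov φ p u (Y p) + φ p (cov Y p u) := by
  have hid : MDifferentiableAt 𝓘(ℝ, E) 𝓘(ℝ, E) (fun q : M ↦ q) p := mdifferentiableAt_id
  have h1 := covAlong_endo (cov := cov) (f := fun q : M ↦ q) (σ := Y) hφ hid hY u
  have h2 := covAlong_comp (cov := cov) (f := fun q : M ↦ q) hφY hid u
  have h3 := covAlong_comp (cov := cov) (f := fun q : M ↦ q) hY hid u
  have h4 : mfderiv 𝓘(ℝ, E) 𝓘(ℝ, E) (fun q : M ↦ q) p = ContinuousLinearMap.id ℝ _ :=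
    mfderiv_id
  rw [h4] at h1 h2 h3
  exact h2.symm.trans (h1.trans (by rw [h3]; rfl))

end TensorFields

namespace IndefiniteSStructure

variable {E : Type*} [NormedAddCommGroup E] [NormedSpace ℝ E] [FiniteDimensional ℝ E]
  {M : Type*} [TopologicalSpace M] [ChartedSpace E M] [IsManifold 𝓘(ℝ, E) ∞ M] {s : ℕ}
  (S : IndefiniteSStructure 𝓘(ℝ, E) M s)

/-- The metric `f`-structure at a point. -/
def fAlgebra (p : M) : FAlgebra (TangentSpace 𝓘(ℝ, E) p) (Fin s) where
  g := ContinuousLinearMap.coeLM ℝ ∘ₗ (S.metric.val p).toLinearMap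
  φ := (S.φ p).toLinearMap
  ξ α := S.ξ α p
  η α := (S.η α p).toLinearMap
  ε := S.ε
  symm := S.metric.symm p
  ε_sq α := by rcases S.ε_eq α with h | h <;> rw [h] <;> norm_num
  φ_sq := S.φ_sq p
  φ_ξ α := S.φ_ξ α p
  η_ξ α β := S.η_ξ α β p
  compatible := S.compatible p

theorem g_φ_left (p : M) (v w : TangentSpace 𝓘(ℝ, E) p) :
    S.metric.val p (S.φ p v) w = - S.metric.val p v (S.φ p w) := (S.fAlgebra p).g_φ_left v w

theorem g_ξ (p : M) (α : Fin s) (v : TangentSpace 𝓘(ℝ, E) p) :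
    S.metric.val p v (S.ξ α p) = S.ε α * S.η α p v := (S.fAlgebra p).g_ξ α v

theorem ε_mul_self (α : Fin s) : S.ε α * S.ε α = 1 := by
  rcases S.ε_eq α with h | h <;> rw [h] <;> norm_num

theorem η_eq (p : M) (α : Fin s) (v : TangentSpace 𝓘(ℝ, E) p) :
    S.η α p v = S.ε α * S.metric.val p v (S.ξ α p) := by
  rw [g_ξ, ← mul_assoc, ε_mul_self, one_mul]

variable {cov : CovariantDerivative 𝓘(ℝ, E) E (TangentSpace 𝓘(ℝ, E) : M → Type _)}

theorem mdifferentiableAt_ξ (α : Fin s) (p : M) :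
    MDifferentiableAt 𝓘(ℝ, E) 𝓘(ℝ, E).tangent (fun q ↦ TotalSpace.mk' E q (S.ξ α q)) p :=
  (S.contMDiff_ξ α p).mdifferentiableAt (by simp)

theorem cov_φ_coordFrame (p : M) (a : E) (u : TangentSpace 𝓘(ℝ, E) p) :
    cov (fun q ↦ S.φ q (coordFrame p q a)) p u =
      nablaEndo cov S.φ p u (coordFrame p p a) + S.φ p (christoffel cov p a u) :=
  cov_endo (S.diffEndoAt p) (mdifferentiableAt_coordFrame (mem_chart_source E p) a)
    (S.diffEndoAt p a) u

variable (cov) in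
/-- `(∇_X φ) Y` as a linear map in `X`. -/
def nablaφ (p : M) (Y : TangentSpace 𝓘(ℝ, E) p) :
    TangentSpace 𝓘(ℝ, E) p →ₗ[ℝ] TangentSpace 𝓘(ℝ, E) p :=
  (cov (fun q ↦ S.φ q (coordFrame p q (tangentCoord p p Y))) p).toLinearMap -
    (S.φ p).toLinearMap ∘ₗ (christoffel cov p (tangentCoord p p Y)).toLinearMap

variable (hcov : IsLeviCivita S.metric.val cov)
include hcov

theorem nablaEndo_skew (p : M) (a b : E) (X : TangentSpace 𝓘(ℝ, E) p) :
    S.metric.val p (nablaEndo cov S.φ p X (coordFrame p p a)) (coordFrame p p b) =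
      - S.metric.val p (nablaEndo cov S.φ p X (coordFrame p p b)) (coordFrame p p a) := by
  have ha := mdifferentiableAt_coordFrame (mem_chart_source E p) a
  have hb := mdifferentiableAt_coordFrame (mem_chart_source E p) b
  have h1 := hcov.metric _ _ p X (S.diffEndoAt p a) hb
  have h2 := hcov.metric _ _ p X ha (S.diffEndoAt p b)
  have h3 : (fun q ↦ S.metric.val q (S.φ q (coordFrame p q a)) (coordFrame p q b)) =
      -fun q ↦ S.metric.val q (coordFrame p q a) (S.φ q (coordFrame p q b)) :=
    funext fun q ↦ S.g_φ_left q _ _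
  rw [h3, mvfderiv_neg, _root_.neg_apply, h2, S.cov_φ_coordFrame, S.cov_φ_coordFrame] at h1
  simp only [map_add, _root_.add_apply, S.g_φ_left] at h1
  rw [S.metric.symm p (coordFrame p p a) (nablaEndo cov S.φ p X (coordFrame p p b)),
    S.metric.symm p (coordFrame p p a) (S.φ p _), S.g_φ_left] at h1
  rw [S.metric.symm p (christoffel cov p b X)] at h1
  have h4 := S.g_φ_left p (coordFrame p p a) (christoffel cov p b X)
  simp only [show ∀ c, cov (fun q ↦ coordFrame p q c) p = christoffel cov p c from
    fun _ ↦ rfl] at h1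
  linarith

theorem nablaEndo_ξ (p : M) (α : Fin s) (X : TangentSpace 𝓘(ℝ, E) p) :
    nablaEndo cov S.φ p X (S.ξ α p) = - S.φ p (cov (S.ξ α) p X) := by
  have h0 : (fun q ↦ S.φ q (S.ξ α q)) = fun q : M ↦ (0 : TangentSpace 𝓘(ℝ, E) q) :=
    funext fun q ↦ S.φ_ξ α q
  have h1 := cov_endo (cov := cov) (S.diffEndoAt p) (S.mdifferentiableAt_ξ α p)
    ((S.contMDiffAt_φ_apply (S.contMDiff_ξ α p)).mdifferentiableAt (by simp)) X
  have h2 : cov (fun q : M ↦ (0 : TangentSpace 𝓘(ℝ, E) q)) p = 0 :=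
    cov.isCovariantDerivativeOnUniv.zero
  rw [h0, h2] at h1
  exact eq_neg_of_add_eq_zero_left h1.symm

theorem cov_ξ_orthonormal (p : M) (α β : Fin s) (X : TangentSpace 𝓘(ℝ, E) p) :
    S.metric.val p (cov (S.ξ α) p X) (S.ξ β p) + S.metric.val p (S.ξ α p) (cov (S.ξ β) p X)
      = 0 := by
  rw [← hcov.metric _ _ p X (S.mdifferentiableAt_ξ α p) (S.mdifferentiableAt_ξ β p)]
  refine mvfderiv_eq_zero_of_eventuallyEq_const (c := S.ε β * if β = α then 1 else 0) ?_ X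
  exact Filter.Eventually.of_forall fun q ↦ by rw [S.g_ξ, S.η_ξ]

theorem mvfderiv_η_coordFrame (p : M) (α : Fin s) (a : E) (X : TangentSpace 𝓘(ℝ, E) p) :
    mvfderiv 𝓘(ℝ, E) (fun q ↦ S.η α q (coordFrame p q a)) p X =
      S.ε α * (S.metric.val p (christoffel cov p a X) (S.ξ α p) +
        S.metric.val p (coordFrame p p a) (cov (S.ξ α) p X)) := by
  have ha := mdifferentiableAt_coordFrame (mem_chart_source E p) a
  have h := hcov.metric _ _ p X ha (S.mdifferentiableAt_ξ α p)
  rw [christoffel, ← h]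
  have h1 : (fun q ↦ S.η α q (coordFrame p q a)) = fun q ↦
      (S.ε α • ContinuousLinearMap.id ℝ ℝ) (S.metric.val q (coordFrame p q a) (S.ξ α q)) :=
    funext fun q ↦ S.η_eq q α _
  rw [h1, mvfderiv_clm_const_apply]
  · rfl
  · exact (S.metric.contMDiffAt_apply (contMDiffAt_coordFrame (mem_chart_source E p) a)
      (S.contMDiff_ξ α p)).mdifferentiableAt (by simp)

theorem cov_ξ_alt (p : M) (α : Fin s) (a b : E) :
    S.metric.val p (cov (S.ξ α) p (coordFrame p p a)) (coordFrame p p b) -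
      S.metric.val p (cov (S.ξ α) p (coordFrame p p b)) (coordFrame p p a) =
      2 * S.ε α * S.metric.val p (coordFrame p p a) (S.φ p (coordFrame p p b)) := by
  have hs := mem_chart_source E p
  have h := S.dη_eq α _ _ p (mdifferentiableAt_coordFrame hs a) (mdifferentiableAt_coordFrame hs b)
  rw [extDerivOneForm, mlieBracket_coordFrame hs, S.mvfderiv_η_coordFrame hcov,
    S.mvfderiv_η_coordFrame hcov] at h
  have h2 : christoffel cov p a (coordFrame p p b) = christoffel cov p b (coordFrame p p a) :=
    cov_coordFrame_comm hcov hs a b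
  rw [h2, map_zero, S.metric.symm p (coordFrame p p b) (cov _ _ _),
    S.metric.symm p (coordFrame p p a) (cov _ _ _)] at h
  have h3 := S.ε_mul_self α
  linear_combination (2 * S.ε α) * h - h3 *
    (S.metric.val p (cov (S.ξ α) p (coordFrame p p a)) (coordFrame p p b) -
      S.metric.val p (cov (S.ξ α) p (coordFrame p p b)) (coordFrame p p a))

theorem nablaEndo_φ (p : M) (a b : E) (X : TangentSpace 𝓘(ℝ, E) p) :
    S.metric.val p (nablaEndo cov S.φ p X (coordFrame p p a)) (S.φ p (coordFrame p p b)) +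
      S.metric.val p (nablaEndo cov S.φ p X (coordFrame p p b)) (S.φ p (coordFrame p p a)) =
    - ∑ α, S.ε α * (S.metric.val p (coordFrame p p a) (cov (S.ξ α) p X) *
        S.metric.val p (coordFrame p p b) (S.ξ α p) +
        S.metric.val p (coordFrame p p a) (S.ξ α p) *
        S.metric.val p (coordFrame p p b) (cov (S.ξ α) p X)) := by
  have hs := mem_chart_source E p
  have ha := contMDiffAt_coordFrame hs a
  have hb := contMDiffAt_coordFrame hs b
  have h1 := hcov.metric _ _ p X (S.diffEndoAt p a) (S.diffEndoAt p b)
  have h2 := hcov.metric _ _ p X (mdifferentiableAt_coordFrame hs a)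
    (mdifferentiableAt_coordFrame hs b)
  have hη : ∀ α, ∀ c : E, MDifferentiableAt 𝓘(ℝ, E) 𝓘(ℝ, ℝ)
      (fun q ↦ S.η α q (coordFrame p q c)) p := fun α c ↦
    (contMDiffAt_form_apply (S.contMDiff_η α)
      (contMDiffAt_coordFrame hs c)).mdifferentiableAt (by simp)
  have hg := (S.metric.contMDiffAt_apply ha hb).mdifferentiableAt (by simp)
  have hm : ∀ α, MDifferentiableAt 𝓘(ℝ, E) 𝓘(ℝ, ℝ)
      (fun q ↦ S.ε α * (S.η α q (coordFrame p q a) * S.η α q (coordFrame p q b))) p := fun α ↦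
    mdifferentiableAt_const.mul ((hη α a).mul (hη α b))
  obtain ⟨h3, h4⟩ := mvfderiv_finset_sum Finset.univ (fun α _ ↦ hm α) X
  have h5 := congrArg (fun L ↦ L X) (mvfderiv_sub hg h3)
  have h6 : (fun q ↦ S.metric.val q (S.φ q (coordFrame p q a)) (S.φ q (coordFrame p q b))) =
      (fun q ↦ S.metric.val q (coordFrame p q a) (coordFrame p q b)) -
      fun q ↦ ∑ α, S.ε α * (S.η α q (coordFrame p q a) * S.η α q (coordFrame p q b)) :=
    funext fun q ↦ S.compatible q _ _
  have h7 : ∀ α, mvfderiv 𝓘(ℝ, E)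
      (fun q ↦ S.ε α * (S.η α q (coordFrame p q a) * S.η α q (coordFrame p q b))) p X =
      S.ε α * (S.η α p (coordFrame p p a) * mvfderiv 𝓘(ℝ, E)
        (fun q ↦ S.η α q (coordFrame p q b)) p X + S.η α p (coordFrame p p b) *
        mvfderiv 𝓘(ℝ, E) (fun q ↦ S.η α q (coordFrame p q a)) p X) := by
    intro α
    have e1 := congrArg (fun L ↦ L X) (mvfderiv_mul (hη α a) (hη α b))
    have e2 := congrArg (fun L ↦ L X) (mvfderiv_mul (f := fun _ : M ↦ S.ε α)
      mdifferentiableAt_const ((hη α a).mul (hη α b)))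
    rw [mvfderiv_const] at e2
    refine e2.trans ?_
    rw [_root_.add_apply, _root_.smul_apply, e1]
    simp
  rw [h6] at h1
  have h8 := h1.symm.trans h5
  rw [_root_.sub_apply, h4, h2] at h8
  simp only [h7, S.mvfderiv_η_coordFrame hcov, S.cov_φ_coordFrame, map_add, _root_.add_apply,
    S.compatible] at h8
  rw [S.metric.symm p (S.φ p (coordFrame p p a)) (nablaEndo _ _ _ _ _)] at h8
  change _ = S.metric.val p (christoffel cov p a X) (coordFrame p p b) +
    S.metric.val p (coordFrame p p a) (christoffel cov p b X) - _ at h8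
  have h9 : ∑ α, S.ε α * (S.η α p (coordFrame p p a) * (S.ε α *
        (S.metric.val p (christoffel cov p b X) (S.ξ α p) +
          S.metric.val p (coordFrame p p b) (cov (S.ξ α) p X))) +
        S.η α p (coordFrame p p b) * (S.ε α *
        (S.metric.val p (christoffel cov p a X) (S.ξ α p) +
          S.metric.val p (coordFrame p p a) (cov (S.ξ α) p X)))) =
      ∑ α, S.ε α * (S.η α p (christoffel cov p a X) * S.η α p (coordFrame p p b)) +
      ∑ α, S.ε α * (S.η α p (coordFrame p p a) * S.η α p (christoffel cov p b X)) +
      ∑ α, S.ε α * (S.metric.val p (coordFrame p p a) (cov (S.ξ α) p X) *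
        S.metric.val p (coordFrame p p b) (S.ξ α p) +
        S.metric.val p (coordFrame p p a) (S.ξ α p) *
        S.metric.val p (coordFrame p p b) (cov (S.ξ α) p X)) := by
    rw [← Finset.sum_add_distrib, ← Finset.sum_add_distrib]
    refine Finset.sum_congr rfl fun α _ ↦ ?_
    simp only [S.g_ξ]
    have h3 := S.ε_mul_self α
    linear_combination (S.ε α * (S.η α p (christoffel cov p a X) * S.η α p (coordFrame p p b) +
      S.η α p (coordFrame p p a) * S.η α p (christoffel cov p b X))) * h3
  rw [h9] at h8
  linarith

theorem nablaEndo_normal (p : M) (a b : E) (Z : TangentSpace 𝓘(ℝ, E) p) :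
    S.metric.val p (nablaEndo cov S.φ p (S.φ p (coordFrame p p a)) (coordFrame p p b)) Z -
      S.metric.val p (nablaEndo cov S.φ p (S.φ p (coordFrame p p b)) (coordFrame p p a)) Z +
      S.metric.val p (nablaEndo cov S.φ p (coordFrame p p a) (coordFrame p p b)) (S.φ p Z) -
      S.metric.val p (nablaEndo cov S.φ p (coordFrame p p b) (coordFrame p p a)) (S.φ p Z) +
      2 * (S.metric.val p (coordFrame p p a) (S.φ p (coordFrame p p b)) *
        ∑ α, S.metric.val p (S.ξ α p) Z) = 0 := by
  have hs := mem_chart_source E p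
  have ha := mdifferentiableAt_coordFrame hs a
  have hb := mdifferentiableAt_coordFrame hs b
  have h := S.normal _ _ p ha hb
  simp only [S.dη_eq _ _ _ p ha hb, nijenhuis, mlieBracket_coordFrame hs,
    ← hcov.torsion_free _ _ p (S.diffEndoAt p a) (S.diffEndoAt p b),
    ← hcov.torsion_free _ _ p (S.diffEndoAt p a) hb,
    ← hcov.torsion_free _ _ p ha (S.diffEndoAt p b), S.cov_φ_coordFrame] at h
  simp only [show ∀ c, cov (fun q ↦ coordFrame p q c) p = christoffel cov p c from
    fun _ ↦ rfl, map_sub, map_add, map_zero] at h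
  have h1 : christoffel cov p a (coordFrame p p b) = christoffel cov p b (coordFrame p p a) :=
    cov_coordFrame_comm hcov hs a b
  rw [h1, ← Finset.smul_sum] at h
  have h2 := congrArg (fun v ↦ S.metric.val p v Z) h
  simp only [map_add, map_sub, map_smul, map_sum, map_zero, _root_.add_apply, _root_.sub_apply,
    _root_.smul_apply, _root_.zero_apply, _root_.sum_apply, S.g_φ_left, smul_eq_mul] at h2
  linarith

theorem nablaEndo_cyclic (α : Fin s) (p : M) (a b c : E) :
    S.metric.val p (nablaEndo cov S.φ p (coordFrame p p a) (coordFrame p p b)) (coordFrame p p c) +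
    S.metric.val p (nablaEndo cov S.φ p (coordFrame p p b) (coordFrame p p c)) (coordFrame p p a) +
    S.metric.val p (nablaEndo cov S.φ p (coordFrame p p c) (coordFrame p p a)) (coordFrame p p b)
      = 0 := by
  have hs := mem_chart_source E p
  have hψ : ∀ a : E, ContMDiffAt 𝓘(ℝ, E) 𝓘(ℝ, ℝ) ∞ (fun q ↦ S.η α q (coordFrame p q a)) p :=
    fun a ↦ contMDiffAt_form_apply (S.contMDiff_η α) (contMDiffAt_coordFrame hs a)
  let D : E → E → M → ℝ := fun a b q ↦
    mvfderiv 𝓘(ℝ, E) (fun q ↦ S.η α q (coordFrame p q b)) q (coordFrame p q a)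
  have hD : ∀ a b, MDifferentiableAt 𝓘(ℝ, E) 𝓘(ℝ, ℝ) (D a b) p := fun a b ↦
    mdifferentiableAt_mvfderiv_coordFrame (hψ b) a
  have hcomm : ∀ a b c, mvfderiv 𝓘(ℝ, E) (D a c) p (coordFrame p p b) =
      mvfderiv 𝓘(ℝ, E) (D b c) p (coordFrame p p a) := fun a b c ↦
    mvfderiv_mvfderiv_coordFrame_comm (hψ c) a b
  have key : ∀ a b c : E,
      S.metric.val p (christoffel cov p a (coordFrame p p c)) (S.φ p (coordFrame p p b)) +
        S.metric.val p (nablaEndo cov S.φ p (coordFrame p p c) (coordFrame p p b))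
          (coordFrame p p a) -
        S.metric.val p (christoffel cov p b (coordFrame p p c)) (S.φ p (coordFrame p p a)) =
      (1 / 2) * (mvfderiv 𝓘(ℝ, E) (D a b) p (coordFrame p p c) -
        mvfderiv 𝓘(ℝ, E) (D b a) p (coordFrame p p c)) := by
    intro a b c
    have h1 := hcov.metric _ _ p (coordFrame p p c) (mdifferentiableAt_coordFrame hs a)
      (S.diffEndoAt p b)
    have h2 : (fun q ↦ S.metric.val q (coordFrame p q a) (S.φ q (coordFrame p q b))) =ᶠ[𝓝 p]
        fun q ↦ ((1 / 2 : ℝ) • ContinuousLinearMap.id ℝ ℝ) ((D a b - D b a) q) := by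
      filter_upwards [chart_source_mem_nhds E p] with q hq
      have h := S.dη_eq α _ _ q (mdifferentiableAt_coordFrame hq a)
        (mdifferentiableAt_coordFrame hq b)
      rw [extDerivOneForm, mlieBracket_coordFrame hq, map_zero, sub_zero] at h
      exact h.symm
    rw [mvfderiv_congr_of_eventuallyEq h2, mvfderiv_clm_const_apply _ ((hD a b).sub (hD b a)),
      mvfderiv_sub (hD a b) (hD b a), S.cov_φ_coordFrame] at h1
    simp only [map_add] at h1
    rw [S.metric.symm p (coordFrame p p a) (nablaEndo _ _ _ _ _),
      S.metric.symm p (coordFrame p p a) (S.φ p _), S.g_φ_left] at h1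
    simp only [_root_.smul_apply, _root_.sub_apply, smul_eq_mul] at h1
    change (1 / 2 : ℝ) * (mvfderiv 𝓘(ℝ, E) (D a b) p (coordFrame p p c) -
        mvfderiv 𝓘(ℝ, E) (D b a) p (coordFrame p p c)) =
        S.metric.val p (christoffel cov p a (coordFrame p p c)) (S.φ p (coordFrame p p b)) + _ at h1
    linarith
  have hΓ : ∀ a b, christoffel cov p a (coordFrame p p b) = christoffel cov p b (coordFrame p p a) :=
    fun a b ↦ cov_coordFrame_comm hcov hs a b
  have h1 := key a b c
  have h2 := key b c a
  have h3 := key c a b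
  rw [hΓ a c] at h1
  rw [hΓ b a] at h2
  rw [hΓ c b] at h3
  have h4 := hcomm a c b
  have h5 := hcomm b c a
  have h6 := hcomm b a c
  have e1 := S.nablaEndo_skew hcov p a b (coordFrame p p c)
  have e2 := S.nablaEndo_skew hcov p b c (coordFrame p p a)
  have e3 := S.nablaEndo_skew hcov p c a (coordFrame p p b)
  linarith

/-- The tensors of an indefinite S-manifold at a point. -/
def sAlgebra (hs : 0 < s) (p : M) : SAlgebra (TangentSpace 𝓘(ℝ, E) p) (Fin s) :=
  have hc : ∀ v : TangentSpace 𝓘(ℝ, E) p, coordFrame p p (tangentCoord p p v) = v := fun v ↦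
    coordFrame_tangentCoord (mem_chart_source E p) v
  { S.fAlgebra p with
    T := S.nablaφ cov p
    K := fun α ↦ (cov (S.ξ α) p).toLinearMap
    T_skew := fun X Y Z ↦ by
      have h := S.nablaEndo_skew hcov p (tangentCoord p p Y) (tangentCoord p p Z) X
      rwa [hc, hc] at h
    T_cyclic := fun X Y Z ↦ by
      have h := S.nablaEndo_cyclic hcov ⟨0, hs⟩ p (tangentCoord p p X) (tangentCoord p p Y)
        (tangentCoord p p Z)
      rwa [hc, hc, hc] at h
    T_normal := fun X Y Z ↦ by
      have h := S.nablaEndo_normal hcov p (tangentCoord p p X) (tangentCoord p p Y) Z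
      rwa [hc, hc] at h
    T_φ := fun X Y Z ↦ by
      have h := S.nablaEndo_φ hcov p (tangentCoord p p Y) (tangentCoord p p Z) X
      have h1 := S.nablaEndo_skew hcov p (tangentCoord p p Z) (tangentCoord p p (S.φ p Y)) X
      rw [hc, hc] at h h1
      have h2 : ∑ α, S.ε α * (S.metric.val p Y (cov (S.ξ α) p X) * S.metric.val p Z (S.ξ α p) +
          S.metric.val p Y (S.ξ α p) * S.metric.val p Z (cov (S.ξ α) p X)) =
          ∑ α, (S.ε α * S.metric.val p (cov (S.ξ α) p X) Y * S.metric.val p (S.ξ α p) Z +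
            S.η α p Y * S.metric.val p (cov (S.ξ α) p X) Z) := by
        refine Finset.sum_congr rfl fun α _ ↦ ?_
        rw [S.η_eq, S.metric.symm p Y (cov _ _ _), S.metric.symm p Z (cov _ _ _),
          S.metric.symm p Z (S.ξ α p)]
        ring
      rw [h2] at h
      change S.metric.val p (nablaEndo cov S.φ p X (S.φ p Y)) Z -
        S.metric.val p (nablaEndo cov S.φ p X Y) (S.φ p Z) = ∑ α,
          (S.ε α * S.metric.val p (cov (S.ξ α) p X) Y * S.metric.val p (S.ξ α p) Z +
            S.η α p Y * S.metric.val p (cov (S.ξ α) p X) Z)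
      linarith
    T_ξ := fun α X Z ↦ by
      have h := congrArg (fun v ↦ S.metric.val p v Z) (S.nablaEndo_ξ hcov p α X)
      simp only [map_neg, _root_.neg_apply] at h
      exact h
    K_alt := fun α X Y ↦ by
      have h := S.cov_ξ_alt hcov p α (tangentCoord p p X) (tangentCoord p p Y)
      rwa [hc, hc] at h
    K_ξ := fun α β X ↦ S.cov_ξ_orthonormal hcov p α β X }

/-- `∇_X ξ_α = -ε_α φ X`. -/
theorem bilin_cov_ξ (hs : 0 < s) (p : M) (α : Fin s) (X Y : TangentSpace 𝓘(ℝ, E) p) :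
    S.metric.val p (cov (S.ξ α) p X) Y = S.ε α * S.metric.val p X (S.φ p Y) :=
  (S.sAlgebra hcov hs p).K_eq α X Y

/-- `(∇_X φ) Y = ∑ α, ε_α η^α(Y) φ² X + g(φ X, φ Y) ξ_α`. -/
theorem bilin_nablaEndo (hs : 0 < s) (p : M) (X Y Z : TangentSpace 𝓘(ℝ, E) p) :
    S.metric.val p (nablaEndo cov S.φ p X Y) Z =
      ∑ α, S.ε α * (S.η α p Y * S.metric.val p (S.φ p (S.φ p X)) Z +
        S.metric.val p (S.φ p X) (S.φ p Y) * S.η α p Z) :=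
  (S.sAlgebra hcov hs p).T_eq X Y Z

end IndefiniteSStructure

section Fields

variable {F : Type*} [NormedAddCommGroup F] [NormedSpace ℝ F] [FiniteDimensional ℝ F]
  {N : Type*} [TopologicalSpace N] [ChartedSpace F N] [IsManifold 𝓘(ℝ, F) ∞ N]

/-- A continuous vector field that does not lie in a smooth distribution at a point does not lie in
it at nearby points. -/
theorem IsSmoothDistribution.eventually_not_mem {D : ∀ p : N, Submodule ℝ (TangentSpace 𝓘(ℝ, F) p)}
    (hD : IsSmoothDistribution D) {X : ∀ q : N, TangentSpace 𝓘(ℝ, F) q} {p : N}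
    (hX : MDifferentiableAt 𝓘(ℝ, F) 𝓘(ℝ, F).tangent (fun q ↦ TotalSpace.mk' F q (X q)) p)
    (hp : X p ∉ D p) : ∀ᶠ q in 𝓝 p, X q ∉ D q := by
  obtain ⟨U, hU, hpU, r, Y, hY, hli⟩ := hD p
  have hYd : ∀ i, MDifferentiableAt 𝓘(ℝ, F) 𝓘(ℝ, F).tangent
      (fun q ↦ TotalSpace.mk' F q (Y i q)) p := fun i ↦
    ((hY i).contMDiffAt (hU.mem_nhds hpU)).mdifferentiableAt (by simp)
  let Z : ∀ q : N, Fin (r + 1) → TangentSpace 𝓘(ℝ, F) q := fun q ↦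
    Fin.cons (X q) fun i ↦ Y i q
  have hZ : ∀ q ∈ U, LinearIndependent ℝ (Z q) ↔ X q ∉ D q := by
    intro q hq
    rw [← (hli q hq).2]
    exact linearIndependent_finCons.trans (and_iff_right (hli q hq).1)
  let C : N → Fin (r + 1) → F := fun q i ↦ tangentCoord p q (Z q i)
  have hC : ContinuousAt C p := by
    refine continuousAt_pi.2 fun i ↦ ?_
    refine Fin.cases ?_ (fun i ↦ ?_) i
    · exact (mdifferentiableAt_tangentCoord hX).continuousAt
    · exact (mdifferentiableAt_tangentCoord (hYd i)).continuousAt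
  have hCi : ∀ q ∈ (chartAt F p).source, LinearIndependent ℝ (C q) ↔ LinearIndependent ℝ (Z q) := by
    intro q hq
    refine LinearMap.linearIndependent_iff (tangentCoord p q).toLinearMap
      (LinearMap.ker_eq_bot'.2 fun v hv ↦ ?_)
    rw [← coordFrame_tangentCoord hq v]
    exact (congrArg _ hv).trans (map_zero _)
  have hev := hC.preimage_mem_nhds (isOpen_setOfPred_linearIndependent.mem_nhds
    (show C p ∈ {f | LinearIndependent ℝ f} from
      (hCi p (mem_chart_source F p)).2 ((hZ p hpU).2 hp)))
  filter_upwards [hev, hU.mem_nhds hpU, chart_source_mem_nhds F p] with q h1 h2 h3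
  exact (hZ q h2).1 ((hCi q h3).1 h1)

end Fields

section ContactCR

variable {E : Type*} [NormedAddCommGroup E] [NormedSpace ℝ E] [FiniteDimensional ℝ E]
  {M : Type*} [TopologicalSpace M] [ChartedSpace E M] [IsManifold 𝓘(ℝ, E) ∞ M]
  {F : Type*} [NormedAddCommGroup F] [NormedSpace ℝ F] [FiniteDimensional ℝ F]
  {N : Type*} [TopologicalSpace N] [ChartedSpace F N] [IsManifold 𝓘(ℝ, F) ∞ N]
  {s : ℕ} {S : IndefiniteSStructure 𝓘(ℝ, E) M s} {f : N → M}
  {D : ∀ p : N, Submodule ℝ (TangentSpace 𝓘(ℝ, F) p)}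

namespace IsContactCRSubmanifold

variable (hf : IsContactCRSubmanifold S f D)
include hf

theorem orthComplement_orthDistribution (p : N) :
    orthComplement (inducedMetric 𝓘(ℝ, F) S.metric.val f p)
      (orthDistribution (inducedMetric 𝓘(ℝ, F) S.metric.val f) D p) = D p :=
  isCompl_orthComplement_orthComplement (fun _ _ ↦ S.metric.symm _ _ _) (hf.nondegenerate p)
    (hf.isCompl p)

theorem bilin_eq_zero {p : N} {x z : TangentSpace 𝓘(ℝ, F) p} (hx : x ∈ D p)
    (hz : z ∈ orthDistribution (inducedMetric 𝓘(ℝ, F) S.metric.val f) D p) :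
    S.metric.val (f p) (mfderiv 𝓘(ℝ, F) 𝓘(ℝ, E) f p x) (mfderiv 𝓘(ℝ, F) 𝓘(ℝ, E) f p z) = 0 :=
  hz x hx

/-- The Reeb fields of the ambient space restrict to differentiable fields. -/
theorem exists_ξ (α : Fin s) (p : N) : ∃ ζ : ∀ q : N, TangentSpace 𝓘(ℝ, F) q,
    MDifferentiableAt 𝓘(ℝ, F) 𝓘(ℝ, F).tangent (fun q ↦ TotalSpace.mk' F q (ζ q)) p ∧
    ∀ q, mfderiv 𝓘(ℝ, F) 𝓘(ℝ, E) f q (ζ q) = S.ξ α (f q) ∧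
      (ζ q ∈ D q ∨ ζ q ∈ orthDistribution (inducedMetric 𝓘(ℝ, F) S.metric.val f) D q) := by
  choose ζ hζ using hf.tangent_ξ α
  refine ⟨ζ, ?_, hζ⟩
  exact exists_field_of_tangent hf.immersion
    (DiffAlong.of_field (S.mdifferentiableAt_ξ α (f p))
      (hf.immersion.contMDiff.mdifferentiable (by simp) p))
    (Filter.Eventually.of_forall fun q ↦ (hζ q).1)

/-- If `ξ_α` is not orthogonal to some vector in `D^⊥`, then every section of `D` is orthogonal to
`ξ_α` nearby. -/
theorem η_eq_zero_or (α : Fin s) (p : N) :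
    (∀ w ∈ orthDistribution (inducedMetric 𝓘(ℝ, F) S.metric.val f) D p,
      S.η α (f p) (mfderiv 𝓘(ℝ, F) 𝓘(ℝ, E) f p w) = 0) ∨
    ∀ᶠ q in 𝓝 p, ∀ x ∈ D q, S.η α (f q) (mfderiv 𝓘(ℝ, F) 𝓘(ℝ, E) f q x) = 0 := by
  obtain ⟨ζ, hζd, hζ⟩ := hf.exists_ξ α p
  by_cases hp : ζ p ∈ D p
  · left
    intro w hw
    rw [S.η_eq, ← (hζ p).1, S.metric.symm, hf.bilin_eq_zero hp hw, mul_zero]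
  · right
    filter_upwards [hf.smooth.eventually_not_mem hζd hp] with q hq x hx
    rw [S.η_eq, ← (hζ q).1, hf.bilin_eq_zero hx ((hζ q).2.resolve_left hq), mul_zero]

variable {cov : CovariantDerivative 𝓘(ℝ, E) E (TangentSpace 𝓘(ℝ, E) : M → Type _)}
  (hcov : IsLeviCivita S.metric.val cov) (hs : 0 < s)
include hcov hs

theorem bilin_cov_section {covN : CovariantDerivative 𝓘(ℝ, F) F (TangentSpace 𝓘(ℝ, F) : N → Type _)}
    (hcovN : IsLeviCivita (inducedMetric 𝓘(ℝ, F) S.metric.val f) covN) {p : N}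
    {X : ∀ q : N, TangentSpace 𝓘(ℝ, F) q}
    (hX : MDifferentiableAt 𝓘(ℝ, F) 𝓘(ℝ, F).tangent (fun q ↦ TotalSpace.mk' F q (X q)) p)
    (hXD : ∀ᶠ q in 𝓝 p, X q ∈ D q) {y : TangentSpace 𝓘(ℝ, F) p}
    (hy : mfderiv 𝓘(ℝ, F) 𝓘(ℝ, E) f p y = S.φ (f p) (mfderiv 𝓘(ℝ, F) 𝓘(ℝ, E) f p (X p)))
    {z w : TangentSpace 𝓘(ℝ, F) p}
    (hz : z ∈ orthDistribution (inducedMetric 𝓘(ℝ, F) S.metric.val f) D p)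
    (hw : w ∈ orthDistribution (inducedMetric 𝓘(ℝ, F) S.metric.val f) D p) :
    inducedMetric 𝓘(ℝ, F) S.metric.val f p (covN X p z) w =
      S.metric.val (f p) (covHess cov f p z y)
        (S.φ (f p) (mfderiv 𝓘(ℝ, F) 𝓘(ℝ, E) f p w)) := by
  classical
  have hfs := hf.immersion.contMDiff
  have hfd := hfs.mdifferentiable (by simp) p
  have hσ := DiffAlong.mfderiv_field hfs hX
  have hφσ := hσ.endo (S.diffEndoAt (f p)) hfd
  rw [← bilin_covAlong_mfderiv hcov S.metric.symm hfs hcovN (S.metric.diffBilinAt _) hX z w]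
  have hXp := hXD.self_of_nhds
  set U := covAlong 𝓘(ℝ, F) cov f (fun q ↦ mfderiv 𝓘(ℝ, F) 𝓘(ℝ, E) f q (X q)) p z with hU
  set W := mfderiv 𝓘(ℝ, F) 𝓘(ℝ, E) f p w with hW
  have hη : ∀ α, S.ε α * (S.η α (f p) U * S.η α (f p) W) = 0 := by
    intro α
    rcases hf.η_eq_zero_or α p with h | h
    · rw [hW, h w hw, mul_zero, mul_zero]
    · have h1 : ∀ᶠ q in 𝓝 p, S.metric.val (f q) (mfderiv 𝓘(ℝ, F) 𝓘(ℝ, E) f q (X q))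
          (S.ξ α (f q)) = 0 := by
        filter_upwards [h, hXD] with q h2 h3
        rw [S.g_ξ, h2 _ h3, mul_zero]
      have h2 := mvfderiv_bilin_along hcov (S.metric.diffBilinAt _) hfd hσ
        (DiffAlong.of_field (S.mdifferentiableAt_ξ α (f p)) hfd) z
      rw [mvfderiv_eq_zero_of_eventuallyEq_const h1,
        covAlong_comp (S.mdifferentiableAt_ξ α (f p)) hfd, S.metric.symm _ _ (cov _ _ _),
        S.bilin_cov_ξ hcov hs] at h2
      obtain ⟨v, hv, hv'⟩ := hf.invariant p _ hXp
      rw [← hv', S.metric.symm _ _ (mfderiv 𝓘(ℝ, F) 𝓘(ℝ, E) f p v), hf.bilin_eq_zero hv hz,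
        mul_zero, add_zero, S.g_ξ] at h2
      rw [← mul_assoc, ← h2, zero_mul]
  have h1 := S.compatible (f p) U W
  rw [Finset.sum_congr rfl fun α _ ↦ hη α, Finset.sum_const_zero, sub_zero] at h1
  rw [← h1]
  have h2 := covAlong_endo (cov := cov) (S.diffEndoAt (f p)) hfd hσ z
  rw [eq_sub_of_add_eq' h2.symm, map_sub, _root_.sub_apply, S.bilin_nablaEndo hcov hs]
  have hn : ∀ v, S.metric.val (f p) (mfderiv 𝓘(ℝ, F) 𝓘(ℝ, E) f p v) (S.φ (f p) W) = 0 := fun v ↦ by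
    rw [S.metric.symm]
    exact hf.anti_invariant p w hw v
  have hz0 : S.metric.val (f p) (S.φ (f p) (S.φ (f p) (mfderiv 𝓘(ℝ, F) 𝓘(ℝ, E) f p z)))
      (S.φ (f p) W) = 0 := by
    rw [S.compatible, hf.anti_invariant p z hz w]
    simp only [show ∀ α v, S.η α (f p) (S.φ (f p) v) = 0 from
      fun α v ↦ (S.fAlgebra (f p)).η_φ α v, zero_mul, mul_zero, Finset.sum_const_zero, sub_zero]
  have hη0 : ∀ α, S.η α (f p) (S.φ (f p) W) = 0 := fun α ↦ (S.fAlgebra (f p)).η_φ α W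
  simp only [hz0, hη0, mul_zero, add_zero, Finset.sum_const_zero, sub_zero]
  -- replace `φ (df X)` by the image of a field on `N`
  let Y : ∀ q : N, TangentSpace 𝓘(ℝ, F) q := fun q ↦
    if h : X q ∈ D q then (hf.invariant q (X q) h).choose else 0
  have hY : ∀ᶠ q in 𝓝 p, mfderiv 𝓘(ℝ, F) 𝓘(ℝ, E) f q (Y q) =
      S.φ (f q) (mfderiv 𝓘(ℝ, F) 𝓘(ℝ, E) f q (X q)) := by
    filter_upwards [hXD] with q hq
    simp only [Y, dif_pos hq]
    exact (hf.invariant q (X q) hq).choose_spec.2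
  have hYd := exists_field_of_tangent hf.immersion hφσ hY
  have hYy : Y p = y := hf.immersion.injective_mfderiv p (hY.self_of_nhds.trans hy.symm)
  rw [covAlong_congr (τ := fun q ↦ mfderiv 𝓘(ℝ, F) 𝓘(ℝ, E) f q (Y q)) hfs.continuous.continuousAt
    (hY.mono fun q hq ↦ hq.symm), bilin_covAlong_of_tangent hf.immersion hYd hn, hYy]

/-- The form `g(h(z, y), φ w)` is symmetric in `z, w ∈ D^⊥`. -/
theorem bilin_covHess_comm {p : N} {y : TangentSpace 𝓘(ℝ, F) p} (hy : y ∈ D p)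
    (hη : ∀ α, S.η α (f p) (mfderiv 𝓘(ℝ, F) 𝓘(ℝ, E) f p y) = 0)
    {Z W : ∀ q : N, TangentSpace 𝓘(ℝ, F) q}
    (hZ : MDifferentiableAt 𝓘(ℝ, F) 𝓘(ℝ, F).tangent (fun q ↦ TotalSpace.mk' F q (Z q)) p)
    (hW : MDifferentiableAt 𝓘(ℝ, F) 𝓘(ℝ, F).tangent (fun q ↦ TotalSpace.mk' F q (W q)) p)
    (hZD : ∀ᶠ q in 𝓝 p, Z q ∈ orthDistribution (inducedMetric 𝓘(ℝ, F) S.metric.val f) D q)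
    (hWD : ∀ᶠ q in 𝓝 p, W q ∈ orthDistribution (inducedMetric 𝓘(ℝ, F) S.metric.val f) D q) :
    S.metric.val (f p) (covHess cov f p (Z p) y)
        (S.φ (f p) (mfderiv 𝓘(ℝ, F) 𝓘(ℝ, E) f p (W p))) =
      S.metric.val (f p) (covHess cov f p (W p) y)
        (S.φ (f p) (mfderiv 𝓘(ℝ, F) 𝓘(ℝ, E) f p (Z p))) := by
  have hfs := hf.immersion.contMDiff
  have hfd := hfs.mdifferentiable (by simp) p
  have hZp := hZD.self_of_nhds
  have hWp := hWD.self_of_nhds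
  have hσ := DiffAlong.mfderiv_field hfs hZ
  have hτ := DiffAlong.mfderiv_field hfs hW
  have hφσ := hσ.endo (S.diffEndoAt (f p)) hfd
  have hn : ∀ {w}, w ∈ orthDistribution (inducedMetric 𝓘(ℝ, F) S.metric.val f) D p →
      ∀ v, S.metric.val (f p) (mfderiv 𝓘(ℝ, F) 𝓘(ℝ, E) f p v)
        (S.φ (f p) (mfderiv 𝓘(ℝ, F) 𝓘(ℝ, E) f p w)) = 0 := fun hw v ↦ by
    rw [S.metric.symm]
    exact hf.anti_invariant p _ hw v
  rw [covHess_comm hcov hfs, covHess_comm hcov hfs p (W p),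
    ← bilin_covAlong_of_tangent hf.immersion hZ (hn hWp),
    ← bilin_covAlong_of_tangent hf.immersion hW (hn hZp)]
  have h1 : ∀ᶠ q in 𝓝 p, S.metric.val (f q) (mfderiv 𝓘(ℝ, F) 𝓘(ℝ, E) f q (W q))
      (S.φ (f q) (mfderiv 𝓘(ℝ, F) 𝓘(ℝ, E) f q (Z q))) = 0 := by
    filter_upwards [hZD] with q hq
    rw [S.metric.symm]
    exact hf.anti_invariant q _ hq _
  have h2 := mvfderiv_bilin_along hcov (S.metric.diffBilinAt _) hfd hτ hφσ y
  rw [mvfderiv_eq_zero_of_eventuallyEq_const h1, covAlong_endo (S.diffEndoAt (f p)) hfd hσ,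
    map_add, S.metric.symm _ _ (nablaEndo _ _ _ _ _), S.bilin_nablaEndo hcov hs] at h2
  have h3 : ∀ α, S.ε α * (S.η α (f p) (mfderiv 𝓘(ℝ, F) 𝓘(ℝ, E) f p (Z p)) *
      S.metric.val (f p) (S.φ (f p) (S.φ (f p) (mfderiv 𝓘(ℝ, F) 𝓘(ℝ, E) f p y)))
        (mfderiv 𝓘(ℝ, F) 𝓘(ℝ, E) f p (W p)) +
      S.metric.val (f p) (S.φ (f p) (mfderiv 𝓘(ℝ, F) 𝓘(ℝ, E) f p y))
        (S.φ (f p) (mfderiv 𝓘(ℝ, F) 𝓘(ℝ, E) f p (Z p))) *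
        S.η α (f p) (mfderiv 𝓘(ℝ, F) 𝓘(ℝ, E) f p (W p))) = 0 := by
    intro α
    rw [S.compatible, hf.bilin_eq_zero hy hZp, S.φ_sq]
    simp only [hη, zero_smul, zero_mul, mul_zero, Finset.sum_const_zero, add_zero, sub_zero,
      map_neg, _root_.neg_apply, hf.bilin_eq_zero hy hWp, neg_zero]
  rw [Finset.sum_congr rfl fun α _ ↦ h3 α, Finset.sum_const_zero, zero_add,
    S.metric.symm _ (mfderiv 𝓘(ℝ, F) 𝓘(ℝ, E) f p (W p)), S.g_φ_left] at h2
  linarith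

omit hcov hs in
/-- Every vector of `D` orthogonal to the Reeb fields is in the image of `φ`. -/
theorem exists_φ_eq {p : N} {y : TangentSpace 𝓘(ℝ, F) p} (hy : y ∈ D p)
    (hη : ∀ α, S.η α (f p) (mfderiv 𝓘(ℝ, F) 𝓘(ℝ, E) f p y) = 0) : ∃ x ∈ D p,
      mfderiv 𝓘(ℝ, F) 𝓘(ℝ, E) f p y = S.φ (f p) (mfderiv 𝓘(ℝ, F) 𝓘(ℝ, E) f p x) := by
  obtain ⟨v, hv, hv'⟩ := hf.invariant p y hy
  refine ⟨-v, (D p).neg_mem hv, ?_⟩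
  rw [map_neg, map_neg, hv', S.φ_sq]
  simp [hη]

end IsContactCRSubmanifold

end ContactCR

section TotalDifferentialEquation

open Metric ODE

theorem IsPicardLindelof.exists_eq_forall_mem_closedBall {E : Type*} [NormedAddCommGroup E]
    [NormedSpace ℝ E] [CompleteSpace E] {f : ℝ → E → E} {tmin tmax : ℝ} {t₀ : Icc tmin tmax}
    {x₀ x : E} {a r L K : NNReal} (hf : IsPicardLindelof f t₀ x₀ a r L K)
    (hx : x ∈ closedBall x₀ r) :
    ∃ α : ℝ → E, α t₀ = x ∧ (∀ t, α t ∈ closedBall x₀ a) ∧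
      ∀ t ∈ Icc tmin tmax, HasDerivWithinAt α (f t (α t)) (Icc tmin tmax) t := by
  obtain ⟨α, hα⟩ := FunSpace.exists_isFixedPt_next hf hx
  refine ⟨α.compProj, by rw [FunSpace.compProj_val, ← hα, FunSpace.next_apply₀],
    fun t ↦ α.compProj_mem_closedBall hf.mul_max_le, fun t ht ↦ ?_⟩
  apply hasDerivWithinAt_picard_Icc t₀.2 hf.continuousOn_uncurry
    α.continuous_compProj.continuousOn (fun _ ht' ↦ α.compProj_mem_closedBall hf.mul_max_le)
    x ht |>.congr_of_mem _ ht
  intro t' ht'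
  nth_rw 1 [← hα]
  rw [FunSpace.compProj_of_mem ht', FunSpace.next_apply]

variable {E : Type*} [NormedAddCommGroup E] [NormedSpace ℝ E]
  {K : Type*} [NormedAddCommGroup K] [NormedSpace ℝ K]

set_option synthInstance.maxHeartbeats 200000 in
/-- If two solutions `v`, `w` of `v' = V(v) t` and `w' = V(w) (t + h)` start at the same point and
`V` satisfies the integrability condition, then `w(1) = v(1) + V(v(1)) h + O(h²)`. -/
theorem norm_sub_sub_le_of_integrable {V : E → K →L[ℝ] E} {V' : E → E →L[ℝ] K →L[ℝ] E} {x₀ : E}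
    {a M C₁ C₂ : NNReal}
    (hV : ∀ x ∈ closedBall x₀ a, HasFDerivAt V (V' x) x)
    (hM : ∀ x ∈ closedBall x₀ a, ‖V x‖ ≤ M) (hC₁ : ∀ x ∈ closedBall x₀ a, ‖V' x‖ ≤ C₁)
    (hC₂ : LipschitzOnWith C₂ V' (closedBall x₀ a))
    (hsymm : ∀ x ∈ closedBall x₀ a, ∀ k l, V' x (V x k) l = V' x (V x l) k)
    {t h : K} {δ : NNReal} (hδ : ‖t + h‖ ≤ δ) (hh : M * ‖h‖ ≤ a / 2) {v w : ℝ → E}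
    (hv0 : v 0 = x₀) (hw0 : w 0 = x₀) (hva : ∀ s, v s ∈ closedBall x₀ (a / 2))
    (hwa : ∀ s, w s ∈ closedBall x₀ (a / 2))
    (hv : ∀ s ∈ Icc (0 : ℝ) 1, HasDerivWithinAt v (V (v s) t) (Icc 0 1) s)
    (hw : ∀ s ∈ Icc (0 : ℝ) 1, HasDerivWithinAt w (V (w s) (t + h)) (Icc 0 1) s) :
    ‖w 1 - v 1 - V (v 1) h‖ ≤
      (C₁ * M + C₂ * M ^ 2 * δ) / (C₁ * δ + 1) * (Real.exp (C₁ * δ + 1) - 1) * ‖h‖ ^ 2 := by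
  have hsub : closedBall x₀ (a / 2) ⊆ closedBall x₀ (a : ℝ) :=
    closedBall_subset_closedBall (by linarith [a.2])
  have hconv : Convex ℝ (closedBall x₀ (a : ℝ)) := convex_closedBall _ _
  have hIci : ∀ s ∈ Ico (0 : ℝ) 1, Icc (0 : ℝ) 1 ∈ 𝓝[Ici s] s := fun s hs ↦
    Icc_mem_nhdsGE_of_mem ⟨hs.1, hs.2⟩
  let u : ℝ → E := fun s ↦ v s + s • V (v s) h
  let u' : ℝ → E := fun s ↦ V (v s) t + (s • V' (v s) (V (v s) t) h + (1 : ℝ) • V (v s) h)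
  have hu : ∀ s ∈ Icc (0 : ℝ) 1, HasDerivWithinAt u (u' s) (Icc 0 1) s := by
    intro s hs
    have h1 : HasDerivWithinAt (fun s ↦ V (v s)) (V' (v s) (V (v s) t)) (Icc 0 1) s :=
      (hV _ (hsub (hva s))).comp_hasDerivWithinAt s (hv s hs)
    have h2 : HasDerivWithinAt (fun s ↦ V (v s) h) (V' (v s) (V (v s) t) h) (Icc 0 1) s := by
      have := h1.clm_apply (hasDerivWithinAt_const s (Icc 0 1) h)
      simpa using this
    exact (hv s hs).add ((hasDerivWithinAt_id s _).smul h2)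
  have hVh : ∀ s, ‖V (v s) h‖ ≤ M * ‖h‖ := fun s ↦
    (ContinuousLinearMap.le_opNorm _ _).trans
      (mul_le_mul_of_nonneg_right (hM _ (hsub (hva s))) (norm_nonneg _))
  have hsVh : ∀ s ∈ Icc (0 : ℝ) 1, ‖s • V (v s) h‖ ≤ M * ‖h‖ := fun s hs ↦ by
    rw [norm_smul, Real.norm_of_nonneg hs.1]
    exact (mul_le_of_le_one_left (norm_nonneg _) hs.2).trans (hVh s)
  have hua : ∀ s ∈ Icc (0 : ℝ) 1, u s ∈ closedBall x₀ (a : ℝ) := by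
    intro s hs
    have h1 := mem_closedBall_iff_norm.1 (hva s)
    rw [mem_closedBall_iff_norm]
    calc ‖u s - x₀‖ = ‖(v s - x₀) + s • V (v s) h‖ := by simp only [u]; congr 1; abel
      _ ≤ ‖v s - x₀‖ + ‖s • V (v s) h‖ := norm_add_le _ _
      _ ≤ a / 2 + a / 2 := add_le_add h1 ((hsVh s hs).trans hh)
      _ = a := add_halves _
  have hlip : LipschitzOnWith (C₁ * δ + 1) (fun x ↦ V x (t + h)) (closedBall x₀ a) := by
    refine LipschitzOnWith.of_dist_le_mul fun x hx y hy ↦ ?_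
    rw [dist_eq_norm, dist_eq_norm, ← _root_.sub_apply]
    have h1 : ‖V x - V y‖ ≤ C₁ * ‖x - y‖ :=
      hconv.norm_image_sub_le_of_norm_hasFDerivWithin_le
        (fun z hz ↦ (hV z hz).hasFDerivWithinAt) hC₁ hy hx
    calc ‖(V x - V y) (t + h)‖ ≤ ‖V x - V y‖ * ‖t + h‖ := ContinuousLinearMap.le_opNorm _ _
      _ ≤ (C₁ * ‖x - y‖) * δ := by gcongr
      _ ≤ (C₁ * δ + 1 : NNReal) * ‖x - y‖ := by
        push_cast
        nlinarith [norm_nonneg (x - y)]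
  have hest : ∀ s ∈ Ico (0 : ℝ) 1, dist (u' s) (V (u s) (t + h)) ≤
      (C₁ * M + C₂ * M ^ 2 * δ) * ‖h‖ ^ 2 := by
    intro s hs
    have hs' : s ∈ Icc (0 : ℝ) 1 := Ico_subset_Icc_self hs
    have hrem : ‖V (u s) - V (v s) - V' (v s) (u s - v s)‖ ≤
        (C₂ * (M * ‖h‖)) * ‖u s - v s‖ := by
      refine Convex.norm_image_sub_le_of_norm_hasFDerivWithin_le' (s := segment ℝ (v s) (u s))
        (f' := V') (fun z hz ↦ (hV z (hconv.segment_subset (hsub (hva s)) (hua s hs')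
          hz)).hasFDerivWithinAt) (fun z hz ↦ ?_) (convex_segment _ _) (left_mem_segment _ _ _)
        (right_mem_segment _ _ _)
      have h1 := hC₂.dist_le_mul z (hconv.segment_subset (hsub (hva s)) (hua s hs') hz) (v s)
        (hsub (hva s))
      rw [dist_eq_norm, dist_eq_norm] at h1
      refine h1.trans ?_
      gcongr
      refine (norm_sub_le_of_mem_segment hz).trans ?_
      have : u s - v s = s • V (v s) h := by simp [u]
      rw [this]
      exact hsVh s hs'
    have hus : u s - v s = s • V (v s) h := by simp [u]
    have hdec : u' s - V (u s) (t + h) = -(s • V' (v s) (V (v s) h) h) -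
        (V (u s) - V (v s) - V' (v s) (u s - v s)) (t + h) := by
      rw [hus]
      simp only [u', hsymm _ (hsub (hva s)) t h, _root_.sub_apply, map_add, map_smul,
        _root_.smul_apply]
      module
    rw [dist_eq_norm, hdec]
    have h1 : ‖s • V' (v s) (V (v s) h) h‖ ≤ C₁ * M * ‖h‖ ^ 2 := by
      rw [norm_smul, Real.norm_of_nonneg hs.1]
      refine (mul_le_of_le_one_left (norm_nonneg _) hs.2.le).trans ?_
      calc ‖V' (v s) (V (v s) h) h‖ ≤ ‖V' (v s)‖ * ‖V (v s) h‖ * ‖h‖ :=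
            ContinuousLinearMap.le_opNorm₂ _ _ _
        _ ≤ C₁ * (M * ‖h‖) * ‖h‖ := by
            gcongr
            · exact hC₁ _ (hsub (hva s))
            · exact hVh s
        _ = C₁ * M * ‖h‖ ^ 2 := by ring
    have h2 : ‖(V (u s) - V (v s) - V' (v s) (u s - v s)) (t + h)‖ ≤
        C₂ * M ^ 2 * δ * ‖h‖ ^ 2 := by
      calc _ ≤ ‖V (u s) - V (v s) - V' (v s) (u s - v s)‖ * ‖t + h‖ :=
            ContinuousLinearMap.le_opNorm _ _
        _ ≤ ((C₂ * (M * ‖h‖)) * (M * ‖h‖)) * δ := by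
            gcongr
            refine hrem.trans ?_
            gcongr
            rw [hus]
            exact hsVh s hs'
        _ = C₂ * M ^ 2 * δ * ‖h‖ ^ 2 := by ring
    calc _ ≤ ‖-(s • V' (v s) (V (v s) h) h)‖ + _ := norm_sub_le _ _
      _ ≤ C₁ * M * ‖h‖ ^ 2 + C₂ * M ^ 2 * δ * ‖h‖ ^ 2 := by
          rw [norm_neg]
          exact add_le_add h1 h2
      _ = _ := by ring
  have key := dist_le_of_approx_trajectories_ODE_of_mem (v := fun _ x ↦ V x (t + h))
    (s := fun _ ↦ closedBall x₀ a) (f := u) (g := w) (f' := u') (g' := fun s ↦ V (w s) (t + h))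
    (a := 0) (b := 1) (δ := 0) (εg := 0) (fun s _ ↦ hlip)
    (fun s hs ↦ (hu s hs).continuousWithinAt)
    (fun s hs ↦ (hu s (Ico_subset_Icc_self hs)).mono_of_mem_nhdsWithin (hIci s hs)) hest
    (fun s hs ↦ hua s (Ico_subset_Icc_self hs))
    (fun s hs ↦ (hw s hs).continuousWithinAt)
    (fun s hs ↦ (hw s (Ico_subset_Icc_self hs)).mono_of_mem_nhdsWithin (hIci s hs))
    (fun s _ ↦ by simp) (fun s _ ↦ hsub (hwa s)) (by simp [u, hv0, hw0]) 1 (by simp)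
  rw [gronwallBound_of_K_ne_0 (by positivity), dist_comm, dist_eq_norm] at key
  calc ‖w 1 - v 1 - V (v 1) h‖ = ‖w 1 - u 1‖ := by
        simp only [u, one_smul, sub_sub]
    _ ≤ _ := key
    _ = _ := by
      push_cast
      simp only [add_zero, zero_mul, zero_add, sub_zero, mul_one]
      ring

end TotalDifferentialEquation

section TotalDifferentialEquation

open Metric

variable {E : Type*} [NormedAddCommGroup E] [NormedSpace ℝ E] [CompleteSpace E]
  {K : Type*} [NormedAddCommGroup K] [NormedSpace ℝ K]

theorem ContinuousAt.eventually_norm_lt {X G : Type*} [TopologicalSpace X] [NormedAddCommGroup G]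
    {f : X → G} {x : X} (hf : ContinuousAt f x) : ∀ᶠ y in 𝓝 x, ‖f y‖ < ‖f x‖ + 1 :=
  hf.norm.eventually_lt_const (lt_add_one _)

theorem contDiffOn_of_hasFDerivAt_comp {V : E → K →L[ℝ] E} {y : K → E} {s : Set K} (hs : IsOpen s)
    (hy : ∀ t ∈ s, HasFDerivAt y (V (y t)) t) (hV : ∀ t ∈ s, ContDiffAt ℝ ∞ V (y t)) :
    ContDiffOn ℝ ∞ y s := by
  refine contDiffOn_infty.2 fun n ↦ ?_
  induction n with
  | zero => exact contDiffOn_zero.2 fun t ht ↦ (hy t ht).continuousAt.continuousWithinAt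
  | succ n ih =>
    rw [show ((n + 1 : ℕ) : WithTop ℕ∞) = (n : WithTop ℕ∞) + 1 by norm_cast,
      contDiffOn_succ_iff_fderiv_of_isOpen hs]
    refine ⟨fun t ht ↦ (hy t ht).differentiableAt.differentiableWithinAt, by simp, ?_⟩
    have h1 : ContDiffOn ℝ n (fun t ↦ V (y t)) s := fun t ht ↦
      ((hV t ht).of_le (by exact_mod_cast le_top)).comp_contDiffWithinAt t (ih t ht)
    exact h1.congr fun t ht ↦ (hy t ht).fderiv

set_option synthInstance.maxHeartbeats 200000 in
/-- The Frobenius theorem for total differential equations `dy = V(y)`. -/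
theorem exists_hasFDerivAt_of_integrable {V : E → K →L[ℝ] E} {x₀ : E}
    (hV : ∀ᶠ x in 𝓝 x₀, ContDiffAt ℝ ∞ V x)
    (hsymm : ∀ᶠ x in 𝓝 x₀, ∀ k l, fderiv ℝ V x (V x k) l = fderiv ℝ V x (V x l) k)
    {U : Set E} (hU : U ∈ 𝓝 x₀) :
    ∃ δ > 0, ∃ y : K → E, y 0 = x₀ ∧ ContDiffOn ℝ ∞ y (ball 0 δ) ∧
      ∀ t ∈ ball (0 : K) δ, y t ∈ U ∧ HasFDerivAt y (V (y t)) t := by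
  have hV0 := hV.self_of_nhds
  have hV1 : ContDiffAt ℝ 1 (fderiv ℝ V) x₀ :=
    hV0.fderiv_right (by norm_cast)
  obtain ⟨C₂, s, hs, hC₂⟩ := hV1.exists_lipschitzOnWith
  have hb1 : ∀ᶠ x in 𝓝 x₀, ‖V x‖ < ‖V x₀‖ + 1 :=
    hV0.continuousAt.eventually_norm_lt
  have hb2 : ∀ᶠ x in 𝓝 x₀, ‖fderiv ℝ V x‖ < ‖fderiv ℝ V x₀‖ + 1 :=
    hV1.continuousAt.eventually_norm_lt
  obtain ⟨a, ha, hsub⟩ := nhds_basis_closedBall.mem_iff.1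
    (hV.and (hsymm.and (hb1.and (hb2.and (Filter.inter_mem hs hU)))))
  lift a to NNReal using ha.le
  have ha' : (0 : ℝ) < a := ha
  set M : NNReal := ‖V x₀‖₊ + 1 with hMdef
  set C₁ : NNReal := ‖fderiv ℝ V x₀‖₊ + 1
  have hMpos : (0 : ℝ) < M := by positivity
  have hd : ∀ x ∈ closedBall x₀ a, HasFDerivAt V (fderiv ℝ V x) x := fun x hx ↦
    ((hsub hx).1.differentiableAt (by simp)).hasFDerivAt
  have hM : ∀ x ∈ closedBall x₀ a, ‖V x‖ ≤ M := fun x hx ↦ (hsub hx).2.2.1.le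
  have hC₁ : ∀ x ∈ closedBall x₀ a, ‖fderiv ℝ V x‖ ≤ C₁ := fun x hx ↦ (hsub hx).2.2.2.1.le
  have hC₂' : LipschitzOnWith C₂ (fderiv ℝ V) (closedBall x₀ a) :=
    hC₂.mono fun x hx ↦ (hsub hx).2.2.2.2.1
  have hsy : ∀ x ∈ closedBall x₀ a, ∀ k l, fderiv ℝ V x (V x k) l = fderiv ℝ V x (V x l) k :=
    fun x hx ↦ (hsub hx).2.1
  have hhalf : closedBall x₀ (a / 2) ⊆ closedBall x₀ (a : ℝ) :=
    closedBall_subset_closedBall (by linarith)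
  set δ : NNReal := a / 2 / M with hδdef
  have hδ : (0 : ℝ) < δ := by
    rw [hδdef]
    push_cast
    positivity
  have hMδ : (M : ℝ) * δ = a / 2 := by
    rw [hδdef]
    push_cast
    field_simp
  have hex : ∀ t : K, ∃ v : ℝ → E, ‖t‖ < δ → v 0 = x₀ ∧ (∀ s, v s ∈ closedBall x₀ (a / 2)) ∧
      ∀ s ∈ Icc (0 : ℝ) 1, HasDerivWithinAt v (V (v s) t) (Icc 0 1) s := by
    intro t
    by_cases ht : ‖t‖ < δ
    · have hpl : IsPicardLindelof (fun _ x ↦ V x t) (⟨0, by simp⟩ : Icc (0 : ℝ) 1) x₀ (a / 2) 0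
          (M * ‖t‖₊) (C₁ * ‖t‖₊) := by
        refine IsPicardLindelof.of_time_independent (fun x hx ↦ ?_) ?_ ?_
        · refine (ContinuousLinearMap.le_opNorm _ _).trans ?_
          push_cast at hx ⊢
          exact mul_le_mul_of_nonneg_right (hM x (hhalf hx)) (norm_nonneg _)
        · refine LipschitzOnWith.of_dist_le_mul fun x hx z hz ↦ ?_
          push_cast at hx hz ⊢
          rw [dist_eq_norm, dist_eq_norm, ← _root_.sub_apply]
          have h1 : ‖V x - V z‖ ≤ C₁ * ‖x - z‖ :=
            (convex_closedBall x₀ (a : ℝ)).norm_image_sub_le_of_norm_hasFDerivWithin_le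
              (fun z hz ↦ (hd z hz).hasFDerivWithinAt) hC₁ (hhalf hz) (hhalf hx)
          calc _ ≤ ‖V x - V z‖ * ‖t‖ := ContinuousLinearMap.le_opNorm _ _
            _ ≤ (C₁ * ‖x - z‖) * ‖t‖ := by gcongr
            _ = _ := by ring
        · push_cast
          simp only [sub_zero, sub_self]
          rw [max_eq_left zero_le_one, mul_one]
          rw [← hMδ]
          exact mul_le_mul_of_nonneg_left ht.le hMpos.le
      obtain ⟨v, h1, h2, h3⟩ := hpl.exists_eq_forall_mem_closedBall (x := x₀) (by simp)
      exact ⟨v, fun _ ↦ ⟨h1, fun s ↦ by simpa using h2 s, h3⟩⟩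
    · exact ⟨0, fun h ↦ absurd h ht⟩
  choose v hv using hex
  let y : K → E := fun t ↦ v t 1
  have hya : ∀ t ∈ ball (0 : K) δ, y t ∈ closedBall x₀ (a : ℝ) := fun t ht ↦
    hhalf ((hv t (mem_ball_zero_iff.1 ht)).2.1 1)
  have hy : ∀ t ∈ ball (0 : K) δ, HasFDerivAt y (V (y t)) t := by
    intro t ht
    have htδ := mem_ball_zero_iff.1 ht
    obtain ⟨h1, h2, h3⟩ := hv t htδ
    have hbig : (fun t' ↦ y t' - y t - V (y t) (t' - t)) =O[𝓝 t] fun t' ↦ ‖t' - t‖ ^ 2 := by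
      refine Asymptotics.IsBigO.of_bound
        ((C₁ * M + C₂ * M ^ 2 * δ) / (C₁ * δ + 1) * (Real.exp (C₁ * δ + 1) - 1)) ?_
      filter_upwards [isOpen_ball.mem_nhds ht, ball_mem_nhds t hδ] with t' ht' hh
      obtain ⟨h1', h2', h3'⟩ := hv t' (mem_ball_zero_iff.1 ht')
      rw [mem_ball_iff_norm] at hh
      have hadd : t + (t' - t) = t' := add_sub_cancel t t'
      have := norm_sub_sub_le_of_integrable hd hM hC₁ hC₂' hsy (t := t) (h := t' - t) (δ := δ)
        (by rw [hadd]; exact (mem_ball_zero_iff.1 ht').le)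
        (by rw [← hMδ]; exact mul_le_mul_of_nonneg_left hh.le hMpos.le) h1 h1' h2 h2' h3
        (by rwa [hadd])
      rwa [Real.norm_of_nonneg (by positivity : (0 : ℝ) ≤ ‖t' - t‖ ^ 2)]
    have h4 := hbig.hasFDerivAt (𝕜 := ℝ) one_lt_two
    have h5 : HasFDerivAt (fun t' ↦ y t + V (y t) (t' - t)) (V (y t)) t :=
      ((V (y t)).hasFDerivAt.comp t ((hasFDerivAt_id t).sub_const t)).const_add _
    have h6 := h4.add h5
    rw [zero_add] at h6
    refine h6.congr_of_eventuallyEq (Filter.Eventually.of_forall fun t' ↦ ?_)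
    simp only [Pi.add_apply]
    abel
  refine ⟨δ, hδ, y, ?_, contDiffOn_of_hasFDerivAt_comp isOpen_ball hy
    fun t ht ↦ (hsub (hya t ht)).1, fun t ht ↦ ⟨(hsub (hya t ht)).2.2.2.2.2, hy t ht⟩⟩
  obtain ⟨h1, h2, h3⟩ := hv 0 (by simpa using hδ)
  have hconst : ∀ s ∈ Icc (0 : ℝ) 1, v 0 s = v 0 0 := by
    refine constant_of_has_deriv_right_zero (fun s hs ↦ (h3 s hs).continuousWithinAt) fun s hs ↦ ?_
    have := (h3 s (Ico_subset_Icc_self hs)).mono_of_mem_nhdsWithin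
      (Icc_mem_nhdsGE_of_mem ⟨hs.1, hs.2⟩ : Icc (0 : ℝ) 1 ∈ 𝓝[Ici s] s)
    simpa using this
  exact (hconst 1 (by simp)).trans h1

end TotalDifferentialEquation

section Frobenius

open Metric

variable {E : Type*} [NormedAddCommGroup E] [NormedSpace ℝ E] [FiniteDimensional ℝ E]
  {W : Type*} [NormedAddCommGroup W] [NormedSpace ℝ W] [FiniteDimensional ℝ W]

section Projection

variable {P : Type*}

/-- The projection of `k ∈ ker A(x₀)` to `ker A(x)` along the range of `R`. -/
def kernelProjection (A : P → E →L[ℝ] W) (R : W →L[ℝ] E) (x₀ x : P) :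
    LinearMap.ker (A x₀).toLinearMap →L[ℝ] E :=
  (LinearMap.ker (A x₀).toLinearMap).subtypeL -
    R ∘L ((A x ∘L R).inverse ∘L A x ∘L (LinearMap.ker (A x₀).toLinearMap).subtypeL)

variable {A : P → E →L[ℝ] W} {R : W →L[ℝ] E} {x₀ : P}

theorem kernelProjection_apply (x : P) (k : LinearMap.ker (A x₀).toLinearMap) :
    kernelProjection A R x₀ x k = k - R ((A x ∘L R).inverse (A x k)) := rfl

theorem apply_kernelProjection {x : P}
    (hx : ∀ w, (A x ∘L R).inverse ((A x ∘L R) w) = w ∧ (A x ∘L R) ((A x ∘L R).inverse w) = w)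
    (k : LinearMap.ker (A x₀).toLinearMap) : A x (kernelProjection A R x₀ x k) = 0 := by
  rw [kernelProjection_apply, map_sub]
  exact sub_eq_zero.2 (hx _).2.symm

theorem sub_kernelProjection (hR : ∀ w, A x₀ (R w) = w) (x : P)
    (k : LinearMap.ker (A x₀).toLinearMap) :
    kernelProjection A R x₀ x k - R (A x₀ (kernelProjection A R x₀ x k)) = k := by
  have hk : A x₀ k = 0 := k.2
  rw [kernelProjection_apply, map_sub, hR, hk, zero_sub, map_neg]
  abel

theorem exists_kernelProjection_eq (hR : ∀ w, A x₀ (R w) = w) {x : P}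
    (hx : ∀ w, (A x ∘L R).inverse ((A x ∘L R) w) = w ∧ (A x ∘L R) ((A x ∘L R).inverse w) = w)
    {v : E} (hv : A x v = 0) : ∃ k, kernelProjection A R x₀ x k = v := by
  have hmem : A x₀ (v - R (A x₀ v)) = 0 := by rw [map_sub, hR, sub_self]
  refine ⟨⟨_, hmem⟩, ?_⟩
  have h := (hx (A x₀ v)).1
  rw [ContinuousLinearMap.comp_apply] at h
  change v - R (A x₀ v) - R ((A x ∘L R).inverse (A x (v - R (A x₀ v)))) = v
  rw [map_sub (A x), hv, zero_sub, map_neg, h, map_neg]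
  abel

theorem eventually_inverse_comp [TopologicalSpace P] (hR : ∀ w, A x₀ (R w) = w) (hA : ContinuousAt A x₀) :
    ∀ᶠ x in 𝓝 x₀, ∀ w, (A x ∘L R).inverse ((A x ∘L R) w) = w ∧
      (A x ∘L R) ((A x ∘L R).inverse w) = w := by
  have hid : A x₀ ∘L R = ContinuousLinearMap.id ℝ W := ContinuousLinearMap.ext hR
  have h1 : ContinuousAt (fun x ↦ A x ∘L R) x₀ := hA.clm_comp continuousAt_const
  exact h1.tendsto.eventually (hid ▸ eventually_inverse_apply_apply)

end Projection

variable {A : E → E →L[ℝ] W} {R : W →L[ℝ] E} {x₀ : E}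

theorem contDiffAt_kernelProjection {x : E} (hA : ContDiffAt ℝ ∞ A x)
    (hx : ∀ w, (A x ∘L R).inverse ((A x ∘L R) w) = w ∧ (A x ∘L R) ((A x ∘L R).inverse w) = w) :
    ContDiffAt ℝ ∞ (kernelProjection A R x₀) x := by
  have h1 : ContDiffAt ℝ ∞ (fun x ↦ A x ∘L R) x := hA.clm_comp contDiffAt_const
  let e : W ≃L[ℝ] W := ContinuousLinearEquiv.equivOfInverse (A x ∘L R) (A x ∘L R).inverse
    (fun w ↦ (hx w).1) fun w ↦ (hx w).2
  have h2 : ContDiffAt ℝ ∞ (fun x ↦ (A x ∘L R).inverse) x :=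
    ContDiffAt.comp (g := ContinuousLinearMap.inverse) x (contDiffAt_map_inverse e) h1
  exact contDiffAt_const.sub (contDiffAt_const.clm_comp (h2.clm_comp
    (hA.clm_comp contDiffAt_const)))

/-- The integrability condition for the kernel of a vector-valued one-form `A`. -/
theorem fderiv_kernelProjection_comm (hA : ∀ᶠ x in 𝓝 x₀, ContDiffAt ℝ ∞ A x)
    (hR : ∀ w, A x₀ (R w) = w)
    (hd : ∀ᶠ x in 𝓝 x₀, ∀ a b, A x a = 0 → A x b = 0 → fderiv ℝ A x a b = fderiv ℝ A x b a) :
    ∀ᶠ x in 𝓝 x₀, ∀ k l, fderiv ℝ (kernelProjection A R x₀) x (kernelProjection A R x₀ x k) l =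
      fderiv ℝ (kernelProjection A R x₀) x (kernelProjection A R x₀ x l) k := by
  have hinv := eventually_inverse_comp hR hA.self_of_nhds.continuousAt
  filter_upwards [hA, hd, hinv, hinv.eventually_nhds] with x hAx hdx hx hxx k l
  have hV := (contDiffAt_kernelProjection (x₀ := x₀) hAx hx).differentiableAt (by simp)
  have hAd := hAx.differentiableAt (by simp)
  have hrange : ∀ u l, ∃ w, fderiv ℝ (kernelProjection A R x₀) x u l = R w := by
    intro u l
    have h1 : ∀ x, (kernelProjection A R x₀ x l) - R (A x₀ (kernelProjection A R x₀ x l)) = l :=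
      fun x ↦ sub_kernelProjection hR x l
    let ρ : E →L[ℝ] E := ContinuousLinearMap.id ℝ E - R ∘L A x₀
    have h2 : HasFDerivAt (fun x ↦ kernelProjection A R x₀ x l)
        ((fderiv ℝ (kernelProjection A R x₀) x).flip l) x := by
      simpa using hV.hasFDerivAt.clm_apply (hasFDerivAt_const l x)
    have h3 : HasFDerivAt (fun x ↦ ρ (kernelProjection A R x₀ x l))
        (ρ ∘L (fderiv ℝ (kernelProjection A R x₀) x).flip l) x := ρ.hasFDerivAt.comp x h2
    have h4 : (fun x ↦ ρ (kernelProjection A R x₀ x l)) = fun _ ↦ (l : E) := funext h1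
    rw [h4] at h3
    have h5 := congrArg (fun L ↦ L u) (h3.unique (hasFDerivAt_const _ _))
    refine ⟨A x₀ (fderiv ℝ (kernelProjection A R x₀) x u l), ?_⟩
    exact sub_eq_zero.1 h5
  have hker : ∀ u l, fderiv ℝ A x u (kernelProjection A R x₀ x l) +
      A x (fderiv ℝ (kernelProjection A R x₀) x u l) = 0 := by
    intro u l
    have h2 : HasFDerivAt (fun x ↦ kernelProjection A R x₀ x l)
        ((fderiv ℝ (kernelProjection A R x₀) x).flip l) x := by
      simpa using hV.hasFDerivAt.clm_apply (hasFDerivAt_const l x)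
    have h3 := hAd.hasFDerivAt.clm_apply h2
    have h4 : (fun x ↦ A x (kernelProjection A R x₀ x l)) =ᶠ[𝓝 x] fun _ ↦ (0 : W) :=
      hxx.mono fun x hx ↦ apply_kernelProjection hx l
    have h5 := congrArg (fun L ↦ L u)
      (h3.unique ((hasFDerivAt_const (0 : W) x).congr_of_eventuallyEq h4))
    rw [add_comm]
    exact h5
  obtain ⟨w₁, h1⟩ := hrange (kernelProjection A R x₀ x k) l
  obtain ⟨w₂, h2⟩ := hrange (kernelProjection A R x₀ x l) k
  have h3 := hker (kernelProjection A R x₀ x k) l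
  have h4 := hker (kernelProjection A R x₀ x l) k
  have h5 := hdx _ _ (apply_kernelProjection hx k) (apply_kernelProjection hx l)
  rw [h5] at h3
  have h6 : A x (R w₁) = A x (R w₂) := by
    rw [← h1, ← h2]
    exact add_left_cancel (h3.trans h4.symm)
  rw [h1, h2, ← (hx w₁).1, ← (hx w₂).1, ContinuousLinearMap.comp_apply, h6]
  rfl

/-- The Frobenius theorem for the kernel of a vector-valued one-form `A` of maximal rank. -/
theorem exists_integral_ball (hA : ∀ᶠ x in 𝓝 x₀, ContDiffAt ℝ ∞ A x)
    (hsurj : Function.Surjective (A x₀))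
    (hd : ∀ᶠ x in 𝓝 x₀, ∀ a b, A x a = 0 → A x b = 0 → fderiv ℝ A x a b = fderiv ℝ A x b a)
    {U : Set E} (hU : U ∈ 𝓝 x₀) :
    ∃ δ > 0, ∃ y : LinearMap.ker (A x₀).toLinearMap → E, y 0 = x₀ ∧
      ContDiffOn ℝ ∞ y (ball 0 δ) ∧ InjOn y (ball 0 δ) ∧ ∀ t ∈ ball 0 δ, y t ∈ U ∧
        Function.Injective (fderiv ℝ y t) ∧ ∀ v, v ∈ range (fderiv ℝ y t) ↔ A (y t) v = 0 := by
  obtain ⟨R', hR'⟩ := LinearMap.exists_rightInverse_of_surjective (A x₀).toLinearMap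
    (LinearMap.range_eq_top.2 hsurj)
  let R : W →L[ℝ] E := LinearMap.toContinuousLinearMap R'
  have hR : ∀ w, A x₀ (R w) = w := fun w ↦ congrArg (fun L ↦ L w) hR'
  have hinv := eventually_inverse_comp hR hA.self_of_nhds.continuousAt
  obtain ⟨δ, hδ, y, hy0, hys, hy⟩ := exists_hasFDerivAt_of_integrable
    (V := kernelProjection A R x₀)
    ((hA.and hinv).mono fun x hx ↦ contDiffAt_kernelProjection hx.1 hx.2)
    (fderiv_kernelProjection_comm hA hR hd) (Filter.inter_mem hU hinv)
  let ρ : E →L[ℝ] E := ContinuousLinearMap.id ℝ E - R ∘L A x₀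
  have hρ : ∀ x k, ρ (kernelProjection A R x₀ x k) = k := sub_kernelProjection hR
  refine ⟨δ, hδ, y, hy0, hys, ?_, fun t ht ↦ ⟨(hy t ht).1.1, ?_, fun v ↦ ?_⟩⟩
  · have h1 : ∀ t ∈ ball (0 : LinearMap.ker (A x₀).toLinearMap) δ,
        HasFDerivWithinAt (𝕜 := ℝ) (fun t ↦ ρ (y t) - (t : E)) 0 (ball 0 δ) t := by
      intro t ht
      have h2 : HasFDerivAt (fun t ↦ ρ (y t) - (t : E)) (ρ ∘L kernelProjection A R x₀ (y t) -
          (LinearMap.ker (A x₀).toLinearMap).subtypeL) t :=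
        (ρ.hasFDerivAt.comp t (hy t ht).2).sub
          (LinearMap.ker (A x₀).toLinearMap).subtypeL.hasFDerivAt
      have h3 : ρ ∘L kernelProjection A R x₀ (y t) -
          (LinearMap.ker (A x₀).toLinearMap).subtypeL = 0 := by
        ext k
        exact sub_eq_zero.2 (hρ _ k)
      rw [h3] at h2
      exact h2.hasFDerivWithinAt
    intro t ht t' ht' htt'
    have h4 := (convex_ball _ _).norm_image_sub_le_of_norm_hasFDerivWithin_le h1
      (C := 0) (fun _ _ ↦ by simp) ht ht'
    rw [zero_mul, norm_le_zero_iff, sub_eq_zero] at h4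
    rw [htt'] at h4
    exact Subtype.ext (sub_right_injective h4).symm
  · rw [(hy t ht).2.fderiv]
    intro k l hkl
    exact Subtype.ext ((hρ _ k).symm.trans ((congrArg ρ hkl).trans (hρ _ l)))
  · rw [(hy t ht).2.fderiv]
    constructor
    · rintro ⟨k, rfl⟩
      exact apply_kernelProjection (hy t ht).1.2 k
    · intro hv
      exact exists_kernelProjection_eq hR (hy t ht).1.2 hv

end Frobenius

section Leaf

theorem bijective_mfderiv_of_isOpenEmbedding {G : Type*} [NormedAddCommGroup G] [NormedSpace ℝ G]
    {L : Type*} [TopologicalSpace L] [Nonempty L] {ι : L → G} (h : Topology.IsOpenEmbedding ι) (x : L) :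
    letI := h.singletonChartedSpace
    Function.Bijective (mfderiv 𝓘(ℝ, G) 𝓘(ℝ, G) ι x) := by
  let := h.singletonChartedSpace
  have : IsManifold 𝓘(ℝ, G) ∞ L := h.isManifold_singleton
  have hx : x ∈ (chartAt G x).source := mem_chart_source G x
  have h1 := tangentCoord_eq_mfderiv hx
  have h2 : (chartAt G x : L → G) = ι := h.singletonChartedSpace_chartAt_eq
  rw [h2] at h1
  rw [← h1]
  exact ⟨fun v w hvw ↦ by
    rw [← coordFrame_tangentCoord hx v, ← coordFrame_tangentCoord hx w]
    exact congrArg _ hvw,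
    fun a ↦ ⟨coordFrame x x a, tangentCoord_coordFrame hx a⟩⟩

variable {F : Type*} [NormedAddCommGroup F] [NormedSpace ℝ F]
  {N : Type u} [TopologicalSpace N] [ChartedSpace F N] [IsManifold 𝓘(ℝ, F) ∞ N]

theorem mfderiv_chartAt_symm (p : N) {x : F} (hx : x ∈ (chartAt F p).target) (a : F) :
    mfderiv 𝓘(ℝ, F) 𝓘(ℝ, F) (chartAt F p).symm x a = coordFrame p ((chartAt F p).symm x) a := by
  have hq : (chartAt F p).symm x ∈ (chartAt F p).source := (chartAt F p).map_target hx
  rw [← coordFrame_tangentCoord hq (mfderiv 𝓘(ℝ, F) 𝓘(ℝ, F) (chartAt F p).symm x a),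
    tangentCoord_eq_mfderiv hq]
  have h1 := mfderiv_comp x (mdifferentiableAt_atlas (I := 𝓘(ℝ, F)) (chart_mem_atlas F p) hq)
    (mdifferentiableAt_atlas_symm (I := 𝓘(ℝ, F)) (chart_mem_atlas F p) hx)
  have h2 : chartAt F p ∘ (chartAt F p).symm =ᶠ[𝓝 x] id := by
    filter_upwards [(chartAt F p).open_target.mem_nhds hx] with z hz
    exact (chartAt F p).right_inv hz
  rw [h2.mfderiv_eq, mfderiv_id] at h1
  exact congrArg _ (congrArg (fun T ↦ T a) h1).symm

theorem exists_isLeaf_of_chart {k : ℕ} {p : N} {D : ∀ q : N, Submodule ℝ (TangentSpace 𝓘(ℝ, F) q)}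
    {B : Set (EuclideanSpace ℝ (Fin k))} (hB : IsOpen B) (hBc : Convex ℝ B)
    {y : EuclideanSpace ℝ (Fin k) → F} (hy : ContDiffOn ℝ ∞ y B) (hinj : InjOn y B)
    (ht : ∀ t ∈ B, y t ∈ (chartAt F p).target ∧ Function.Injective (fderiv ℝ y t) ∧
      ∀ v, v ∈ range (fderiv ℝ y t) ↔
        coordFrame p ((chartAt F p).symm (y t)) v ∈ D ((chartAt F p).symm (y t)))
    {t₀ : EuclideanSpace ℝ (Fin k)} (ht₀ : t₀ ∈ B) :
    ∃ (L : Type u) (_ : TopologicalSpace L) (_ : ChartedSpace (EuclideanSpace ℝ (Fin k)) L)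
      (_ : IsManifold (𝓡 k) ∞ L) (j : L → N), IsLeaf (I := 𝓘(ℝ, F)) (𝓡 k) D j ∧
        ∃ l, j l = (chartAt F p).symm (y t₀) := by
  let L : Type u := ULift.{u} B
  let ι : L → EuclideanSpace ℝ (Fin k) := fun l ↦ l.down
  have hι : Topology.IsOpenEmbedding ι := hB.isOpenEmbedding_subtypeVal.comp Homeomorph.ulift.isOpenEmbedding
  have : Nonempty L := ⟨⟨⟨t₀, ht₀⟩⟩⟩
  let cs := hι.singletonChartedSpace
  have hm : IsManifold (𝓡 k) ∞ L := hι.isManifold_singleton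
  have hιs : ContMDiff (𝓡 k) (𝓡 k) ∞ ι := contMDiff_isOpenEmbedding hι
  have hmem : ∀ l, ι l ∈ B := fun l ↦ l.down.2
  let j : L → N := fun l ↦ (chartAt F p).symm (y (ι l))
  have hyd : ∀ l, ContDiffAt ℝ ∞ y (ι l) := fun l ↦
    (hy _ (hmem l)).contDiffAt (hB.mem_nhds (hmem l))
  have hsym : ∀ l, ContMDiffAt 𝓘(ℝ, F) 𝓘(ℝ, F) ∞ (chartAt F p).symm (y (ι l)) := fun l ↦
    contMDiffAt_symm_of_mem_maximalAtlas (IsManifold.chart_mem_maximalAtlas p) (ht _ (hmem l)).1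
  have hyι : ∀ l, ContMDiffAt (𝓡 k) 𝓘(ℝ, F) ∞ (fun l ↦ y (ι l)) l := fun l ↦
    ContMDiffAt.comp l (contMDiffAt_iff_contDiffAt.2 (hyd l)) (hιs l)
  have hj : ∀ l, ContMDiffAt (𝓡 k) 𝓘(ℝ, F) ∞ j l := fun l ↦ ContMDiffAt.comp l (hsym l) (hyι l)
  have hdj : ∀ l v, mfderiv (𝓡 k) 𝓘(ℝ, F) j l v = coordFrame p (j l)
      (fderiv ℝ y (ι l) (mfderiv (𝓡 k) (𝓡 k) ι l v)) := by
    intro l v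
    have h1 := mfderiv_comp l ((hsym l).mdifferentiableAt (by simp))
      ((hyι l).mdifferentiableAt (by simp))
    have h2 := mfderiv_comp l ((contMDiffAt_iff_contDiffAt.2 (hyd l)).mdifferentiableAt (by simp))
      ((hιs l).mdifferentiableAt (by simp))
    have h3 := congrArg (fun T ↦ T v) h1
    have h4 := congrArg (fun T ↦ T v) h2
    rw [mfderiv_eq_fderiv] at h4
    refine h3.trans ?_
    refine (mfderiv_chartAt_symm p (ht _ (hmem l)).1 _).trans ?_
    exact congrArg _ h4
  have hsrc : ∀ l, j l ∈ (chartAt F p).source := fun l ↦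
    (chartAt F p).map_target (ht _ (hmem l)).1
  have hcinj : ∀ l, Function.Injective (coordFrame (E := F) p (j l)) := fun l a b hab ↦ by
    rw [← tangentCoord_coordFrame (hsrc l) a, hab, tangentCoord_coordFrame (hsrc l)]
  have hbij := fun l ↦ bijective_mfderiv_of_isOpenEmbedding hι l
  refine ⟨L, inferInstance, cs, hm, j, ⟨?_, ⟨hj, fun l v w hvw ↦ ?_⟩, ?_, fun l ↦ ?_⟩,
    ⟨⟨t₀, ht₀⟩⟩, rfl⟩
  · have : ConnectedSpace B := isConnected_iff_connectedSpace.1 ⟨⟨t₀, ht₀⟩, hBc.isPreconnected⟩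
    exact Homeomorph.ulift.symm.surjective.connectedSpace Homeomorph.ulift.symm.continuous
  · rw [hdj, hdj] at hvw
    exact (hbij l).1 ((ht _ (hmem l)).2.1 (hcinj l hvw))
  · intro l l' hll'
    have h1 := (chartAt F p).symm.injOn (ht _ (hmem l)).1 (ht _ (hmem l')).1 hll'
    exact hι.injective (hinj (hmem l) (hmem l') h1)
  · ext v
    constructor
    · rintro ⟨w, rfl⟩
      change mfderiv (𝓡 k) 𝓘(ℝ, F) j l w ∈ D (j l)
      rw [hdj]
      exact ((ht _ (hmem l)).2.2 _).1 ⟨_, rfl⟩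
    · intro hv
      have h1 : tangentCoord p (j l) v ∈ range (fderiv ℝ y (ι l)) := by
        refine ((ht _ (hmem l)).2.2 _).2 ?_
        have h2 := coordFrame_tangentCoord (hsrc l) v
        exact h2.symm ▸ hv
      obtain ⟨a, ha⟩ := h1
      obtain ⟨w, hw⟩ := (hbij l).2 a
      refine ⟨w, ?_⟩
      change mfderiv (𝓡 k) 𝓘(ℝ, F) j l w = v
      rw [hdj, ← coordFrame_tangentCoord (hsrc l) v, ← ha]
      exact congrArg _ (congrArg _ hw)

end Leaf

section Integrability

variable {F : Type*} [NormedAddCommGroup F] [NormedSpace ℝ F] [FiniteDimensional ℝ F]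
  {N : Type u} [TopologicalSpace N] [ChartedSpace F N] [IsManifold 𝓘(ℝ, F) ∞ N]

/-- The one-forms `g(X_i, ·)` in the preferred trivialization at `p`. -/
def frameForms (g : BilinField 𝓘(ℝ, F) N) {r : ℕ} (X : Fin r → ∀ q : N, TangentSpace 𝓘(ℝ, F) q)
    (p q : N) : F →L[ℝ] Fin r → ℝ :=
  ContinuousLinearMap.pi fun i ↦ g q (X i q) ∘L coordFrame p q

theorem frameForms_apply (g : BilinField 𝓘(ℝ, F) N) {r : ℕ}
    (X : Fin r → ∀ q : N, TangentSpace 𝓘(ℝ, F) q) (p q : N) (a : F) (i : Fin r) :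
    frameForms g X p q a i = g q (X i q) (coordFrame p q a) := rfl

variable {g : BilinField 𝓘(ℝ, F) N} {D : ∀ q : N, Submodule ℝ (TangentSpace 𝓘(ℝ, F) q)}
  {r : ℕ} {X : Fin r → ∀ q : N, TangentSpace 𝓘(ℝ, F) q}

theorem frameForms_eq_zero_iff {p q : N} (hX : Submodule.span ℝ (range fun i ↦ X i q) = D q)
    (a : F) : frameForms g X p q a = 0 ↔ coordFrame p q a ∈ orthDistribution g D q := by
  constructor
  · intro h w hw
    rw [← hX] at hw
    induction hw using Submodule.span_induction with
    | mem w hw =>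
      obtain ⟨i, rfl⟩ := hw
      exact congrFun h i
    | zero => simp
    | add v w _ _ h1 h2 => rw [map_add, _root_.add_apply, h1, h2, add_zero]
    | smul c v _ h1 => rw [map_smul, _root_.smul_apply, h1, smul_zero]
  · intro h
    funext i
    exact h (X i q) (hX ▸ Submodule.subset_span ⟨i, rfl⟩)

theorem surjective_frameForms (hnd : ∀ p v, (∀ w, g p v w = 0) → v = 0) {p q : N}
    (hq : q ∈ (chartAt F p).source) (hX : LinearIndependent ℝ fun i ↦ X i q) :
    Function.Surjective (frameForms g X p q) := by
  have hdual := LinearMap.dualMap_injective_iff (f := (frameForms g X p q).toLinearMap)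
  refine hdual.1 (LinearMap.ker_eq_bot.1 (LinearMap.ker_eq_bot'.2 fun l hl ↦ ?_))
  have h1 : ∑ i, l (Pi.single i 1) • X i q = 0 := by
    refine hnd q _ fun w ↦ ?_
    have h2 : l (frameForms g X p q (tangentCoord p q w)) = 0 := LinearMap.congr_fun hl (tangentCoord p q w)
    rw [LinearMap.pi_apply_eq_sum_univ] at h2
    simp only [frameForms_apply, coordFrame_tangentCoord hq] at h2
    rw [map_sum, _root_.sum_apply, ← h2]
    refine Finset.sum_congr rfl fun i _ ↦ ?_
    rw [map_smul, _root_.smul_apply, smul_eq_mul, smul_eq_mul, mul_comm]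
    congr 2
    funext j
    simp [Pi.single_apply, eq_comm]
  have h3 := Fintype.linearIndependent_iff.1 hX _ h1
  refine LinearMap.pi_ext' fun i ↦ LinearMap.ext_ring ?_
  simpa using h3 i

theorem contMDiffAt_frameForms
    (hg : ∀ {X Y : ∀ q : N, TangentSpace 𝓘(ℝ, F) q} {q : N},
      ContMDiffAt 𝓘(ℝ, F) 𝓘(ℝ, F).tangent ∞ (fun q ↦ TotalSpace.mk' F q (X q)) q →
      ContMDiffAt 𝓘(ℝ, F) 𝓘(ℝ, F).tangent ∞ (fun q ↦ TotalSpace.mk' F q (Y q)) q →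
      ContMDiffAt 𝓘(ℝ, F) 𝓘(ℝ, ℝ) ∞ (fun q ↦ g q (X q) (Y q)) q) {p q : N}
    (hq : q ∈ (chartAt F p).source)
    (hX : ∀ i, ContMDiffAt 𝓘(ℝ, F) 𝓘(ℝ, F).tangent ∞ (fun q ↦ TotalSpace.mk' F q (X i q)) q) :
    ContMDiffAt 𝓘(ℝ, F) 𝓘(ℝ, F →L[ℝ] Fin r → ℝ) ∞ (frameForms g X p) q :=
  contMDiffAt_clm_of_apply fun a ↦ contMDiffAt_pi_space.2 fun i ↦
    hg (hX i) (contMDiffAt_coordFrame hq a)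

theorem mvfderiv_frameForms_comm
    {covN : CovariantDerivative 𝓘(ℝ, F) F (TangentSpace 𝓘(ℝ, F) : N → Type _)}
    (hcovN : IsLeviCivita g covN) {p q : N} (hq : q ∈ (chartAt F p).source) {i : Fin r}
    (hX : MDifferentiableAt 𝓘(ℝ, F) 𝓘(ℝ, F).tangent (fun q ↦ TotalSpace.mk' F q (X i q)) q)
    {a b : F} (hab : g q (covN (X i) q (coordFrame p q a)) (coordFrame p q b) =
      g q (covN (X i) q (coordFrame p q b)) (coordFrame p q a)) :
    mvfderiv 𝓘(ℝ, F) (fun q ↦ frameForms g X p q b i) q (coordFrame p q a) =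
      mvfderiv 𝓘(ℝ, F) (fun q ↦ frameForms g X p q a i) q (coordFrame p q b) := by
  simp only [frameForms_apply]
  rw [hcovN.metric _ _ q _ hX (mdifferentiableAt_coordFrame hq b),
    hcovN.metric _ _ q _ hX (mdifferentiableAt_coordFrame hq a), hab,
    cov_coordFrame_comm hcovN hq b a]

/-- If the forms `g(∇X, ·)` are symmetric on `D^⊥` for all sections `X` of `D`, then `D^⊥` has a
leaf through every point. -/
theorem exists_isLeaf_orthDistribution
    {covN : CovariantDerivative 𝓘(ℝ, F) F (TangentSpace 𝓘(ℝ, F) : N → Type _)}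
    (hcovN : IsLeviCivita g covN) (hnd : ∀ p v, (∀ w, g p v w = 0) → v = 0)
    (hg : ∀ {X Y : ∀ q : N, TangentSpace 𝓘(ℝ, F) q} {q : N},
      ContMDiffAt 𝓘(ℝ, F) 𝓘(ℝ, F).tangent ∞ (fun q ↦ TotalSpace.mk' F q (X q)) q →
      ContMDiffAt 𝓘(ℝ, F) 𝓘(ℝ, F).tangent ∞ (fun q ↦ TotalSpace.mk' F q (Y q)) q →
      ContMDiffAt 𝓘(ℝ, F) 𝓘(ℝ, ℝ) ∞ (fun q ↦ g q (X q) (Y q)) q)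
    (hD : IsSmoothDistribution D)
    (hint : ∀ {X : ∀ q : N, TangentSpace 𝓘(ℝ, F) q} {p : N},
      MDifferentiableAt 𝓘(ℝ, F) 𝓘(ℝ, F).tangent (fun q ↦ TotalSpace.mk' F q (X q)) p →
      (∀ᶠ q in 𝓝 p, X q ∈ D q) → ∀ a ∈ orthDistribution g D p, ∀ b ∈ orthDistribution g D p,
        g p (covN X p a) b = g p (covN X p b) a) (p : N) :
    ∃ (k : ℕ) (L : Type u) (_ : TopologicalSpace L)
      (_ : ChartedSpace (EuclideanSpace ℝ (Fin k)) L) (_ : IsManifold (𝓡 k) ∞ L) (j : L → N),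
      IsLeaf (I := 𝓘(ℝ, F)) (𝓡 k) (orthDistribution g D) j ∧ ∃ l, j l = p := by
  obtain ⟨U, hU, hpU, r, X, hXs, hX⟩ := hD p
  have hs : p ∈ (chartAt F p).source := mem_chart_source F p
  have htp : chartAt F p p ∈ (chartAt F p).target := mem_chart_target F p
  have hsymp : (chartAt F p).symm (chartAt F p p) = p := (chartAt F p).left_inv hs
  set x₀ := chartAt F p p with hx₀
  have hXq : ∀ q ∈ U, ∀ i,
      ContMDiffAt 𝓘(ℝ, F) 𝓘(ℝ, F).tangent ∞ (fun q ↦ TotalSpace.mk' F q (X i q)) q :=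
    fun q hq i ↦ (hXs i).contMDiffAt (hU.mem_nhds hq)
  let A : F → F →L[ℝ] Fin r → ℝ := fun x ↦ frameForms g X p ((chartAt F p).symm x)
  -- the set of good coordinates
  let T : Set F := (chartAt F p).target ∩ (chartAt F p).symm ⁻¹' U
  have hT : IsOpen T := (chartAt F p).isOpen_inter_preimage_symm hU
  have hx₀T : x₀ ∈ T := ⟨htp, by rw [mem_preimage, hsymp]; exact hpU⟩
  have hsrc : ∀ x ∈ T, (chartAt F p).symm x ∈ (chartAt F p).source := fun x hx ↦
    (chartAt F p).map_target hx.1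
  have hA : ∀ x ∈ T, ContDiffAt ℝ ∞ A x := by
    intro x hx
    rw [← contMDiffAt_iff_contDiffAt]
    exact ContMDiffAt.comp (I' := 𝓘(ℝ, F)) (g := frameForms g X p) x
      (contMDiffAt_frameForms hg (hsrc x hx) (hXq _ hx.2))
      (contMDiffAt_symm_of_mem_maximalAtlas (IsManifold.chart_mem_maximalAtlas p) hx.1)
  have hfd : ∀ x ∈ T, ∀ a b i, fderiv ℝ A x a b i =
      mvfderiv 𝓘(ℝ, F) (fun q ↦ frameForms g X p q b i) ((chartAt F p).symm x)
        (coordFrame p ((chartAt F p).symm x) a) := by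
    intro x hx a b i
    have h1 : MDifferentiableAt 𝓘(ℝ, F) 𝓘(ℝ, ℝ) (fun q ↦ frameForms g X p q b i)
        ((chartAt F p).symm x) :=
      (hg (hXq _ hx.2 i) (contMDiffAt_coordFrame (hsrc x hx) b)).mdifferentiableAt (by simp)
    have h2 := mvfderiv_coordFrame (hsrc x hx) h1 a
    rw [(chartAt F p).right_inv hx.1] at h2
    refine Eq.trans ?_ h2.symm
    have h3 := ((hA x hx).differentiableAt (by simp)).hasFDerivAt.clm_apply (hasFDerivAt_const b x)
    have h5 := (hasFDerivAt_pi'.1 h3 i).fderiv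
    have h6 := congrArg (fun T ↦ T a) h5
    simp only [ContinuousLinearMap.comp_apply, _root_.add_apply, ContinuousLinearMap.flip_apply,
      _root_.zero_apply, map_zero, zero_add, ContinuousLinearMap.proj_apply] at h6
    exact h6.symm
  have hker : ∀ x ∈ T, ∀ a, A x a = 0 ↔ coordFrame p ((chartAt F p).symm x) a ∈
      orthDistribution g D ((chartAt F p).symm x) := fun x hx a ↦
    frameForms_eq_zero_iff (hX _ hx.2).2 a
  have hd : ∀ x ∈ T, ∀ a b, A x a = 0 → A x b = 0 → fderiv ℝ A x a b = fderiv ℝ A x b a := by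
    intro x hx a b ha hb
    funext i
    rw [hfd x hx, hfd x hx]
    have h1 := (hXq _ hx.2 i).mdifferentiableAt (by simp)
    refine mvfderiv_frameForms_comm hcovN (hsrc x hx) h1
      (hint h1 ?_ _ ((hker x hx a).1 ha) _ ((hker x hx b).1 hb))
    filter_upwards [hU.mem_nhds hx.2] with q hq
    rw [← (hX q hq).2]
    exact Submodule.subset_span ⟨i, rfl⟩
  have hsurj : Function.Surjective (A x₀) := by
    have h1 := surjective_frameForms hnd hs (hX p hpU).1
    simp only [A, hsymp]
    exact h1
  have hTn : ∀ᶠ x in 𝓝 x₀, x ∈ T := hT.mem_nhds hx₀T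
  obtain ⟨δ, hδ, y, hy0, hys, hyi, hy⟩ := exists_integral_ball (hTn.mono hA) hsurj
    (hTn.mono hd) (hT.mem_nhds hx₀T)
  let k := Module.finrank ℝ (LinearMap.ker (A x₀).toLinearMap)
  let ψ : EuclideanSpace ℝ (Fin k) ≃L[ℝ] LinearMap.ker (A x₀).toLinearMap :=
    ContinuousLinearEquiv.ofFinrankEq (by simp [k])
  have hfd' : ∀ t ∈ ψ ⁻¹' Metric.ball 0 δ, ∀ v, fderiv ℝ (y ∘ ψ) t v = fderiv ℝ y (ψ t) (ψ v) := by
    intro t _ v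
    rw [ψ.comp_right_fderiv]
    rfl
  have hlf := exists_isLeaf_of_chart (p := p) (D := orthDistribution g D)
    (B := ψ ⁻¹' Metric.ball 0 δ)
    (Metric.isOpen_ball.preimage ψ.continuous) ((convex_ball _ _).linear_preimage ψ.toLinearMap)
    (y := y ∘ ψ) (hys.comp ψ.contDiff.contDiffOn fun t ht ↦ ht)
    (hyi.comp ψ.injective.injOn fun t ht ↦ ht) (fun t ht ↦ ?_) (t₀ := 0) (by simp [hδ])
  · obtain ⟨L, i1, i2, i3, j, h1, l, h2⟩ := hlf
    refine ⟨k, L, i1, i2, i3, j, h1, l, ?_⟩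
    rw [h2, Function.comp_apply, map_zero, hy0, hsymp]
  · obtain ⟨h1, h2, h3⟩ := hy (ψ t) ht
    refine ⟨h1.1, fun v w hvw ↦ ?_, fun v ↦ ?_⟩
    · rw [hfd' t ht, hfd' t ht] at hvw
      exact ψ.injective (h2 hvw)
    · refine Iff.trans ?_ ((h3 v).trans (hker _ h1 v))
      constructor
      · rintro ⟨w, rfl⟩
        exact ⟨ψ w, (hfd' t ht w).symm⟩
      · rintro ⟨w, rfl⟩
        exact ⟨ψ.symm w, by rw [hfd' t ht, ψ.apply_symm_apply]⟩

end Integrability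

section Sections

variable {F : Type*} [NormedAddCommGroup F] [NormedSpace ℝ F] [FiniteDimensional ℝ F]
  {N : Type u} [TopologicalSpace N] [ChartedSpace F N] [IsManifold 𝓘(ℝ, F) ∞ N]
  {g : BilinField 𝓘(ℝ, F) N} {D : ∀ q : N, Submodule ℝ (TangentSpace 𝓘(ℝ, F) q)}

theorem IsSmoothDistribution.exists_section (hD : IsSmoothDistribution D) {p : N}
    {x : TangentSpace 𝓘(ℝ, F) p} (hx : x ∈ D p) : ∃ X : ∀ q : N, TangentSpace 𝓘(ℝ, F) q,
      MDifferentiableAt 𝓘(ℝ, F) 𝓘(ℝ, F).tangent (fun q ↦ TotalSpace.mk' F q (X q)) p ∧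
      (∀ᶠ q in 𝓝 p, X q ∈ D q) ∧ X p = x := by
  obtain ⟨U, hU, hpU, r, X, hXs, hX⟩ := hD p
  rw [← (hX p hpU).2] at hx
  obtain ⟨c, rfl⟩ := (Submodule.mem_span_range_iff_exists_fun ℝ).1 hx
  refine ⟨fun q ↦ ∑ i, c i • X i q, ?_, ?_, rfl⟩
  · refine (diffAlong_iff (F := F) (f := fun q : N ↦ q) mdifferentiableAt_id).2 ?_
    simp only [map_sum, map_smul]
    have h1 : ∀ i, MDifferentiableAt 𝓘(ℝ, F) 𝓘(ℝ, F) (fun q ↦ c i • tangentCoord p q (X i q)) p :=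
      fun i ↦ (mdifferentiableAt_tangentCoord (((hXs i).contMDiffAt
        (hU.mem_nhds hpU)).mdifferentiableAt (by simp))).const_smul (c i)
    exact (mvfderiv_finset_sum Finset.univ (fun i _ ↦ h1 i) 0).1
  · filter_upwards [hU.mem_nhds hpU] with q hq
    rw [← (hX q hq).2]
    exact Submodule.sum_mem _ fun i _ ↦
      Submodule.smul_mem _ _ (Submodule.subset_span ⟨i, rfl⟩)

theorem IsSmoothDistribution.exists_section_orthDistribution (hD : IsSmoothDistribution D)
    (hnd : ∀ p v, (∀ w, g p v w = 0) → v = 0)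
    (hg : ∀ {X Y : ∀ q : N, TangentSpace 𝓘(ℝ, F) q} {q : N},
      ContMDiffAt 𝓘(ℝ, F) 𝓘(ℝ, F).tangent ∞ (fun q ↦ TotalSpace.mk' F q (X q)) q →
      ContMDiffAt 𝓘(ℝ, F) 𝓘(ℝ, F).tangent ∞ (fun q ↦ TotalSpace.mk' F q (Y q)) q →
      ContMDiffAt 𝓘(ℝ, F) 𝓘(ℝ, ℝ) ∞ (fun q ↦ g q (X q) (Y q)) q) {p : N}
    {z : TangentSpace 𝓘(ℝ, F) p} (hz : z ∈ orthDistribution g D p) :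
    ∃ Z : ∀ q : N, TangentSpace 𝓘(ℝ, F) q,
      MDifferentiableAt 𝓘(ℝ, F) 𝓘(ℝ, F).tangent (fun q ↦ TotalSpace.mk' F q (Z q)) p ∧
      (∀ᶠ q in 𝓝 p, Z q ∈ orthDistribution g D q) ∧ Z p = z := by
  obtain ⟨U, hU, hpU, r, X, hXs, hX⟩ := hD p
  have hs : p ∈ (chartAt F p).source := mem_chart_source F p
  obtain ⟨R', hR'⟩ := LinearMap.exists_rightInverse_of_surjective (frameForms g X p p).toLinearMap
    (LinearMap.range_eq_top.2 (surjective_frameForms hnd hs (hX p hpU).1))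
  let R : (Fin r → ℝ) →L[ℝ] F := LinearMap.toContinuousLinearMap R'
  have hR : ∀ w, frameForms g X p p (R w) = w := fun w ↦ congrArg (fun L ↦ L w) hR'
  have hA : MDifferentiableAt 𝓘(ℝ, F) 𝓘(ℝ, F →L[ℝ] Fin r → ℝ) (frameForms g X p) p :=
    (contMDiffAt_frameForms hg hs fun i ↦
      (hXs i).contMDiffAt (hU.mem_nhds hpU)).mdifferentiableAt (by simp)
  have hinv := eventually_inverse_comp hR hA.continuousAt
  have hid : frameForms g X p p ∘L R = ContinuousLinearMap.id ℝ _ := ContinuousLinearMap.ext hR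
  have hk0 : frameForms g X p p (tangentCoord p p z) = 0 := by
    rw [frameForms_eq_zero_iff (hX p hpU).2, coordFrame_tangentCoord hs]
    exact hz
  let k : LinearMap.ker (frameForms g X p p).toLinearMap := ⟨tangentCoord p p z, hk0⟩
  refine ⟨fun q ↦ coordFrame p q (kernelProjection (frameForms g X p) R p q k), ?_, ?_, ?_⟩
  · refine (diffAlong_iff (F := F) (f := fun q : N ↦ q) mdifferentiableAt_id).2 ?_
    have h1 : MDifferentiableAt 𝓘(ℝ, F) 𝓘(ℝ, (Fin r → ℝ) →L[ℝ] Fin r → ℝ)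
        (fun q ↦ frameForms g X p q ∘L R) p := hA.clm_comp mdifferentiableAt_const
    have h2 : MDifferentiableAt 𝓘(ℝ, F) 𝓘(ℝ, (Fin r → ℝ) →L[ℝ] Fin r → ℝ)
        (fun q ↦ (frameForms g X p q ∘L R).inverse) p := by
      refine MDifferentiableAt.comp (I' := 𝓘(ℝ, (Fin r → ℝ) →L[ℝ] Fin r → ℝ))
        (g := ContinuousLinearMap.inverse) p ?_ h1
      rw [hid]
      exact ((contDiffAt_inverse_id (n := 1)).differentiableAt (by simp)).mdifferentiableAt
    have h3 : MDifferentiableAt 𝓘(ℝ, F) 𝓘(ℝ, F) (fun q ↦ (k : F) -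
        R ((frameForms g X p q ∘L R).inverse (frameForms g X p q k))) p :=
      mdifferentiableAt_const.sub (R.mdifferentiableAt.comp p
        (h2.clm_apply (hA.clm_apply mdifferentiableAt_const)))
    refine h3.congr_of_eventuallyEq ?_
    filter_upwards [chart_source_mem_nhds F p] with q hq
    rw [tangentCoord_coordFrame hq, kernelProjection_apply]
  · filter_upwards [hinv, hU.mem_nhds hpU] with q h1 h2
    exact (frameForms_eq_zero_iff (hX q h2).2 _).1 (apply_kernelProjection h1 k)
  · have h1 : kernelProjection (frameForms g X p) R p p k = tangentCoord p p z := by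
      have h2 : frameForms g X p p (k : F) = 0 := hk0
      rw [kernelProjection_apply, h2, map_zero, map_zero, sub_zero]
    exact (congrArg _ h1).trans (coordFrame_tangentCoord hs z)

end Sections

section LeafCurvature

variable {F : Type*} [NormedAddCommGroup F] [NormedSpace ℝ F] [FiniteDimensional ℝ F]
  {N : Type*} [TopologicalSpace N] [ChartedSpace F N] [IsManifold 𝓘(ℝ, F) ∞ N]
  {g : BilinField 𝓘(ℝ, F) N} {D : ∀ q : N, Submodule ℝ (TangentSpace 𝓘(ℝ, F) q)}
  {G : Type*} [NormedAddCommGroup G] [NormedSpace ℝ G] [FiniteDimensional ℝ G]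
  {L : Type*} [TopologicalSpace L] [ChartedSpace G L] [IsManifold 𝓘(ℝ, G) ∞ L]
  {covN : CovariantDerivative 𝓘(ℝ, F) F (TangentSpace 𝓘(ℝ, F) : N → Type _)}

/-- The component in `D` of the second derivative of an integral manifold of `D^⊥`. -/
theorem bilin_covHess_of_tangent (hcovN : IsLeviCivita g covN) {j : L → N}
    (hj : ContMDiff 𝓘(ℝ, G) 𝓘(ℝ, F) ∞ j)
    (ht : ∀ y v, mfderiv 𝓘(ℝ, G) 𝓘(ℝ, F) j y v ∈ orthDistribution g D (j y)) {y : L}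
    (hg : DiffBilinAt g (j y)) {X : ∀ q : N, TangentSpace 𝓘(ℝ, F) q}
    (hX : MDifferentiableAt 𝓘(ℝ, F) 𝓘(ℝ, F).tangent (fun q ↦ TotalSpace.mk' F q (X q)) (j y))
    (hXD : ∀ᶠ q in 𝓝 (j y), X q ∈ D q) (w z : TangentSpace 𝓘(ℝ, G) y) :
    g (j y) (X (j y)) (covHess covN j y w z) =
      - g (j y) (covN X (j y) (mfderiv 𝓘(ℝ, G) 𝓘(ℝ, F) j y w))
        (mfderiv 𝓘(ℝ, G) 𝓘(ℝ, F) j y z) := by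
  have hs := mem_chart_source G y
  have hjd := hj.mdifferentiable (by simp) y
  have h1 := mvfderiv_bilin_along hcovN hg hjd (DiffAlong.of_field hX hjd)
    (DiffAlong.mfderiv_field hj (mdifferentiableAt_coordFrame hs (tangentCoord y y z))) w
  rw [mvfderiv_eq_zero_of_eventuallyEq_const ((hj.continuous.continuousAt.eventually hXD).mono
    fun q hq ↦ ht q _ _ hq), covAlong_comp hX hjd, coordFrame_tangentCoord hs] at h1
  exact (neg_eq_of_add_eq_zero_right h1.symm).symm

end LeafCurvature

section Main

variable {E : Type*} [NormedAddCommGroup E] [NormedSpace ℝ E] [FiniteDimensional ℝ E]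
  {M : Type*} [TopologicalSpace M] [ChartedSpace E M] [IsManifold 𝓘(ℝ, E) ∞ M]
  {F : Type*} [NormedAddCommGroup F] [NormedSpace ℝ F] [FiniteDimensional ℝ F]
  {N : Type u} [TopologicalSpace N] [ChartedSpace F N] [IsManifold 𝓘(ℝ, F) ∞ N]
  {s : ℕ} {S : IndefiniteSStructure 𝓘(ℝ, E) M s} {f : N → M}
  {D : ∀ p : N, Submodule ℝ (TangentSpace 𝓘(ℝ, F) p)}

theorem SemiRiemannianMetric.contMDiffAt_induced (g : SemiRiemannianMetric 𝓘(ℝ, E) M)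
    (hf : ContMDiff 𝓘(ℝ, F) 𝓘(ℝ, E) ∞ f) {X Y : ∀ x : N, TangentSpace 𝓘(ℝ, F) x} {p : N}
    (hX : ContMDiffAt 𝓘(ℝ, F) 𝓘(ℝ, F).tangent ∞ (fun q ↦ TotalSpace.mk' F q (X q)) p)
    (hY : ContMDiffAt 𝓘(ℝ, F) 𝓘(ℝ, F).tangent ∞ (fun q ↦ TotalSpace.mk' F q (Y q)) p) :
    ContMDiffAt 𝓘(ℝ, F) 𝓘(ℝ, ℝ) ∞
      (fun q ↦ inducedMetric 𝓘(ℝ, F) g.val f q (X q) (Y q)) p := by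
  have hT := hf.contMDiff_tangentMap (m := ∞) le_rfl
  have h : ContMDiffAt 𝓘(ℝ, F) (𝓘(ℝ, E).prod 𝓘(ℝ)) ∞
      (fun q ↦ TotalSpace.mk' ℝ (E := Bundle.Trivial M ℝ) (f q)
        (g.val (f q) (mfderiv 𝓘(ℝ, F) 𝓘(ℝ, E) f q (X q)) (mfderiv 𝓘(ℝ, F) 𝓘(ℝ, E) f q (Y q)))) p :=
    ContMDiffAt.clm_bundle_apply₂ (E₁ := (TangentSpace 𝓘(ℝ, E) : M → Type _)) (F₁ := E)
      (E₂ := (TangentSpace 𝓘(ℝ, E) : M → Type _)) (F₂ := E)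
      (E₃ := Bundle.Trivial M ℝ) (F₃ := ℝ) ((g.contMDiff (f p)).comp p (hf p))
      ((hT _).comp p hX) ((hT _).comp p hY)
  simp only [contMDiffAt_totalSpace] at h
  exact h.2

namespace IsContactCRSubmanifold

variable (hf : IsContactCRSubmanifold S f D)
  {cov : CovariantDerivative 𝓘(ℝ, E) E (TangentSpace 𝓘(ℝ, E) : M → Type _)}
  (hcov : IsLeviCivita S.metric.val cov) (hs : 0 < s)
  {covN : CovariantDerivative 𝓘(ℝ, F) F (TangentSpace 𝓘(ℝ, F) : N → Type _)}
  (hcovN : IsLeviCivita (inducedMetric 𝓘(ℝ, F) S.metric.val f) covN)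
include hf

theorem η_φ_eq_zero {p : N} {x y : TangentSpace 𝓘(ℝ, F) p}
    (hy : mfderiv 𝓘(ℝ, F) 𝓘(ℝ, E) f p y = S.φ (f p) (mfderiv 𝓘(ℝ, F) 𝓘(ℝ, E) f p x))
    (α : Fin s) : S.η α (f p) (mfderiv 𝓘(ℝ, F) 𝓘(ℝ, E) f p y) = 0 := by
  rw [hy]
  exact (S.fAlgebra (f p)).η_φ α _

theorem bilin_secondFundamentalForm (p : N) (u v : TangentSpace 𝓘(ℝ, F) p)
    {w : TangentSpace 𝓘(ℝ, F) p}
    (hw : w ∈ orthDistribution (inducedMetric 𝓘(ℝ, F) S.metric.val f) D p) :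
    S.metric.val (f p) (secondFundamentalForm 𝓘(ℝ, F) S.metric.val cov f p u v)
        (S.φ (f p) (mfderiv 𝓘(ℝ, F) 𝓘(ℝ, E) f p w)) =
      S.metric.val (f p) (covHess cov f p u v)
        (S.φ (f p) (mfderiv 𝓘(ℝ, F) 𝓘(ℝ, E) f p w)) := by
  have : FiniteDimensional ℝ (TangentSpace 𝓘(ℝ, E) (f p)) := inferInstanceAs (FiniteDimensional ℝ E)
  have : FiniteDimensional ℝ (TangentSpace 𝓘(ℝ, F) p) := inferInstanceAs (FiniteDimensional ℝ F)
  have hc := isCompl_orthComplement_range (S.metric.symm (f p))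
    (mfderiv 𝓘(ℝ, F) 𝓘(ℝ, E) f p).toLinearMap fun u hu ↦ hf.nondegenerate p u hu
  rw [secondFundamentalForm,
    covAlong_mfderiv_extend hf.immersion.contMDiff.continuous.continuousAt]
  refine apply_normalComponent hc _ ?_
  rintro _ ⟨v, rfl⟩
  rw [S.metric.symm]
  exact hf.anti_invariant p w hw v

include hcov hs hcovN

theorem bilin_cov_section_comm {X : ∀ q : N, TangentSpace 𝓘(ℝ, F) q} {p : N}
    (hX : MDifferentiableAt 𝓘(ℝ, F) 𝓘(ℝ, F).tangent (fun q ↦ TotalSpace.mk' F q (X q)) p)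
    (hXD : ∀ᶠ q in 𝓝 p, X q ∈ D q) {a b : TangentSpace 𝓘(ℝ, F) p}
    (ha : a ∈ orthDistribution (inducedMetric 𝓘(ℝ, F) S.metric.val f) D p)
    (hb : b ∈ orthDistribution (inducedMetric 𝓘(ℝ, F) S.metric.val f) D p) :
    inducedMetric 𝓘(ℝ, F) S.metric.val f p (covN X p a) b =
      inducedMetric 𝓘(ℝ, F) S.metric.val f p (covN X p b) a := by
  obtain ⟨y, hy, hy'⟩ := hf.invariant p _ hXD.self_of_nhds
  rw [hf.bilin_cov_section hcov hs hcovN hX hXD hy' ha hb,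
    hf.bilin_cov_section hcov hs hcovN hX hXD hy' hb ha]
  have hsec := fun {z : TangentSpace 𝓘(ℝ, F) p} ↦
    hf.smooth.exists_section_orthDistribution hf.nondegenerate
      (S.metric.contMDiffAt_induced hf.immersion.contMDiff) (z := z)
  obtain ⟨Z, hZ, hZD, rfl⟩ := hsec ha
  obtain ⟨W, hW, hWD, rfl⟩ := hsec hb
  exact hf.bilin_covHess_comm hcov hs hy (hf.η_φ_eq_zero hy') hZ hW hZD hWD

/-- There is a leaf of `D^⊥` through every point. -/
theorem exists_isLeaf (p : N) : ∃ (k : ℕ) (L : Type u) (_ : TopologicalSpace L)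
      (_ : ChartedSpace (EuclideanSpace ℝ (Fin k)) L) (_ : IsManifold (𝓡 k) ∞ L) (j : L → N),
      IsLeaf (I := 𝓘(ℝ, F)) (𝓡 k)
        (orthDistribution (inducedMetric 𝓘(ℝ, F) S.metric.val f) D) j ∧ ∃ l, j l = p :=
  exists_isLeaf_orthDistribution hcovN hf.nondegenerate
    (S.metric.contMDiffAt_induced hf.immersion.contMDiff) hf.smooth
    (fun hX hXD _ ha _ hb ↦ hf.bilin_cov_section_comm hcov hs hcovN hX hXD ha hb) p

omit hcov hs hcovN in
theorem leaf_secondFundamentalForm_eq_zero_iff {G : Type*} [NormedAddCommGroup G] [NormedSpace ℝ G]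
    [FiniteDimensional ℝ G]
    {L : Type*} [TopologicalSpace L] [ChartedSpace G L] [IsManifold 𝓘(ℝ, G) ∞ L] {j : L → N}
    (hj : IsLeaf (I := 𝓘(ℝ, F)) 𝓘(ℝ, G)
      (orthDistribution (inducedMetric 𝓘(ℝ, F) S.metric.val f) D) j)
    (y : L) (w z : TangentSpace 𝓘(ℝ, G) y) :
    secondFundamentalForm 𝓘(ℝ, G) (inducedMetric 𝓘(ℝ, F) S.metric.val f) covN j y w z = 0 ↔
      ∀ x ∈ D (j y), inducedMetric 𝓘(ℝ, F) S.metric.val f (j y) x (covHess covN j y w z) = 0 := by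
  rw [secondFundamentalForm, covAlong_mfderiv_extend hj.immersion.contMDiff.continuous.continuousAt,
    hj.tangent, normalComponent_eq_zero_iff]
  · rfl
  · rw [hf.orthComplement_orthDistribution]
    exact hf.isCompl (j y)

/-- A leaf of `D^⊥` is totally geodesic at a point if and only if `h(z, φ X)` is orthogonal to
`φ w` there. -/
theorem bilin_covHess_leaf {G : Type*} [NormedAddCommGroup G] [NormedSpace ℝ G]
    [FiniteDimensional ℝ G]
    {L : Type*} [TopologicalSpace L] [ChartedSpace G L] [IsManifold 𝓘(ℝ, G) ∞ L] {j : L → N}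
    (hj : IsLeaf (I := 𝓘(ℝ, F)) 𝓘(ℝ, G)
      (orthDistribution (inducedMetric 𝓘(ℝ, F) S.metric.val f) D) j)
    (y : L) (w z : TangentSpace 𝓘(ℝ, G) y) {x v : TangentSpace 𝓘(ℝ, F) (j y)} (hx : x ∈ D (j y))
    (hv : mfderiv 𝓘(ℝ, F) 𝓘(ℝ, E) f (j y) v =
      S.φ (f (j y)) (mfderiv 𝓘(ℝ, F) 𝓘(ℝ, E) f (j y) x)) :
    inducedMetric 𝓘(ℝ, F) S.metric.val f (j y) x (covHess covN j y w z) =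
      - S.metric.val (f (j y)) (covHess cov f (j y) (mfderiv 𝓘(ℝ, G) 𝓘(ℝ, F) j y w) v)
        (S.φ (f (j y)) (mfderiv 𝓘(ℝ, F) 𝓘(ℝ, E) f (j y) (mfderiv 𝓘(ℝ, G) 𝓘(ℝ, F) j y z))) := by
  have ht : ∀ y v, mfderiv 𝓘(ℝ, G) 𝓘(ℝ, F) j y v ∈
      orthDistribution (inducedMetric 𝓘(ℝ, F) S.metric.val f) D (j y) := fun y v ↦ by
    rw [← hj.tangent]
    exact ⟨v, rfl⟩
  obtain ⟨X, hX, hXD, rfl⟩ := hf.smooth.exists_section hx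
  rw [bilin_covHess_of_tangent hcovN hj.immersion.contMDiff ht
    (DiffBilinAt.induced hf.immersion.contMDiff (S.metric.diffBilinAt _)) hX hXD,
    hf.bilin_cov_section hcov hs hcovN hX hXD hv (ht _ _) (ht _ _)]

end IsContactCRSubmanifold

end Main

theorem proposition2p4 {n s m : ℕ} (hs : 0 < s)
    -- the indefinite S-manifold, of dimension `2n + s`, and its Levi-Civita connection
    {M' : Type*} [TopologicalSpace M'] [T2Space M'] [SecondCountableTopology M']
    [ChartedSpace (EuclideanSpace ℝ (Fin (2 * n + s))) M'] [IsManifold (𝓡 (2 * n + s)) ∞ M']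
    (S : IndefiniteSStructure (𝓡 (2 * n + s)) M' s)
    (cov' : CovariantDerivative (𝓡 (2 * n + s)) (EuclideanSpace ℝ (Fin (2 * n + s)))
      (TangentSpace (𝓡 (2 * n + s)) : M' → Type _))
    (hcov' : IsLeviCivita S.metric.val cov')
    -- the contact CR-submanifold, of dimension `m`, with the Levi-Civita connection of the
    -- induced metric
    {M : Type u} [TopologicalSpace M] [T2Space M] [SecondCountableTopology M]
    [ChartedSpace (EuclideanSpace ℝ (Fin m)) M] [IsManifold (𝓡 m) ∞ M]
    (f : M → M') (D : ∀ p : M, Submodule ℝ (TangentSpace (𝓡 m) p))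
    (hf : IsContactCRSubmanifold S f D)
    (cov : CovariantDerivative (𝓡 m) (EuclideanSpace ℝ (Fin m))
      (TangentSpace (𝓡 m) : M → Type _))
    (hcov : IsLeviCivita (inducedMetric (𝓡 m) S.metric.val f) cov) :
    LeavesTotallyGeodesic (inducedMetric (𝓡 m) S.metric.val f) cov
        (orthDistribution (inducedMetric (𝓡 m) S.metric.val f) D) ↔
      ∀ p : M, ∀ x ∈ D p, (∀ α, S.η α (f p) (mfderiv (𝓡 m) (𝓡 (2 * n + s)) f p x) = 0) →
        ∀ z ∈ orthDistribution (inducedMetric (𝓡 m) S.metric.val f) D p,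
        ∀ w ∈ orthDistribution (inducedMetric (𝓡 m) S.metric.val f) D p,
          S.metric.val (f p) (secondFundamentalForm (𝓡 m) S.metric.val cov' f p x z)
            (S.φ (f p) (mfderiv (𝓡 m) (𝓡 (2 * n + s)) f p w)) = 0 := by
  constructor
  · intro h p y hy hη z hz w hw
    rw [hf.bilin_secondFundamentalForm p y z hw, covHess_comm hcov' hf.immersion.contMDiff]
    obtain ⟨x, hx, hxy⟩ := hf.exists_φ_eq hy hη
    obtain ⟨k, L, i1, i2, i3, j, hj, l, rfl⟩ := hf.exists_isLeaf hcov' hs hcov p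
    rw [← hj.tangent] at hz hw
    obtain ⟨z, rfl⟩ := hz
    obtain ⟨w, rfl⟩ := hw
    have h1 := (hf.leaf_secondFundamentalForm_eq_zero_iff hj l z w).1 (h k L j hj l z w) x hx
    rw [hf.bilin_covHess_leaf hcov' hs hcov hj l z w hx hxy] at h1
    exact neg_eq_zero.1 h1
  · intro h q L _ _ _ j hj y w z
    have ht : ∀ v, mfderiv (𝓡 q) (𝓡 m) j y v ∈
        orthDistribution (inducedMetric (𝓡 m) S.metric.val f) D (j y) := fun v ↦ by
      rw [← hj.tangent]
      exact ⟨v, rfl⟩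
    refine (hf.leaf_secondFundamentalForm_eq_zero_iff hj y w z).2 fun x hx ↦ ?_
    obtain ⟨v, hv, hvx⟩ := hf.invariant _ x hx
    rw [hf.bilin_covHess_leaf hcov' hs hcov hj y w z hx hvx,
      covHess_comm hcov' hf.immersion.contMDiff,
      ← hf.bilin_secondFundamentalForm (j y) v _ (ht z),
      h (j y) v hv (hf.η_φ_eq_zero hvx) _ (ht w) _ (ht z), neg_zero]

end
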